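/- **Proposition 3.1 (Entropic repulsion).** *Setting.* Let $\tilde{\mathbb Z}^2\subset\mathbb C$ be the metric graph of $\mathbb Z^2$, i.e. the union of all closed unit segments between nearest neighbours $u\sim v$ of $\mathbb Z^2$. Let $\tilde K\subset\tilde{\mathbb Z}^2$ be compact and simply connected, meaning that $\tilde K$ is non-empty, connected, and contains every point of $\tilde{\mathbb Z}^2$ that is separated from infinity by a loop in $\tilde K$. Let $\partial\tilde K$ be its boundary relative to $\tilde{\mathbb Z}^2$ and $V=\tilde K\cap\mathbb Z^2$. For a set $W\subset V$, let $\operatorname{Hm}(v,w;W)$ be the probability that Brownian motion on the metric graph started at $v$ first visits $W\cup\partial\tilde K$ at $w$. For finite sets $U,I\subset V$ put $\operatorname{Hm}(U,w;W)=\sum_{u\in U}\operatorname{Hm}(u,w;W)$ and $\operatorname{Hm}(U,I)=\sum_{w\in I}\operatorname{Hm}(U,w;I)$, and let $$D=\{v\in I:\operatorname{Hm}(U,v;I)>0\},\qquad D'=\{v\in I:\operatorname{Hm}(U,v;I\setminus D)>0\},$$ $$\xi(U,I)=\frac{1}{\operatorname{Hm}(U,I)}\sup\{\operatorname{Hm}(U,w;I\setminus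 D):w\in D'\}$$ (with $\xi(U,I)=0$ if $\operatorname{Hm}(U,I)=0$). Assume that for every $v\in D$ all four edges at $v$ are contained in $\tilde K$, and that every $v\in D$ has a neighbour in $I\setminus D$. Let $\lambda\ge 0$ and let $f:\partial\tilde K\to\mathbb R$ satisfy $|f|\le\lambda$. Let $\tilde\phi$ be a metric graph Gaussian free field on $\tilde K$ with boundary condition $f$: a continuous Gaussian process on $\tilde K$ whose mean is the harmonic extension $v\mapsto\sum_{w\in\partial\tilde K}\operatorname{Hm}(v,w;\emptyset)f(w)$ and whose covariance is the Green's function of $\tilde K$ killed on $\partial\tilde K$. The Green's function is normalized so that $G(u,v)$ is the expected number of visits to $v$, divided by the total conductance at $v$, of the random walk from $u$ killed on $\partial\tilde K$ on the electric network with vertex set $\mathbb Z^2\cup\partial\tilde K\cup\{u,v\}$, in which points $x,y$ that are consecutive on an edge have conductance $1/(4|x-y|)$. Let $I=I^+\sqcup I^-$ be a partition such that $D\subseteq I^-$ and every $v\in D$ has a neighbour in $I^+$. Let $$\mathfrak E=\{\tilde\phi(v)<0\ \ \forall v\in I^-\}\cap\{\tilde\phi(v)\ge 0\ \ \forall v\in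 I^+\},\qquad Y=\sum_{v\in D}\operatorname{Hm}(U,v;I)\,\tilde\phi(v),$$ and assume $\mathbb P(\mathfrak E)>0$. *Claim.* There is a universal function $r$ with $r(x)\to0$ as $x\to0$, and for every $\lambda\ge 0$ there is a constant $\Delta=\Delta(\lambda)>0$, such that for all $\tilde K,U,I,I^\pm,f,\tilde\phi$ as above (with this $\lambda$) $$\mathbb P\big(Y\le-\Delta\,\operatorname{Hm}(U,I)\,\big|\,\mathfrak E\big)\ \ge\ 1-r(\xi(U,I)).$$ -/

import Mathlib

open MeasureTheory ProbabilityTheory Filter Topology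

noncomputable section

namespace MetricGFF

/-! ### The square lattice and its metric graph, drawn in the complex plane -/

/-- The lattice `ℤ²`, as a subset of `ℂ`. -/
def lattice : Set ℂ := {z | (∃ m : ℤ, z.re = m) ∧ ∃ n : ℤ, z.im = n}

/-- The metric graph of `ℤ²`, as a subset of `ℂ`: the union of all closed segments between
nearest neighbours. -/
def grid : Set ℂ := {z | (∃ m : ℤ, z.re = m) ∨ ∃ n : ℤ, z.im = n}

/-- Adjacency of lattice points. -/
def Nbr (u v : ℂ) : Prop := u ∈ lattice ∧ v ∈ lattice ∧ ‖u - v‖ = 1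

/-- The boundary of a closed set `K ⊆ grid`, relative to the topological space `grid`. -/
def bdry (K : Set ℂ) : Set ℂ := K ∩ closure (grid \ K)

/-- `K` contains every point of the metric graph that is separated from infinity by a loop in `K`,
i.e. that lies in a bounded component of the complement (in the plane) of such a loop. -/
def FillsLoops (K : Set ℂ) : Prop :=
  ∀ (x : ℂ) (γ : Path x x), Set.range γ ⊆ K →
    ∀ z ∈ grid \ Set.range γ,
      Bornology.IsBounded (connectedComponentIn (Set.range γ)ᶜ z) → z ∈ K

/-- Compact and simply connected subsets of the metric graph. The faces of the grid do not belong
to the metric graph, so a set may contain the cycle around a face and be simply connected. -/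
structure IsSimplyConnectedCompact (K : Set ℂ) : Prop where
  subset_grid : K ⊆ grid
  isCompact : IsCompact K
  isConnected : IsConnected K
  fillsLoops : FillsLoops K

/-! ### The electric network on a vertex set `N` with `lattice ⊆ N ⊆ grid`

The sequence of distinct points of `N` visited by Brownian motion on the metric graph is the random
walk on this network. -/

/-- `u, v ∈ N` are joined when the metric graph contains the segment between them and no other
point of `N` lies on that segment. -/
def Joined (N : Set ℂ) (u v : ℂ) : Prop :=
  u ∈ N ∧ v ∈ N ∧ u ≠ v ∧ segment ℝ u v ⊆ grid ∧ openSegment ℝ u v ∩ N = ∅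

open Classical in
/-- The conductance `1 / (4 |u - v|)` of the edge between `u` and `v`. -/
def conductance (N : Set ℂ) (u v : ℂ) : ℝ :=
  if Joined N u v then (4 * ‖u - v‖)⁻¹ else 0

/-- The total conductance at `u`; it is `1` at a lattice point all of whose neighbours in the
network are lattice points. -/
def totalConductance (N : Set ℂ) (u : ℂ) : ℝ := ∑ᶠ v, conductance N u v

/-- One-step transition probabilities of the random walk on the network. -/
def stepProb (N : Set ℂ) (u v : ℂ) : ℝ := conductance N u v / totalConductance N u

open Classical in
/-- The probability that the walk started at `u` visits `S` for the first time at time `n`,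
and is then at `w`. -/
def firstHitProb (N S : Set ℂ) : ℕ → ℂ → ℂ → ℝ
  | 0, u, w => if u ∈ S ∧ u = w then 1 else 0
  | n + 1, u, w => if u ∈ S then 0 else ∑ᶠ v, stepProb N u v * firstHitProb N S n v w

open Classical in
/-- The probability that the walk started at `u` is at `w` at time `n` and has not visited `S`
up to and including time `n`. -/
def killedProb (N S : Set ℂ) : ℕ → ℂ → ℂ → ℝ
  | 0, u, w => if u ∉ S ∧ u = w then 1 else 0
  | n + 1, u, w => if u ∈ S then 0 else ∑ᶠ v, stepProb N u v * killedProb N S n v w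

/-! ### Harmonic measure and Green's function on the metric graph -/

/-- Harmonic measure `Hm(v, w; W)`: the probability that Brownian motion on the metric graph
started at `v` visits `W ∪ ∂K` for the first time at `w`. -/
def hm (K W : Set ℂ) (v w : ℂ) : ℝ :=
  ∑' n, firstHitProb (lattice ∪ bdry K ∪ W ∪ {v}) (W ∪ bdry K) n v w

/-- `Hm(U, w; W) = ∑_{u ∈ U} Hm(u, w; W)`. -/
def hmSum (K : Set ℂ) (U : Finset ℂ) (W : Set ℂ) (w : ℂ) : ℝ := ∑ u ∈ U, hm K W u w

/-- `Hm(U, I) = ∑_{u ∈ U} ∑_{w ∈ I} Hm(u, w; I)`. -/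
def hmTotal (K : Set ℂ) (U I : Finset ℂ) : ℝ := ∑ w ∈ I, hmSum K U I w

/-- Green's function on `K`, killed on `∂K`: the expected number of visits to `v` of the walk
started at `u`, divided by the total conductance at `v`. -/
def green (K : Set ℂ) (u v : ℂ) : ℝ :=
  (∑' n, killedProb (lattice ∪ bdry K ∪ {u, v}) (bdry K) n u v) /
    totalConductance (lattice ∪ bdry K ∪ {u, v}) v

/-! ### The Gaussian free field on `K` -/

/-- `φ` is a metric graph Gaussian free field on `K` with boundary condition `f`: a continuous
Gaussian process on `K` whose mean is the harmonic extension of `f` and whose covariance is Green's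
function. Only the values of `φ` on `K` and of `f` on `∂K` matter. -/
structure IsGFF {Ω : Type*} [MeasurableSpace Ω] (P : Measure Ω) (K : Set ℂ) (f : ℂ → ℝ)
    (φ : ℂ → Ω → ℝ) : Prop where
  gaussian : IsGaussianProcess (fun v : K => φ v) P
  continuous : ∀ᵐ ω ∂P, ContinuousOn (fun v => φ v ω) K
  mean : ∀ v ∈ K, ∫ ω, φ v ω ∂P = ∑ᶠ w ∈ bdry K, hm K ∅ v w * f w
  cov : ∀ u ∈ K, ∀ v ∈ K, cov[φ u, φ v; P] = green K u v

/-! ### The explored set -/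

open Classical in
/-- `D`: the points of `I` that can be reached from `U`. -/
def reach (K : Set ℂ) (U I : Finset ℂ) : Finset ℂ := {v ∈ I | 0 < hmSum K U I v}

open Classical in
/-- `D'`: the points of `I` that can be reached from `U` once `D` has been removed from `I`. -/
def reach' (K : Set ℂ) (U I : Finset ℂ) : Finset ℂ :=
  {v ∈ I | 0 < hmSum K U (↑I \ ↑(reach K U I)) v}

/-- `ξ(U, I)`. -/
def xi (K : Set ℂ) (U I : Finset ℂ) : ℝ :=
  1 / hmTotal K U I *
    sSup ((fun w => hmSum K U (↑I \ ↑(reach K U I)) w) '' (reach' K U I : Set ℂ))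

/-- The standing assumptions on `K`, `U` and `I`. -/
structure Admissible (K : Set ℂ) (U I : Finset ℂ) : Prop where
  domain : IsSimplyConnectedCompact K
  subset_U : (U : Set ℂ) ⊆ K ∩ lattice
  subset_I : (I : Set ℂ) ⊆ K ∩ lattice
  edges_subset : ∀ v ∈ reach K U I, ∀ w, Nbr v w → segment ℝ v w ⊆ K
  exists_nbr : ∀ v ∈ reach K U I, ∃ w ∈ I, w ∉ reach K U I ∧ Nbr v w

/-- The event that the field is negative on `Im` and nonnegative on `Ip`. -/
def signEvent {Ω : Type*} (φ : ℂ → Ω → ℝ) (Im Ip : Finset ℂ) : Set Ω :=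
  {ω | (∀ v ∈ Im, φ v ω < 0) ∧ ∀ v ∈ Ip, 0 ≤ φ v ω}

/-- `Y = ∑_{v ∈ D} Hm(U, v; I) φ(v)`. -/
def weightedField {Ω : Type*} (K : Set ℂ) (U I : Finset ℂ) (φ : ℂ → Ω → ℝ) (ω : Ω) : ℝ :=
  ∑ v ∈ reach K U I, hmSum K U I v * φ v ω

end MetricGFF

end

/-!
Entropic repulsion for the metric graph Gaussian free field.

*Reduction to a Gaussian vector.* The interior lattice points `verts K` form a finite set. The
first-step equations of the walk show that Green's function on `verts K` is the inverse of the
generator `netMatrix K` of the killed walk, and that the generator sends the mean of the field to at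
most `lam` times the killing rate. So the field on `verts K` is a Gaussian vector with density
`gaussWeight Q κ`, where `Q = netMatrix K` has nonpositive off-diagonal entries and
`κ ≤ lam • Q *ᵥ 1`. Points of `I` on the boundary carry a deterministic value and can be ignored.

*The potential.* Let `g` be the expected occupation density of the walk from `U` at the points it can
only reach through the explored set `D`: the difference of the potentials of `U` absorbed on `I \ D`
and on `I`. It vanishes on `I \ D`, and `Q *ᵥ g` is the harmonic measure `Hm(U, ·; I)` on `D`, is
`-Hm(U, ·; I \ D)` on `I \ D`, and is zero elsewhere (`exists_repulsionData`). As every point of `D`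
has a neighbour in `I⁺`, `g ≤ 4 ξ H` on `D` and `∑ g ≤ 4 H`, where `H = Hm(U, I)`.

*Stochastic monotonicity.* As `Q` has nonpositive off-diagonal entries, the four functions theorem of
Karlin and Rinott gives `mass_inter_mul_le`: raising the mean or the conditioning set raises the
conditional law. So it may be assumed that `κ = lam • Q *ᵥ 1`, and that the negative values on
`I⁻ \ D` lie in `[-1, 0)`.

*Cost of moving a threshold.* Relaxing the condition `φ v < 0` to `φ v < t` at one point `v ∈ D`
multiplies the probability by at most `exp (C t)` (`mass_signBox_update_le`). By monotonicity, all
other negativity conditions may be dropped and the mean may be raised to a multiple of a logarithmic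
barrier around `v` (`barrier_netMatrix`), for which the conditions `φ ≥ 0` on the rest of `I` hold
with probability at least `1 / 2`, given that `φ v ∈ [-1, 0)`.

*Small charge flowing in.* Let `Y = ∑ Hm(U, v; I) φ v` over `D`, and let `Z ≥ 0` be the sum of
`Hm(U, v; I \ D) φ v` over `I⁺`. Translating the field by `g / (ξ H)` costs only bounded thresholds on
`D`, and multiplies the density by about `exp ((Z - Y) / (ξ H))`. So `Z ≤ M H` up to probability
`exp (-1 / ξ)` (`mass_inflow_le`).

*Repulsion.* Tilt the law on `{Z ≤ M H}` by `exp (t Y)`, with `t` of order `1 / (ξ H)`. Integrating by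
parts in the direction `g` bounds the density of the field near `0` on `D`, hence `E (-Y) ≥ c H` under
the tilted law (`integral_weightedField_ge`). Jensen's inequality removes the tilt:
`Y > -Δ H` has probability at most `exp (-1 / (80 ξ))` (`mass_weightedField_le`).
-/

namespace MetricGFF

open scoped ENNReal

/-! ### The four functions theorem on `ℝⁿ` -/

/-- If `a, b ≤ c` and `a b ≤ c d`, then `(c - a) (c - b) ≥ 0` gives `a + b ≤ c + d`. -/
lemma add_le_add_of_mul_le_mul {a b c d : ℝ≥0∞} (hac : a ≤ c) (hbc : b ≤ c)
    (h : a * b ≤ c * d) : a + b ≤ c + d := by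
  rcases eq_or_ne c ∞ with rfl | hc
  · simp
  rcases eq_or_ne d ∞ with rfl | hd
  · simp
  lift c to NNReal using hc
  lift d to NNReal using hd
  lift a to NNReal using ne_top_of_le_ne_top ENNReal.coe_ne_top hac
  lift b to NNReal using ne_top_of_le_ne_top ENNReal.coe_ne_top hbc
  norm_cast at *
  rcases eq_or_ne c 0 with rfl | hc0
  · have ha : a = 0 := by simpa using hac
    have hb : b = 0 := by simpa using hbc
    simp [ha, hb]
  have hc' : (0 : ℝ) < c := by positivity
  have h1 : (a : ℝ) ≤ c := hac
  have h2 : (b : ℝ) ≤ c := hbc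
  have h3 : (a : ℝ) * b ≤ c * d := by exact_mod_cast h
  have : (a : ℝ) + b ≤ c + d := by
    by_contra! hcon
    nlinarith [mul_nonneg (sub_nonneg.2 h1) (sub_nonneg.2 h2)]
  exact_mod_cast this

/-- The one-dimensional case of the four functions theorem on `ℝ`. -/
lemma four_functions_lintegral_real (μ : Measure ℝ) [SFinite μ] {f₁ f₂ f₃ f₄ : ℝ → ℝ≥0∞}
    (h₁ : Measurable f₁) (h₂ : Measurable f₂) (h₃ : Measurable f₃) (h₄ : Measurable f₄)
    (h : ∀ x y, f₁ x * f₂ y ≤ f₃ (x ⊔ y) * f₄ (x ⊓ y)) :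
    (∫⁻ x, f₁ x ∂μ) * ∫⁻ x, f₂ x ∂μ ≤ (∫⁻ x, f₃ x ∂μ) * ∫⁻ x, f₄ x ∂μ := by
  -- symmetrize in `(x, y)` and compare the integrands pointwise
  have key : ∀ {u v : ℝ → ℝ≥0∞}, Measurable u → Measurable v →
      ∫⁻ x, ∫⁻ y, (u x * v y + u y * v x) ∂μ ∂μ
        = 2 * ((∫⁻ x, u x ∂μ) * ∫⁻ x, v x ∂μ) := by
    intro u v hu hv
    have e1 : ∀ x, ∫⁻ y, (u x * v y + u y * v x) ∂μ
        = u x * (∫⁻ y, v y ∂μ) + (∫⁻ y, u y ∂μ) * v x := by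
      intro x
      rw [lintegral_add_left (by fun_prop), lintegral_const_mul _ hv, lintegral_mul_const _ hu]
    simp_rw [e1]
    rw [lintegral_add_left (by fun_prop), lintegral_const_mul _ hv, lintegral_mul_const _ hu]
    ring
  have hpt : ∀ x y, f₁ x * f₂ y + f₁ y * f₂ x ≤ f₃ x * f₄ y + f₃ y * f₄ x := by
    have aux : ∀ x y, x ≤ y → f₁ x * f₂ y + f₁ y * f₂ x ≤ f₃ x * f₄ y + f₃ y * f₄ x := by
      intro x y hxy
      rw [add_comm (f₃ x * f₄ y)]
      apply add_le_add_of_mul_le_mul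
      · simpa [hxy] using h x y
      · simpa [hxy] using h y x
      · calc f₁ x * f₂ y * (f₁ y * f₂ x) = (f₁ x * f₂ x) * (f₁ y * f₂ y) := by ring
          _ ≤ (f₃ x * f₄ x) * (f₃ y * f₄ y) :=
            mul_le_mul' (by simpa using h x x) (by simpa using h y y)
          _ = f₃ y * f₄ x * (f₃ x * f₄ y) := by ring
    intro x y
    rcases le_total x y with hxy | hxy
    · exact aux x y hxy
    · have := aux y x hxy
      rwa [add_comm (f₁ y * f₂ x), add_comm (f₃ y * f₄ x)] at this
  have := lintegral_mono (μ := μ) (fun x => lintegral_mono (μ := μ) (fun y => hpt x y))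
  rw [key h₁ h₂, key h₃ h₄] at this
  exact (ENNReal.mul_le_mul_iff_right (by simp) (by simp)).1 this

lemma piFinSuccAbove_symm_zero_apply {n : ℕ} (p : ℝ × (Fin n → ℝ)) :
    (MeasurableEquiv.piFinSuccAbove (fun _ : Fin (n + 1) => ℝ) 0).symm p
      = (Fin.cons p.1 p.2 : Fin (n + 1) → ℝ) := by
  rw [← Fin.insertNth_zero']
  rfl

lemma lintegral_fin_succ {n : ℕ} {f : (Fin (n + 1) → ℝ) → ℝ≥0∞} (hf : Measurable f) :
    ∫⁻ x, f x = ∫⁻ s : ℝ, ∫⁻ y : Fin n → ℝ, f (Fin.cons s y) := by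
  have hmp := (volume_preserving_piFinSuccAbove (fun _ : Fin (n + 1) => ℝ) 0).symm
  rw [← hmp.lintegral_comp hf, Measure.volume_eq_prod, lintegral_prod]
  · simp_rw [piFinSuccAbove_symm_zero_apply]
  · exact (hf.comp hmp.measurable).aemeasurable

/-- The four functions theorem on `ℝⁿ` (Karlin and Rinott), by induction on `n`. -/
lemma four_functions_lintegral_fin (n : ℕ) {f₁ f₂ f₃ f₄ : (Fin n → ℝ) → ℝ≥0∞}
    (h₁ : Measurable f₁) (h₂ : Measurable f₂) (h₃ : Measurable f₃) (h₄ : Measurable f₄)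
    (h : ∀ x y, f₁ x * f₂ y ≤ f₃ (x ⊔ y) * f₄ (x ⊓ y)) :
    (∫⁻ x, f₁ x) * ∫⁻ x, f₂ x ≤ (∫⁻ x, f₃ x) * ∫⁻ x, f₄ x := by
  induction n with
  | zero =>
    simp only [volume_pi, Measure.pi_of_empty (fun _ : Fin 0 => (volume : Measure ℝ)) 0,
      lintegral_dirac]
    simpa using h 0 0
  | succ n ih =>
    have hm : Measurable (fun p : ℝ × (Fin n → ℝ) => (Fin.cons p.1 p.2 : Fin (n + 1) → ℝ)) := by
      simp_rw [← piFinSuccAbove_symm_zero_apply]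
      exact (MeasurableEquiv.piFinSuccAbove (fun _ : Fin (n + 1) => ℝ) 0).symm.measurable
    have hs : ∀ s : ℝ, Measurable (fun y : Fin n → ℝ => (Fin.cons s y : Fin (n + 1) → ℝ)) :=
      fun s => hm.comp (measurable_const.prodMk measurable_id)
    have hi : ∀ {f : (Fin (n + 1) → ℝ) → ℝ≥0∞}, Measurable f →
        Measurable (fun s : ℝ => ∫⁻ y : Fin n → ℝ, f (Fin.cons s y)) :=
      fun hf => (hf.comp hm).lintegral_prod_right'
    rw [lintegral_fin_succ h₁, lintegral_fin_succ h₂, lintegral_fin_succ h₃,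
      lintegral_fin_succ h₄]
    refine four_functions_lintegral_real volume (hi h₁) (hi h₂) (hi h₃) (hi h₄) fun s t => ?_
    refine ih (h₁.comp (hs s)) (h₂.comp (hs t)) (h₃.comp (hs _)) (h₄.comp (hs _)) fun x y => ?_
    convert h (Fin.cons s x) (Fin.cons t y) using 3
    · ext i; refine Fin.cases ?_ (fun j => ?_) i <;> simp
    · ext i; refine Fin.cases ?_ (fun j => ?_) i <;> simp

/-- The four functions theorem (Karlin and Rinott) for Lebesgue measure on `ℝ^ι`. -/
theorem four_functions_lintegral {ι : Type*} [Fintype ι] {f₁ f₂ f₃ f₄ : (ι → ℝ) → ℝ≥0∞}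
    (h₁ : Measurable f₁) (h₂ : Measurable f₂) (h₃ : Measurable f₃) (h₄ : Measurable f₄)
    (h : ∀ x y, f₁ x * f₂ y ≤ f₃ (x ⊔ y) * f₄ (x ⊓ y)) :
    (∫⁻ x, f₁ x) * ∫⁻ x, f₂ x ≤ (∫⁻ x, f₃ x) * ∫⁻ x, f₄ x := by
  let e := Fintype.equivFin ι
  have hmp := volume_measurePreserving_piCongrLeft (fun _ : ι => ℝ) e.symm
  have hval : ∀ (x : Fin (Fintype.card ι) → ℝ) (i : ι),
      MeasurableEquiv.piCongrLeft (fun _ : ι => ℝ) e.symm x i = x (e i) := by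
    intro x i
    have := MeasurableEquiv.piCongrLeft_apply_apply (β := fun _ : ι => ℝ) e.symm x (e i)
    simpa using this
  rw [← hmp.lintegral_comp h₁, ← hmp.lintegral_comp h₂, ← hmp.lintegral_comp h₃,
    ← hmp.lintegral_comp h₄]
  refine four_functions_lintegral_fin _ (h₁.comp hmp.measurable) (h₂.comp hmp.measurable)
    (h₃.comp hmp.measurable) (h₄.comp hmp.measurable) fun x y => ?_
  convert h (MeasurableEquiv.piCongrLeft (fun _ : ι => ℝ) e.symm x)
    (MeasurableEquiv.piCongrLeft (fun _ : ι => ℝ) e.symm y) using 3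
  · ext i; simp [hval]
  · ext i; simp [hval]

/-! ### Gaussian weights -/

section GaussianWeight
open Matrix

variable {V : Type*} [Fintype V]

/-- The unnormalized density `exp (κ · x - x · Q x / 2)` of the Gaussian vector with precision
matrix `Q` and mean `Q⁻¹ κ`. -/
noncomputable def gaussWeight (Q : Matrix V V ℝ) (κ x : V → ℝ) : ℝ :=
  Real.exp (κ ⬝ᵥ x - (x ⬝ᵥ Q *ᵥ x) / 2)

/-- The Gaussian weight of a set. -/
noncomputable def mass (Q : Matrix V V ℝ) (κ : V → ℝ) (S : Set (V → ℝ)) : ℝ :=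
  ∫ x in S, gaussWeight Q κ x

variable {Q : Matrix V V ℝ} {κ : V → ℝ}

lemma gaussWeight_pos (x : V → ℝ) : 0 < gaussWeight Q κ x := Real.exp_pos _

@[fun_prop]
lemma continuous_gaussWeight : Continuous (gaussWeight Q κ) := by
  unfold gaussWeight
  simp only [dotProduct, mulVec]
  fun_prop

lemma gaussWeight_mul_exp (ℓ x : V → ℝ) :
    gaussWeight Q κ x * Real.exp (ℓ ⬝ᵥ x) = gaussWeight Q (κ + ℓ) x := by
  rw [gaussWeight, gaussWeight, ← Real.exp_add, add_dotProduct]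
  ring_nf

lemma dotProduct_mulVec_comm (hQ : Q.IsSymm) (x y : V → ℝ) : x ⬝ᵥ Q *ᵥ y = y ⬝ᵥ Q *ᵥ x := by
  rw [dotProduct_mulVec, ← mulVec_transpose, hQ.eq, dotProduct_comm]

lemma gaussWeight_add (hQ : Q.IsSymm) (x h : V → ℝ) :
    gaussWeight Q κ (x + h)
      = gaussWeight Q κ x * Real.exp (h ⬝ᵥ (κ - Q *ᵥ x) - (h ⬝ᵥ Q *ᵥ h) / 2) := by
  rw [gaussWeight, gaussWeight, ← Real.exp_add]
  congr 1
  rw [mulVec_add, dotProduct_add, add_dotProduct, dotProduct_add, dotProduct_add,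
    dotProduct_sub, dotProduct_mulVec_comm hQ x h, dotProduct_comm κ h]
  ring

lemma exists_coercive (hQ : Q.PosDef) :
    ∃ c : ℝ, 0 < c ∧ ∀ x : V → ℝ, c * ‖x‖ ^ 2 ≤ x ⬝ᵥ Q *ᵥ x := by
  have hcont : Continuous fun x : V → ℝ => x ⬝ᵥ Q *ᵥ x := by
    simp only [dotProduct, mulVec]; fun_prop
  have hpos : ∀ x : V → ℝ, x ≠ 0 → 0 < x ⬝ᵥ Q *ᵥ x := fun x hx => by
    simpa using hQ.dotProduct_mulVec_pos hx
  rcases (Metric.sphere (0 : V → ℝ) 1).eq_empty_or_nonempty with he | hne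
  · refine ⟨1, one_pos, fun x => ?_⟩
    have hx : x = 0 := by
      by_contra hx
      have : ‖x‖⁻¹ • x ∈ Metric.sphere (0 : V → ℝ) 1 := by
        simp [norm_smul, inv_mul_cancel₀ (norm_ne_zero_iff.2 hx)]
      simp [he] at this
    simp [hx]
  · obtain ⟨z, hz, hmin⟩ := (isCompact_sphere (0 : V → ℝ) 1).exists_isMinOn hne hcont.continuousOn
    have hz0 : z ≠ 0 := by rintro rfl; simp at hz
    refine ⟨_, hpos z hz0, fun x => ?_⟩
    rcases eq_or_ne x 0 with rfl | hx
    · simp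
    have hn : ‖x‖ ≠ 0 := norm_ne_zero_iff.2 hx
    have h1 : z ⬝ᵥ Q *ᵥ z ≤ (‖x‖⁻¹ • x) ⬝ᵥ Q *ᵥ (‖x‖⁻¹ • x) :=
      hmin (by simp [norm_smul, inv_mul_cancel₀ hn])
    rw [mulVec_smul, smul_dotProduct, dotProduct_smul, smul_eq_mul, smul_eq_mul] at h1
    calc z ⬝ᵥ Q *ᵥ z * ‖x‖ ^ 2 ≤ (‖x‖⁻¹ * (‖x‖⁻¹ * x ⬝ᵥ Q *ᵥ x)) * ‖x‖ ^ 2 := by gcongr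
      _ = x ⬝ᵥ Q *ᵥ x := by field_simp

lemma integrable_gaussWeight (hQ : Q.PosDef) (κ : V → ℝ) : Integrable (gaussWeight Q κ) := by
  obtain ⟨c, hc, hcoer⟩ := exists_coercive hQ
  set b : ℝ := c / (2 * (Fintype.card V + 1)) with hb
  have hb0 : 0 < b := by positivity
  have h1 : Integrable (fun x : V → ℝ => ∏ i, Real.exp (-b * x i ^ 2 + κ i * x i)) := by
    refine Integrable.fintype_prod (f := fun i t => Real.exp (-b * t ^ 2 + κ i * t)) fun i => ?_
    refine ((integrable_exp_neg_mul_sq (half_pos hb0)).const_mul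
      (Real.exp (κ i ^ 2 / (2 * b)))).mono' (by fun_prop) (ae_of_all _ fun t => ?_)
    rw [Real.norm_of_nonneg (Real.exp_pos _).le, ← Real.exp_add]
    apply Real.exp_le_exp.2
    have : κ i ^ 2 / (2 * b) + -(b / 2) * t ^ 2 - (-b * t ^ 2 + κ i * t)
        = (b * t - κ i) ^ 2 / (2 * b) := by
      field_simp; ring
    have : 0 ≤ (b * t - κ i) ^ 2 / (2 * b) := by positivity
    linarith
  refine h1.mono' continuous_gaussWeight.aestronglyMeasurable (ae_of_all _ fun x => ?_)
  rw [Real.norm_of_nonneg (gaussWeight_pos x).le, ← Real.exp_sum, gaussWeight,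
    Finset.sum_add_distrib, ← Finset.mul_sum]
  apply Real.exp_le_exp.2
  have h2 : ∑ i, x i ^ 2 ≤ (Fintype.card V + 1) * ‖x‖ ^ 2 := by
    calc ∑ i, x i ^ 2 ≤ ∑ _i : V, ‖x‖ ^ 2 := by
          refine Finset.sum_le_sum fun i _ => ?_
          rw [← sq_abs]
          exact pow_le_pow_left₀ (abs_nonneg _) (norm_le_pi_norm x i) 2
      _ = Fintype.card V * ‖x‖ ^ 2 := by simp
      _ ≤ _ := by gcongr; simp
  have h3 : b * ∑ i, x i ^ 2 ≤ (x ⬝ᵥ Q *ᵥ x) / 2 := by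
    calc b * ∑ i, x i ^ 2 ≤ b * ((Fintype.card V + 1) * ‖x‖ ^ 2) := by gcongr
      _ = c * ‖x‖ ^ 2 / 2 := by rw [hb]; field_simp
      _ ≤ _ := by gcongr; exact hcoer x
  simp only [dotProduct] at h3 ⊢
  linarith

lemma integrable_exp_mul_gaussWeight (hQ : Q.PosDef) (κ ℓ : V → ℝ) :
    Integrable fun x => Real.exp (ℓ ⬝ᵥ x) * gaussWeight Q κ x := by
  simpa only [mul_comm, gaussWeight_mul_exp] using integrable_gaussWeight hQ (κ + ℓ)

lemma integrable_dotProduct_mul_gaussWeight (hQ : Q.PosDef) (κ ℓ : V → ℝ) :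
    Integrable fun x => (ℓ ⬝ᵥ x) * gaussWeight Q κ x := by
  refine ((integrable_exp_mul_gaussWeight hQ κ ℓ).add
    (integrable_exp_mul_gaussWeight hQ κ (-ℓ))).mono' ?_ (ae_of_all _ fun x => ?_)
  · refine Continuous.aestronglyMeasurable ?_
    simp only [dotProduct]; fun_prop
  · simp only [Pi.add_apply, neg_dotProduct]
    rw [norm_mul, Real.norm_of_nonneg (gaussWeight_pos x).le, ← add_mul]
    refine mul_le_mul_of_nonneg_right ?_ (gaussWeight_pos x).le
    rw [Real.norm_eq_abs, abs_le]
    have h1 := Real.add_one_le_exp (ℓ ⬝ᵥ x)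
    have h2 := Real.add_one_le_exp (-(ℓ ⬝ᵥ x))
    have h3 := Real.exp_pos (ℓ ⬝ᵥ x)
    have h4 := Real.exp_pos (-(ℓ ⬝ᵥ x))
    constructor <;> linarith

lemma mass_nonneg (S : Set (V → ℝ)) : 0 ≤ mass Q κ S :=
  integral_nonneg fun x => (gaussWeight_pos x).le

lemma mass_mono (hQ : Q.PosDef) {S T : Set (V → ℝ)} (h : S ⊆ T) :
    mass Q κ S ≤ mass Q κ T :=
  setIntegral_mono_set (integrable_gaussWeight hQ κ).integrableOn
    (ae_of_all _ fun x => (gaussWeight_pos x).le) h.eventuallyLE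

lemma mass_inter_add_diff (hQ : Q.PosDef) (S : Set (V → ℝ)) {T : Set (V → ℝ)}
    (hT : MeasurableSet T) : mass Q κ (S ∩ T) + mass Q κ (S \ T) = mass Q κ S :=
  integral_inter_add_sdiff hT (integrable_gaussWeight hQ κ).integrableOn

lemma mass_union_le (hQ : Q.PosDef) {S T : Set (V → ℝ)} (hT : MeasurableSet T) :
    mass Q κ (S ∪ T) ≤ mass Q κ S + mass Q κ T := by
  rw [← mass_inter_add_diff hQ (S ∪ T) hT, add_comm]
  exact add_le_add (mass_mono hQ (by intro x hx; exact hx.1.resolve_right hx.2))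
    (mass_mono hQ Set.inter_subset_right)

lemma mass_biUnion_le (hQ : Q.PosDef) {ι : Type*} (s : Finset ι) {S : ι → Set (V → ℝ)}
    (hS : ∀ i ∈ s, MeasurableSet (S i)) :
    mass Q κ (⋃ i ∈ s, S i) ≤ ∑ i ∈ s, mass Q κ (S i) := by
  classical
  induction s using Finset.induction_on with
  | empty => simp [mass]
  | insert i s hi ih =>
    rw [Finset.set_biUnion_insert, Finset.sum_insert hi]
    refine (mass_union_le hQ (Finset.measurableSet_biUnion _ fun j hj =>
      hS j (Finset.mem_insert_of_mem hj))).trans ?_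
    gcongr
    exact ih fun j hj => hS j (Finset.mem_insert_of_mem hj)

lemma ofReal_mass (hQ : Q.PosDef) (S : Set (V → ℝ)) :
    ENNReal.ofReal (mass Q κ S) = ∫⁻ x in S, ENNReal.ofReal (gaussWeight Q κ x) :=
  ofReal_integral_eq_lintegral_ofReal (integrable_gaussWeight hQ κ).integrableOn
    (ae_of_all _ fun x => (gaussWeight_pos x).le)

/-- The Cameron-Martin formula: the weight of a translated set. -/
lemma mass_translate (hQ : Q.IsSymm) (S : Set (V → ℝ)) (h : V → ℝ) :
    mass Q κ ((fun x => x - h) ⁻¹' S)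
      = ∫ x in S, Real.exp (h ⬝ᵥ (κ - Q *ᵥ x) - (h ⬝ᵥ Q *ᵥ h) / 2) * gaussWeight Q κ x := by
  have hmp : MeasurePreserving (fun x : V → ℝ => x - h) volume volume :=
    measurePreserving_sub_right volume h
  have := hmp.setIntegral_preimage_emb (MeasurableEquiv.subRight h).measurableEmbedding
    (fun x => gaussWeight Q κ (x + h)) S
  simp only [sub_add_cancel] at this
  rw [mass, this]
  simp_rw [gaussWeight_add hQ, mul_comm]

/-- A product of Gaussian weights can only increase when the two arguments are replaced by their
maximum and minimum, if the off-diagonal entries of the precision matrix are nonpositive. -/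
lemma gaussWeight_mul_le (hQ : ∀ i j, i ≠ j → Q i j ≤ 0) {κ₁ κ₂ : V → ℝ} (hκ : κ₁ ≤ κ₂)
    (x y : V → ℝ) :
    gaussWeight Q κ₁ x * gaussWeight Q κ₂ y
      ≤ gaussWeight Q κ₂ (x ⊔ y) * gaussWeight Q κ₁ (x ⊓ y) := by
  simp only [gaussWeight, ← Real.exp_add]
  apply Real.exp_le_exp.2
  have h1 : κ₁ ⬝ᵥ x + κ₂ ⬝ᵥ y ≤ κ₂ ⬝ᵥ (x ⊔ y) + κ₁ ⬝ᵥ (x ⊓ y) := by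
    simp only [dotProduct, ← Finset.sum_add_distrib]
    refine Finset.sum_le_sum fun i _ => ?_
    have := hκ i
    simp only [Pi.sup_apply, Pi.inf_apply]
    rcases le_total (x i) (y i) with h | h
    · simp only [sup_of_le_right h, inf_of_le_left h]; linarith
    · simp only [sup_of_le_left h, inf_of_le_right h]; nlinarith
  have h2 : (x ⊔ y) ⬝ᵥ Q *ᵥ (x ⊔ y) + (x ⊓ y) ⬝ᵥ Q *ᵥ (x ⊓ y)
      ≤ x ⬝ᵥ Q *ᵥ x + y ⬝ᵥ Q *ᵥ y := by
    simp only [dotProduct, mulVec, Finset.mul_sum, ← Finset.sum_add_distrib]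
    refine Finset.sum_le_sum fun i _ => Finset.sum_le_sum fun j _ => ?_
    simp only [Pi.sup_apply, Pi.inf_apply]
    rcases eq_or_ne i j with rfl | hij
    · rcases le_total (x i) (y i) with h | h
      · simp only [sup_of_le_right h, inf_of_le_left h]; linarith
      · simp only [sup_of_le_left h, inf_of_le_right h]; linarith
    · have hq := hQ i j hij
      rcases le_total (x i) (y i) with h | h <;> rcases le_total (x j) (y j) with h' | h'
      · simp only [sup_of_le_right h, inf_of_le_left h, sup_of_le_right h', inf_of_le_left h']
        linarith
      · simp only [sup_of_le_right h, inf_of_le_left h, sup_of_le_left h', inf_of_le_right h']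
        nlinarith [mul_nonneg (sub_nonneg.2 h) (sub_nonneg.2 h')]
      · simp only [sup_of_le_left h, inf_of_le_right h, sup_of_le_right h', inf_of_le_left h']
        nlinarith [mul_nonneg (sub_nonneg.2 h) (sub_nonneg.2 h')]
      · simp only [sup_of_le_left h, inf_of_le_right h, sup_of_le_left h', inf_of_le_right h']
        linarith
  linarith

/-- Stochastic monotonicity of conditioned Gaussian vectors (a form of the FKG inequality): raising
the mean, and replacing the conditioning set `S₁` by a higher one `S₂`, increases the conditional
probability of an increasing event `A`. -/
lemma mass_inter_mul_le (hP : Q.PosDef) (hQ : ∀ i j, i ≠ j → Q i j ≤ 0) {κ₁ κ₂ : V → ℝ}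
    (hκ : κ₁ ≤ κ₂) {S₁ S₂ A : Set (V → ℝ)} (hS₁ : MeasurableSet S₁) (hS₂ : MeasurableSet S₂)
    (hA : MeasurableSet A) (hup : IsUpperSet A)
    (hS : ∀ x ∈ S₁, ∀ y ∈ S₂, x ⊔ y ∈ S₂ ∧ x ⊓ y ∈ S₁) :
    mass Q κ₁ (S₁ ∩ A) * mass Q κ₂ S₂ ≤ mass Q κ₂ (S₂ ∩ A) * mass Q κ₁ S₁ := by
  have hm : ∀ κ : V → ℝ, Measurable fun x => ENNReal.ofReal (gaussWeight Q κ x) := fun κ =>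
    (continuous_gaussWeight.measurable).ennreal_ofReal
  rw [← ENNReal.ofReal_le_ofReal_iff (mul_nonneg (mass_nonneg _) (mass_nonneg _)),
    ENNReal.ofReal_mul (mass_nonneg _), ENNReal.ofReal_mul (mass_nonneg _)]
  simp_rw [ofReal_mass hP]
  rw [← lintegral_indicator (hS₁.inter hA), ← lintegral_indicator hS₂,
    ← lintegral_indicator (hS₂.inter hA), ← lintegral_indicator hS₁]
  refine four_functions_lintegral ((hm _).indicator (hS₁.inter hA)) ((hm _).indicator hS₂)
    ((hm _).indicator (hS₂.inter hA)) ((hm _).indicator hS₁) fun x y => ?_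
  by_cases hx : x ∈ S₁ ∩ A
  swap
  · simp [Set.indicator_of_notMem hx]
  by_cases hy : y ∈ S₂
  swap
  · simp [Set.indicator_of_notMem hy]
  obtain ⟨h1, h2⟩ := hS x hx.1 y hy
  have h3 : x ⊔ y ∈ S₂ ∩ A := ⟨h1, hup le_sup_left hx.2⟩
  rw [Set.indicator_of_mem hx, Set.indicator_of_mem hy, Set.indicator_of_mem h2,
    Set.indicator_of_mem h3,
    ← ENNReal.ofReal_mul (gaussWeight_pos _).le, ← ENNReal.ofReal_mul (gaussWeight_pos _).le]
  exact ENNReal.ofReal_le_ofReal (gaussWeight_mul_le hQ hκ x y)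

end GaussianWeight

/-! ### Gaussian laws and their densities -/

section GaussianLaw
open Matrix

variable {V : Type*} [Fintype V] {Q : Matrix V V ℝ} {κ : V → ℝ}

lemma mass_univ_pos (hQ : Q.PosDef) : 0 < mass Q κ Set.univ := by
  rw [mass, setIntegral_univ]
  exact integral_pos_of_integrable_nonneg_nonzero continuous_gaussWeight
    (integrable_gaussWeight hQ κ) (fun x => (gaussWeight_pos x).le)
    (gaussWeight_pos (0 : V → ℝ)).ne'

/-- The Gaussian probability measure with precision matrix `Q` and mean `Q⁻¹ κ`. -/
noncomputable def gaussMeasure (Q : Matrix V V ℝ) (κ : V → ℝ) : Measure (V → ℝ) :=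
  volume.withDensity fun x => ENNReal.ofReal (gaussWeight Q κ x / mass Q κ Set.univ)

lemma gaussMeasure_apply (hQ : Q.PosDef) (S : Set (V → ℝ)) :
    gaussMeasure Q κ S = ENNReal.ofReal (mass Q κ S / mass Q κ Set.univ) := by
  rw [gaussMeasure, withDensity_apply', mass, mass, ← integral_div,
    ofReal_integral_eq_lintegral_ofReal]
  · exact ((integrable_gaussWeight hQ κ).div_const _).integrableOn
  · exact ae_of_all _ fun x => div_nonneg (gaussWeight_pos x).le (mass_nonneg _)

lemma isProbabilityMeasure_gaussMeasure (hQ : Q.PosDef) :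
    IsProbabilityMeasure (gaussMeasure Q κ) :=
  ⟨by rw [gaussMeasure_apply hQ, div_self (mass_univ_pos hQ).ne', ENNReal.ofReal_one]⟩

lemma integral_exp_mul_gaussWeight (hP : Q.PosDef) (ℓ p m : V → ℝ)
    (hp : Q *ᵥ p = ℓ) (hm : Q *ᵥ m = κ) (s : ℝ) :
    ∫ x, Real.exp (s * (ℓ ⬝ᵥ x)) * gaussWeight Q κ x
      = Real.exp (s * (ℓ ⬝ᵥ m) + s ^ 2 * (ℓ ⬝ᵥ p) / 2) * mass Q κ Set.univ := by
  have hQ : Q.IsSymm := by simpa [IsHermitian, IsSymm] using hP.1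
  have h := mass_translate (κ := κ) hQ Set.univ (-s • p)
  have e : ∀ x, (-s • p) ⬝ᵥ (κ - Q *ᵥ x) - ((-s • p) ⬝ᵥ Q *ᵥ (-s • p)) / 2
      = -(s * (ℓ ⬝ᵥ m) + s ^ 2 * (ℓ ⬝ᵥ p) / 2) + s * (ℓ ⬝ᵥ x) := by
    intro x
    rw [mulVec_smul, hp, smul_dotProduct, smul_dotProduct, dotProduct_smul, dotProduct_sub,
      dotProduct_mulVec_comm hQ p x, hp, ← hm, dotProduct_mulVec_comm hQ p m, hp,
      dotProduct_comm x ℓ, dotProduct_comm m ℓ, dotProduct_comm p ℓ]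
    simp only [smul_eq_mul]
    ring
  simp_rw [e, Real.exp_add (-_), mul_assoc] at h
  rw [Set.preimage_univ, setIntegral_univ, integral_const_mul] at h
  rw [h, ← mul_assoc, ← Real.exp_add]
  simp

lemma integral_gaussMeasure (F : (V → ℝ) → ℝ) :
    ∫ x, F x ∂gaussMeasure Q κ = (∫ x, F x * gaussWeight Q κ x) / mass Q κ Set.univ := by
  rw [gaussMeasure, integral_withDensity_eq_integral_toReal_smul
    ((continuous_gaussWeight.div_const _).measurable.ennreal_ofReal)
    (ae_of_all _ fun _ => ENNReal.ofReal_lt_top), ← integral_div]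
  refine integral_congr_ae (ae_of_all _ fun x => ?_)
  simp only
  rw [ENNReal.toReal_ofReal (div_nonneg (gaussWeight_pos x).le (mass_nonneg _)), smul_eq_mul]
  ring

lemma map_dotProduct_gaussMeasure (hP : Q.PosDef) (ℓ p m : V → ℝ)
    (hp : Q *ᵥ p = ℓ) (hm : Q *ᵥ m = κ) :
    (gaussMeasure Q κ).map (fun x => ℓ ⬝ᵥ x) = gaussianReal (ℓ ⬝ᵥ m) (ℓ ⬝ᵥ p).toNNReal := by
  have := isProbabilityMeasure_gaussMeasure (κ := κ) hP
  have hmeas : Measurable fun x : V → ℝ => ℓ ⬝ᵥ x := by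
    simp only [dotProduct]; fun_prop
  have hv : 0 ≤ ℓ ⬝ᵥ p := by
    rw [← hp, dotProduct_comm]
    simpa using hP.posSemidef.dotProduct_mulVec_nonneg p
  have hmgf : mgf id (gaussianReal (ℓ ⬝ᵥ m) (ℓ ⬝ᵥ p).toNNReal)
      = mgf (fun x => ℓ ⬝ᵥ x) (gaussMeasure Q κ) := by
    ext s
    rw [mgf_id_gaussianReal, mgf, integral_gaussMeasure,
      integral_exp_mul_gaussWeight hP ℓ p m hp hm s, mul_div_assoc,
      div_self (mass_univ_pos hP).ne', mul_one, Real.coe_toNNReal _ hv]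
    ring_nf
  have h := Measure.ext_of_complexMGF_eq (μ := gaussianReal (ℓ ⬝ᵥ m) (ℓ ⬝ᵥ p).toNNReal)
    (X := id) aemeasurable_id hmeas.aemeasurable (funext fun z =>
      eqOn_complexMGF_of_mgf hmgf (by simp : z ∈ {z : ℂ | z.re ∈ interior _}))
  rw [← h, Measure.map_id]

/-- A Gaussian vector with invertible covariance matrix `Q⁻¹` has density `gaussWeight Q`, up to
normalization. -/
lemma map_eq_gaussMeasure [DecidableEq V] {Ω : Type*} [MeasurableSpace Ω] {P : Measure Ω}
    {X : V → Ω → ℝ} (hX : HasGaussianLaw (fun ω i => X i ω) P) (hP : Q.PosDef) {m : V → ℝ}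
    (hm : ∀ i, ∫ ω, X i ω ∂P = m i) {G : Matrix V V ℝ} (hG : Q * G = 1)
    (hcov : ∀ i j, cov[X i, X j; P] = G i j) :
    P.map (fun ω i => X i ω) = gaussMeasure Q (Q *ᵥ m) := by
  have := hX.isProbabilityMeasure
  have := isProbabilityMeasure_gaussMeasure (κ := Q *ᵥ m) hP
  have hXm : AEMeasurable (fun ω i => X i ω) P := hX.aemeasurable
  have hX2 : ∀ i, MemLp (X i) 2 P := fun i => (hX.eval i).memLp_two
  have := Measure.isProbabilityMeasure_map hXm
  refine Measure.ext_of_charFunDual (funext fun L => ?_)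
  set ℓ : V → ℝ := fun i => L (Pi.single i 1)
  have hL : ⇑L = fun x => ℓ ⬝ᵥ x := by
    funext x
    have h := LinearMap.pi_apply_eq_sum_univ (L : (V → ℝ) →ₗ[ℝ] ℝ) x
    have e : ∀ i : V, (fun j => if i = j then (1 : ℝ) else 0) = Pi.single i 1 := fun i => by
      ext j; simp [Pi.single_apply, eq_comm]
    simp only [e, ContinuousLinearMap.coe_coe, smul_eq_mul] at h
    rw [h, dotProduct]
    exact Finset.sum_congr rfl fun i _ => mul_comm _ _
  rw [charFunDual_eq_charFun_map_one, charFunDual_eq_charFun_map_one, hL,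
    map_dotProduct_gaussMeasure hP ℓ (G *ᵥ ℓ) m (by rw [mulVec_mulVec, hG, one_mulVec]) rfl]
  congr 1
  have hlin : HasGaussianLaw (fun ω => ℓ ⬝ᵥ fun i => X i ω) P := by
    have := hX.map_fun L
    rwa [hL] at this
  rw [AEMeasurable.map_map_of_aemeasurable (by rw [← hL]; fun_prop) hXm]
  refine hlin.map_eq_gaussianReal.trans ?_
  have h1 : ∫ ω, (ℓ ⬝ᵥ fun i => X i ω) ∂P = ℓ ⬝ᵥ m := by
    simp only [dotProduct]
    rw [integral_finsetSum _ fun i _ => (((hX2 i).integrable (by norm_num)).const_mul _)]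
    simp_rw [integral_const_mul, hm]
  have h2 : Var[fun ω => ℓ ⬝ᵥ fun i => X i ω; P] = ℓ ⬝ᵥ G *ᵥ ℓ := by
    rw [← covariance_self hlin.aemeasurable]
    simp only [dotProduct]
    rw [covariance_fun_sum_fun_sum (fun i => (hX2 i).const_mul _)
      (fun i => (hX2 i).const_mul _)]
    simp only [covariance_const_mul_left, covariance_const_mul_right, hcov, mulVec, dotProduct,
      Finset.mul_sum]
    exact Finset.sum_congr rfl fun i _ => Finset.sum_congr rfl fun j _ => by ring
  rw [h1, h2]

end GaussianLaw

/-! ### Moving one threshold -/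

set_option linter.unusedSectionVars false

section Threshold
open Matrix

variable {V : Type*} [Fintype V] [DecidableEq V] {Q : Matrix V V ℝ} {κ : V → ℝ}

lemma isSymm_of_posDef (hP : Q.PosDef) : Q.IsSymm := by
  simpa [IsHermitian, IsSymm] using hP.1

/-- A centered real Gaussian of variance at least `1` has comparable densities on `[0, ∞)` and on
`[-1, 0)`. -/
lemma gaussianReal_Ico_le {v : NNReal} (hv : 1 ≤ v) {s t : ℝ} (hst : s ≤ t) :
    (gaussianReal 0 v).real (Set.Ico s t)
      ≤ (t - s) * Real.exp (1 / 2) * (gaussianReal 0 v).real (Set.Ico (-1) 0) := by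
  have hv0 : v ≠ 0 := (lt_of_lt_of_le one_pos hv).ne'
  have hv1 : (1 : ℝ) ≤ v := by exact_mod_cast hv
  set ρ : ℝ := (√(2 * Real.pi * v))⁻¹ with hρ
  have hρ0 : 0 ≤ ρ := by positivity
  have h1 : (gaussianReal 0 v).real (Set.Ico s t) ≤ ρ * (t - s) := by
    rw [measureReal_def, gaussianReal_apply _ hv0]
    refine ENNReal.toReal_le_of_le_ofReal (mul_nonneg hρ0 (sub_nonneg.2 hst)) ?_
    calc ∫⁻ x in Set.Ico s t, gaussianPDF 0 v x ≤ ∫⁻ _ in Set.Ico s t, ENNReal.ofReal ρ := by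
          refine lintegral_mono fun x => ENNReal.ofReal_le_ofReal ?_
          rw [gaussianPDFReal, ← hρ]
          refine mul_le_of_le_one_right hρ0 (Real.exp_le_one_iff.2 ?_)
          rw [neg_div]
          have : 0 ≤ (x - 0) ^ 2 / (2 * (v : ℝ)) := by positivity
          linarith
      _ = ENNReal.ofReal (ρ * (t - s)) := by
          rw [setLIntegral_const, Real.volume_Ico, ← ENNReal.ofReal_mul hρ0]
  have h2 : ρ * Real.exp (-(1 / 2)) ≤ (gaussianReal 0 v).real (Set.Ico (-1) 0) := by
    rw [measureReal_def, gaussianReal_apply _ hv0]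
    rw [← ENNReal.ofReal_le_iff_le_toReal]
    · calc ENNReal.ofReal (ρ * Real.exp (-(1 / 2)))
          = ∫⁻ _ in Set.Ico (-1 : ℝ) 0, ENNReal.ofReal (ρ * Real.exp (-(1 / 2))) := by simp
        _ ≤ _ := by
          refine setLIntegral_mono (measurable_gaussianPDF 0 v) fun x hx =>
            ENNReal.ofReal_le_ofReal ?_
          rw [gaussianPDFReal, ← hρ]
          refine mul_le_mul_of_nonneg_left (Real.exp_le_exp.2 ?_) hρ0
          rw [neg_div, neg_le_neg_iff]
          apply div_le_div₀ (by positivity) _ (by positivity) (by linarith)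
          nlinarith [hx.1, hx.2]
    · rw [← gaussianReal_apply _ hv0]; exact measure_ne_top _ _
  calc _ ≤ ρ * (t - s) := h1
    _ = (t - s) * Real.exp (1 / 2) * (ρ * Real.exp (-(1 / 2))) := by
      have : Real.exp (1 / 2) * Real.exp (-(1 / 2)) = 1 := by rw [← Real.exp_add]; simp
      linear_combination (-ρ * (t - s)) * this
    _ ≤ _ := mul_le_mul_of_nonneg_left h2 (mul_nonneg (sub_nonneg.2 hst) (Real.exp_pos _).le)

lemma one_le_variance (hP : Q.PosDef) {v : V} (hv : Q v v = 1) {p : V → ℝ}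
    (hp : Q *ᵥ p = Pi.single v 1) : 1 ≤ p v := by
  have h := hP.posSemidef.dotProduct_mulVec_nonneg (p - Pi.single v 1)
  simp only [star_trivial, mulVec_sub, hp, dotProduct_sub, sub_dotProduct,
    mulVec_single_one, single_one_dotProduct, dotProduct_single] at h
  have h2 : (p ⬝ᵥ Q.col v) = 1 := by
    have := congrFun hp v
    rw [Pi.single_eq_same, mulVec, dotProduct_comm] at this
    rw [← this]
    congr 1
    ext i
    exact congrFun (congrFun (isSymm_of_posDef hP) v) i
  simp [h2, hv] at h
  linarith

lemma mass_eq_gaussMeasure (hP : Q.PosDef) (S : Set (V → ℝ)) :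
    mass Q κ S = mass Q κ Set.univ * (gaussMeasure Q κ).real S := by
  rw [measureReal_def, gaussMeasure_apply hP,
    ENNReal.toReal_ofReal (div_nonneg (mass_nonneg _) (mass_nonneg _)),
    mul_div_cancel₀ _ (mass_univ_pos hP).ne']

lemma mass_Ico_le (hP : Q.PosDef) {v : V} (hv : Q v v = 1) {B : V → ℝ} (hB : B v = 0) {s t : ℝ}
    (hst : s ≤ t) :
    mass Q (Q *ᵥ B) {x | x v ∈ Set.Ico s t}
      ≤ (t - s) * Real.exp (1 / 2) * mass Q (Q *ᵥ B) {x | x v ∈ Set.Ico (-1) 0} := by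
  set p := Q⁻¹ *ᵥ Pi.single v 1
  have hp : Q *ᵥ p = Pi.single v 1 := by
    rw [mulVec_mulVec, mul_nonsing_inv _ hP.det_pos.ne'.isUnit, one_mulVec]
  have hmap := map_dotProduct_gaussMeasure hP (Pi.single v 1) p B hp rfl
  simp only [single_one_dotProduct, hB] at hmap
  have e : ∀ s t : ℝ, mass Q (Q *ᵥ B) {x | x v ∈ Set.Ico s t}
      = mass Q (Q *ᵥ B) Set.univ * (gaussianReal 0 (p v).toNNReal).real (Set.Ico s t) := by
    intro s t
    rw [mass_eq_gaussMeasure hP, ← hmap, map_measureReal_apply (measurable_pi_apply v)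
      measurableSet_Ico]
    rfl
  rw [e, e]
  have h1 : (1 : NNReal) ≤ (p v).toNNReal := by
    rw [← Real.toNNReal_one]
    exact Real.toNNReal_le_toNNReal (one_le_variance hP hv hp)
  nlinarith [mul_le_mul_of_nonneg_left (gaussianReal_Ico_le h1 hst)
    (mass_univ_pos hP (κ := Q *ᵥ B)).le]

/-- Let the field have mean `B`. The weight of the set where it lies in `[-1, 0)` at `v` and is
negative at `w` is bounded by Chernoff's inequality applied to the field at `w` with its value at
`v` given. Here `u` is the conditional covariance with the field at `w`. -/
lemma mass_neg_le (hP : Q.PosDef) {v w : V} {B u : V → ℝ} {q r : ℝ} (hB : B v = 0)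
    (hu : u v = 0) (hQu : Q *ᵥ u = Pi.single w 1 - Pi.single v q) (hq : q ≤ 1) (hr : 0 ≤ r) :
    mass Q (Q *ᵥ B) {x | x v ∈ Set.Ico (-1) 0 ∧ x w < 0}
      ≤ Real.exp (-r * (B w - 1) + r ^ 2 * u w / 2) *
        mass Q (Q *ᵥ B) {x | x v ∈ Set.Ico (-1) 0} := by
  have hsym := isSymm_of_posDef hP
  have h := mass_translate (κ := Q *ᵥ B) hsym {x | x v ∈ Set.Ico (-1) 0} (r • u)
  have hpre : ((fun x => x - r • u) ⁻¹' {x : V → ℝ | x v ∈ Set.Ico (-1) 0})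
      = {x | x v ∈ Set.Ico (-1) 0} := by
    ext x; simp [hu]
  have e : ∀ x : V → ℝ, (r • u) ⬝ᵥ (Q *ᵥ B - Q *ᵥ x) - ((r • u) ⬝ᵥ Q *ᵥ (r • u)) / 2
      = r * (B w - x w + q * x v) - r ^ 2 * u w / 2 := by
    intro x
    rw [← mulVec_sub, smul_dotProduct, smul_dotProduct, mulVec_smul, dotProduct_smul,
      dotProduct_mulVec_comm hsym u (B - x), hQu]
    simp only [dotProduct_sub, dotProduct_single, Pi.sub_apply, smul_eq_mul, hu, hB]
    ring
  simp_rw [hpre, e] at h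
  set S : Set (V → ℝ) := {x | x v ∈ Set.Ico (-1) 0} with hS
  have hint : Integrable fun x : V → ℝ =>
      Real.exp (r * (B w - x w + q * x v) - r ^ 2 * u w / 2) * gaussWeight Q (Q *ᵥ B) x := by
    have := (integrable_exp_mul_gaussWeight hP (Q *ᵥ B)
      (r • (Pi.single v q - Pi.single w 1))).const_mul (Real.exp (r * B w - r ^ 2 * u w / 2))
    refine this.congr (ae_of_all _ fun x => ?_)
    simp only [← mul_assoc, ← Real.exp_add]
    congr 2
    simp only [smul_dotProduct, sub_dotProduct, single_dotProduct, smul_eq_mul]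
    ring
  have hsub : {x : V → ℝ | x v ∈ Set.Ico (-1) 0 ∧ x w < 0} ⊆ S := fun x hx => hx.1
  have hmeas : MeasurableSet {x : V → ℝ | x v ∈ Set.Ico (-1) 0 ∧ x w < 0} :=
    (measurable_pi_apply v measurableSet_Ico).inter
      (measurableSet_lt (measurable_pi_apply w) measurable_const)
  have key : Real.exp (r * (B w - 1) - r ^ 2 * u w / 2) *
      mass Q (Q *ᵥ B) {x | x v ∈ Set.Ico (-1) 0 ∧ x w < 0} ≤ mass Q (Q *ᵥ B) S := by
    rw [h, mass, ← integral_const_mul]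
    refine le_trans (setIntegral_mono_on
      ((integrable_gaussWeight hP _).const_mul _).integrableOn hint.integrableOn hmeas
      fun x hx => ?_) (setIntegral_mono_set hint.integrableOn
        (ae_of_all _ fun x => (mul_pos (Real.exp_pos _) (gaussWeight_pos x)).le)
        hsub.eventuallyLE)
    refine mul_le_mul_of_nonneg_right (Real.exp_le_exp.2 ?_) (gaussWeight_pos x).le
    obtain ⟨⟨h1, h2⟩, h3⟩ := hx
    have : -1 ≤ q * x v := by
      rcases le_total 0 q with hq0 | hq0 <;> nlinarith
    have : r * (B w - 1) ≤ r * (B w - x w + q * x v) :=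
      mul_le_mul_of_nonneg_left (by linarith) hr
    linarith
  calc _ = Real.exp (-r * (B w - 1) + r ^ 2 * u w / 2) *
        (Real.exp (r * (B w - 1) - r ^ 2 * u w / 2) *
          mass Q (Q *ᵥ B) {x | x v ∈ Set.Ico (-1) 0 ∧ x w < 0}) := by
        rw [← mul_assoc, ← Real.exp_add]
        ring_nf
        simp
    _ ≤ _ := mul_le_mul_of_nonneg_left key (Real.exp_pos _).le

lemma gaussWeight_add_single (v : V) (κ x : V → ℝ) (θ : ℝ) :
    gaussWeight Q (κ + Pi.single v θ) x
      = Real.exp (θ * x v) * gaussWeight Q κ x := by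
  rw [← gaussWeight_mul_exp, single_dotProduct, mul_comm]

/-- `Barrier Q W v τ θ` says that there is a profile `B`, vanishing at `v` and a supersolution of
`Q B = τ` up to a charge `θ` at `v`, such that a field with mean `B` has a good chance to be
nonnegative on `W` even if it is negative at `v`. The last property is encoded by what the union bound
over `w ∈ W` needs: `u w` is Green's function at `w` killed at `v`, and `r w` is the parameter of
Chernoff's inequality for the field at `w`. -/
structure Barrier (Q : Matrix V V ℝ) (W : Finset V) (v : V) (τ : V → ℝ) (θ : ℝ) : Prop where
  exists_profile : ∃ B : V → ℝ, B v = 0 ∧ τ ≤ Q *ᵥ B + Pi.single v θ ∧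
    ∃ u : V → V → ℝ, (∀ w ∈ W, u w v = 0 ∧
      ∃ q ≤ 1, Q *ᵥ u w = Pi.single w 1 - Pi.single v q) ∧
    ∃ r : V → ℝ, (∀ w ∈ W, 0 ≤ r w) ∧
      ∑ w ∈ W, Real.exp (-r w * (B w - 1) + r w ^ 2 * u w w / 2) ≤ 1 / 2

/-- A bound for the conditional density of the field at the threshold of a point of `D`, when the
barrier at this point has charge `θ`. -/
noncomputable def hazardConst (θ : ℝ) : ℝ := 2 * Real.exp (5 * θ + 1 / 2)

lemma hazardConst_pos (θ : ℝ) : 0 < hazardConst θ := by unfold hazardConst; positivity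

lemma measurableSet_nonneg_on (W : Finset V) : MeasurableSet {x : V → ℝ | ∀ w ∈ W, 0 ≤ x w} := by
  have : {x : V → ℝ | ∀ w ∈ W, 0 ≤ x w} = ⋂ w ∈ W, {x | 0 ≤ x w} := by ext; simp
  rw [this]
  exact Finset.measurableSet_biInter _ fun w _ =>
    measurableSet_le measurable_const (measurable_pi_apply w)

/-- For a field with mean a barrier, tilted by the charge `θ` at `v`: the weight of the
configurations in a strip at `v` is comparable to that of the configurations below the strip. The
tilt varies by at most `exp (5 θ)` for values in `[-1, 4]`. -/
lemma mass_strip_le (hP : Q.PosDef) {v : V} (hv : Q v v = 1) {W : Finset V} {B : V → ℝ} {θ : ℝ}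
    (hθ : 0 ≤ θ) (hB : B v = 0) {u : V → V → ℝ}
    (hu : ∀ w ∈ W, u w v = 0 ∧ ∃ q ≤ 1, Q *ᵥ u w = Pi.single w 1 - Pi.single v q) {r : V → ℝ}
    (hr : ∀ w ∈ W, 0 ≤ r w)
    (hsum : ∑ w ∈ W, Real.exp (-r w * (B w - 1) + r w ^ 2 * u w w / 2) ≤ 1 / 2)
    {s t : ℝ} (hs : 0 ≤ s) (hst : s ≤ t) (ht : t ≤ 4) :
    mass Q (Q *ᵥ B + Pi.single v θ) {x | x v ∈ Set.Ico s t ∧ ∀ w ∈ W, 0 ≤ x w}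
      ≤ hazardConst θ * (t - s) *
        mass Q (Q *ᵥ B + Pi.single v θ) {x | x v < s ∧ ∀ w ∈ W, 0 ≤ x w} := by
  set κ := Q *ᵥ B
  have hI : ∀ s t : ℝ, MeasurableSet {x : V → ℝ | x v ∈ Set.Ico s t} := fun s t =>
    measurable_pi_apply v measurableSet_Ico
  have hIW : ∀ s t : ℝ, MeasurableSet {x : V → ℝ | x v ∈ Set.Ico s t ∧ ∀ w ∈ W, 0 ≤ x w} :=
    fun s t => (hI s t).inter (measurableSet_nonneg_on W)
  set m := mass Q κ {x | x v ∈ Set.Ico (-1) 0} with hm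
  have h1 : mass Q (κ + Pi.single v θ) {x | x v ∈ Set.Ico s t ∧ ∀ w ∈ W, 0 ≤ x w}
      ≤ Real.exp (4 * θ) * ((t - s) * Real.exp (1 / 2) * m) := by
    refine le_trans ?_ (mul_le_mul_of_nonneg_left (mass_Ico_le hP hv hB hst) (Real.exp_pos _).le)
    refine (mass_mono hP (T := {x | x v ∈ Set.Ico s t}) fun x hx => hx.1).trans ?_
    rw [mass, mass, ← integral_const_mul]
    refine setIntegral_mono_on (integrable_gaussWeight hP _).integrableOn
      ((integrable_gaussWeight hP _).const_mul _).integrableOn (hI s t) fun x hx => ?_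
    rw [gaussWeight_add_single]
    refine mul_le_mul_of_nonneg_right (Real.exp_le_exp.2 ?_) (gaussWeight_pos x).le
    nlinarith [hx.2]
  have h2 : m / 2 ≤ mass Q κ {x | x v ∈ Set.Ico (-1) 0 ∧ ∀ w ∈ W, 0 ≤ x w} := by
    have hcov : {x : V → ℝ | x v ∈ Set.Ico (-1) 0}
        ⊆ (⋃ w ∈ W, {x | x v ∈ Set.Ico (-1) 0 ∧ x w < 0}) ∪
          {x | x v ∈ Set.Ico (-1) 0 ∧ ∀ w ∈ W, 0 ≤ x w} := by
      intro x hx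
      by_cases hW : ∀ w ∈ W, 0 ≤ x w
      · exact Or.inr ⟨hx, hW⟩
      · push Not at hW
        obtain ⟨w, hw, hxw⟩ := hW
        exact Or.inl (Set.mem_biUnion (show w ∈ (W : Set V) from hw) ⟨hx, hxw⟩)
    have hb := (mass_mono hP (κ := κ) hcov).trans (mass_union_le hP (hIW _ _))
    have hc := mass_biUnion_le hP (κ := κ) W
      (S := fun w => {x : V → ℝ | x v ∈ Set.Ico (-1) 0 ∧ x w < 0}) fun w _ =>
        (hI _ _).inter (measurableSet_lt (measurable_pi_apply w) measurable_const)
    have hd : ∑ w ∈ W, mass Q κ {x | x v ∈ Set.Ico (-1) 0 ∧ x w < 0} ≤ 1 / 2 * m := by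
      refine le_trans ?_ (mul_le_mul_of_nonneg_right hsum (mass_nonneg _))
      rw [Finset.sum_mul]
      refine Finset.sum_le_sum fun w hw => ?_
      obtain ⟨h1, q, hq, h2⟩ := hu w hw
      exact mass_neg_le hP hB h1 h2 hq (hr w hw)
    linarith
  have h3 : Real.exp (-θ) * (m / 2)
      ≤ mass Q (κ + Pi.single v θ) {x | x v < s ∧ ∀ w ∈ W, 0 ≤ x w} := by
    refine (mul_le_mul_of_nonneg_left h2 (Real.exp_pos _).le).trans ?_
    refine le_trans ?_ (mass_mono hP (S := {x | x v ∈ Set.Ico (-1) 0 ∧ ∀ w ∈ W, 0 ≤ x w})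
      fun x hx => ⟨lt_of_lt_of_le hx.1.2 hs, hx.2⟩)
    rw [mass, mass, ← integral_const_mul]
    refine setIntegral_mono_on ((integrable_gaussWeight hP _).const_mul _).integrableOn
      (integrable_gaussWeight hP _).integrableOn (hIW _ _) fun x hx => ?_
    rw [gaussWeight_add_single]
    refine mul_le_mul_of_nonneg_right (Real.exp_le_exp.2 ?_) (gaussWeight_pos x).le
    nlinarith [hx.1.1]
  calc _ ≤ _ := h1
    _ = hazardConst θ * (t - s) * (Real.exp (-θ) * (m / 2)) := by
      have : Real.exp (5 * θ + 1 / 2) * Real.exp (-θ) = Real.exp (4 * θ) * Real.exp (1 / 2) := by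
        rw [← Real.exp_add, ← Real.exp_add]; ring_nf
      rw [hazardConst]
      linear_combination (-(t - s) * m) * this
    _ ≤ _ := mul_le_mul_of_nonneg_left h3
      (mul_nonneg (hazardConst_pos θ).le (sub_nonneg.2 hst))

lemma mass_pos_of_isOpen (hP : Q.PosDef) {O S : Set (V → ℝ)} (hO : IsOpen O) (hne : O.Nonempty)
    (hOS : O ⊆ S) : 0 < mass Q κ S := by
  refine lt_of_lt_of_le ?_ (mass_mono hP hOS)
  rw [mass, setIntegral_pos_iff_support_of_nonneg_ae
    (ae_of_all _ fun x => (gaussWeight_pos x).le) (integrable_gaussWeight hP κ).integrableOn]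
  have : Function.support (gaussWeight Q κ) = Set.univ :=
    Set.eq_univ_of_forall fun x => (gaussWeight_pos x).ne'
  rw [this, Set.univ_inter]
  exact hO.measure_pos volume hne

/-- The field is below the threshold `t` on `D`, nonnegative on `P` and in `[-1, 0)` on `R`. -/
def signBox (D P R : Finset V) (t : V → ℝ) : Set (V → ℝ) :=
  {x | (∀ v ∈ D, x v < t v) ∧ (∀ w ∈ P, 0 ≤ x w) ∧ ∀ w ∈ R, -1 ≤ x w ∧ x w < 0}

lemma measurableSet_lt_on (D : Finset V) (t : V → ℝ) :
    MeasurableSet {x : V → ℝ | ∀ v ∈ D, x v < t v} := by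
  have : {x : V → ℝ | ∀ v ∈ D, x v < t v} = ⋂ v ∈ D, {x | x v < t v} := by ext; simp
  rw [this]
  exact Finset.measurableSet_biInter _ fun v _ =>
    measurableSet_lt (measurable_pi_apply v) measurable_const

lemma measurableSet_signBox (D P R : Finset V) (t : V → ℝ) : MeasurableSet (signBox D P R t) := by
  have h : {x : V → ℝ | ∀ w ∈ R, -1 ≤ x w ∧ x w < 0} = ⋂ w ∈ R, {x | -1 ≤ x w ∧ x w < 0} := by
    ext; simp
  refine (measurableSet_lt_on D t).inter ((measurableSet_nonneg_on P).inter
    (show MeasurableSet {x : V → ℝ | ∀ w ∈ R, -1 ≤ x w ∧ x w < 0} from ?_))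
  rw [h]
  exact Finset.measurableSet_biInter _ fun w _ =>
    (measurableSet_le measurable_const (measurable_pi_apply w)).inter
      (measurableSet_lt (measurable_pi_apply w) measurable_const)

/-- Raising a single threshold from `s` to `t` increases the weight of a sign box at most by the
factor `exp (C (t - s))`. By stochastic monotonicity, it is enough to see this when all the other
negativity constraints are dropped and the mean is raised to that provided by a barrier. -/
lemma mass_signBox_update_le (hP : Q.PosDef) (hQ : ∀ i j, i ≠ j → Q i j ≤ 0)
    {D P R : Finset V} {v : V} (hv : v ∈ D) (hvP : v ∉ P ∪ R) (hQv : Q v v = 1) {θ : ℝ} (hθ : 0 ≤ θ)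
    (hbar : Barrier Q (P ∪ R) v κ θ) (T : V → ℝ) {s t : ℝ} (hs : 0 ≤ s) (hst : s ≤ t) (ht : t ≤ 4) :
    mass Q κ (signBox D P R (Function.update T v t))
      ≤ Real.exp (hazardConst θ * (t - s)) * mass Q κ (signBox D P R (Function.update T v s)) := by
  obtain ⟨B, hB, hκ, u, hu, r, hr, hsum⟩ := hbar
  have hstrip := mass_strip_le hP hQv hθ hB hu hr hsum hs hst ht
  set κ₂ := Q *ᵥ B + Pi.single v θ
  set S₁ := signBox D P R (Function.update T v t) with hS₁
  set S₂ : Set (V → ℝ) := {x | x v < t ∧ ∀ w ∈ P ∪ R, 0 ≤ x w} with hS₂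
  set A : Set (V → ℝ) := {x | s ≤ x v} with hA
  have mS₂ : MeasurableSet S₂ := (measurableSet_lt (measurable_pi_apply v) measurable_const).inter
    (measurableSet_nonneg_on _)
  have mA : MeasurableSet A := measurableSet_le measurable_const (measurable_pi_apply v)
  have h := mass_inter_mul_le hP hQ hκ (measurableSet_signBox D P R (Function.update T v t)) mS₂ mA
    (fun x y hxy hx => le_trans (show s ≤ x v from hx) (hxy v)) (by
      rintro x ⟨hx1, hx2, hx3⟩ y ⟨hy1, hy2⟩
      refine ⟨⟨?_, fun w hw => le_sup_of_le_right (hy2 w hw)⟩, fun w hw => ?_, fun w hw => ?_,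
        fun w hw => ⟨?_, ?_⟩⟩
      · have := hx1 v hv
        simp only [Function.update_self] at this
        exact max_lt this hy1
      · exact inf_lt_of_left_lt (hx1 w hw)
      · exact le_inf (hx2 w hw) (hy2 w (Finset.mem_union_left _ hw))
      · exact le_inf (hx3 w hw).1 (by linarith [hy2 w (Finset.mem_union_right _ hw)])
      · exact inf_lt_of_left_lt (hx3 w hw).2)
  have e1 : S₂ ∩ A = {x | x v ∈ Set.Ico s t ∧ ∀ w ∈ P ∪ R, 0 ≤ x w} := by
    ext x; simp only [S₂, A, Set.mem_inter_iff, Set.mem_ofPred_eq, Set.mem_Ico]; tauto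
  have e2 : S₂ \ A = {x | x v < s ∧ ∀ w ∈ P ∪ R, 0 ≤ x w} := by
    ext x
    simp only [S₂, A, Set.mem_sdiff, Set.mem_ofPred_eq, not_le]
    constructor
    · rintro ⟨⟨_, h⟩, h'⟩; exact ⟨h', h⟩
    · rintro ⟨h', h⟩; exact ⟨⟨h'.trans_le hst, h⟩, h'⟩
  have e3 : S₁ \ A = signBox D P R (Function.update T v s) := by
    ext x
    simp only [S₁, A, signBox, Set.mem_sdiff, Set.mem_ofPred_eq, not_le]
    constructor
    · rintro ⟨⟨h1, h2⟩, h'⟩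
      refine ⟨fun w hw => ?_, h2⟩
      rcases eq_or_ne w v with rfl | hwv
      · simpa using h'
      · simpa [hwv] using h1 w hw
    · rintro ⟨h1, h2⟩
      have h' : x v < s := by simpa using h1 v hv
      refine ⟨⟨fun w hw => ?_, h2⟩, h'⟩
      rcases eq_or_ne w v with rfl | hwv
      · simpa using h'.trans_le hst
      · simpa [hwv] using h1 w hw
  have d1 := mass_inter_add_diff hP (κ := κ) S₁ mA
  have d2 := mass_inter_add_diff hP (κ := κ₂) S₂ mA
  rw [e3] at d1
  rw [e1, e2] at d2
  rw [e1] at h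
  set c := hazardConst θ * (t - s) with hc
  have hc0 : 0 ≤ c := mul_nonneg (hazardConst_pos θ).le (sub_nonneg.2 hst)
  have p1 : 0 ≤ mass Q κ (S₁ ∩ A) := mass_nonneg _
  have p2 : 0 ≤ mass Q κ (signBox D P R (Function.update T v s)) := mass_nonneg _
  have p3 : 0 < mass Q κ₂ {x | x v < s ∧ ∀ w ∈ P ∪ R, 0 ≤ x w} := by
    refine mass_pos_of_isOpen hP (O := {x | x v < s ∧ ∀ w ∈ P ∪ R, 0 < x w}) ?_
      ⟨fun w => if w = v then s - 1 else 1, ?_, fun w hw => ?_⟩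
      fun x hx => ⟨hx.1, fun w hw => (hx.2 w hw).le⟩
    · have : {x : V → ℝ | x v < s ∧ ∀ w ∈ P ∪ R, 0 < x w}
          = {x | x v < s} ∩ ⋂ w ∈ P ∪ R, {x | 0 < x w} := by ext; simp
      rw [this]
      exact (isOpen_lt (continuous_apply v) continuous_const).inter
        (isOpen_biInter_finset fun w _ => isOpen_lt continuous_const (continuous_apply w))
    · simp
    · have : w ≠ v := fun h => hvP (h ▸ hw)
      simp [this]
  have hle : mass Q κ (S₁ ∩ A) ≤ c * mass Q κ (signBox D P R (Function.update T v s)) := by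
    rw [← d1, ← d2] at h
    set a₁ := mass Q κ (S₁ ∩ A)
    set b₁ := mass Q κ (signBox D P R (Function.update T v s))
    set a₂ := mass Q κ₂ {x | x v ∈ Set.Ico s t ∧ ∀ w ∈ P ∪ R, 0 ≤ x w}
    set b₂ := mass Q κ₂ {x | x v < s ∧ ∀ w ∈ P ∪ R, 0 ≤ x w}
    have h' : a₁ * b₂ ≤ a₂ * b₁ := by nlinarith
    have h'' : a₁ * b₂ ≤ (c * b₁) * b₂ := by nlinarith
    exact le_of_mul_le_mul_right h'' p3
  calc mass Q κ S₁ = _ := d1.symm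
    _ ≤ (c + 1) * mass Q κ (signBox D P R (Function.update T v s)) := by linarith
    _ ≤ _ := mul_le_mul_of_nonneg_right (Real.add_one_le_exp c) p2

end Threshold

/-! ### Repulsion data, and the charge flowing in -/

section Repulsion
open Matrix

variable {V : Type*} [Fintype V] [DecidableEq V]

/-- The data for entropic repulsion of a Gaussian field on a finite set `V`, with precision matrix
`Q`, conditioned to be negative on `D ∪ R` and nonnegative on `P`. The potential `g` has charge `a` on
`D`, negative charge on `P ∪ R`, where it vanishes, and no charge elsewhere. The row sums `Q *ᵥ 1` are
the killing rates, `lam` bounds the boundary values, `θ` is the charge of the barriers and `4 β` bounds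
the potential on `D`. -/
structure RepulsionData (Q : Matrix V V ℝ) (D P R : Finset V) (a g : V → ℝ) (lam θ β : ℝ) :
    Prop where
  posDef : Q.PosDef
  offDiag : ∀ i j, i ≠ j → Q i j ≤ 0
  disj_DP : Disjoint D P
  disj_DR : Disjoint D R
  disj_PR : Disjoint P R
  diag : ∀ v ∈ D, Q v v = 1
  row_nonneg : ∀ v, 0 ≤ (Q *ᵥ 1) v
  lam_nonneg : 0 ≤ lam
  theta_nonneg : 0 ≤ θ
  beta_pos : 0 < β
  a_nonneg : ∀ v, 0 ≤ a v
  a_zero : ∀ v ∉ D, a v = 0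
  g_nonneg : ∀ v, 0 ≤ g v
  g_zero : ∀ v ∈ P ∪ R, g v = 0
  charge_D : ∀ v ∈ D, (Q *ᵥ g) v = a v
  charge_O : ∀ v, v ∉ D → v ∉ P ∪ R → (Q *ᵥ g) v = 0
  g_le : ∀ v ∈ D, g v ≤ 4 * β
  nbr : ∀ v ∈ D, (∃ w ∈ P, Q v w ≤ -(1 / 4)) ∨ 1 / 4 ≤ (Q *ᵥ 1) v
  barrier : ∀ v ∈ D, Barrier Q (P ∪ R) v (lam • Q *ᵥ 1) θ

namespace RepulsionData

variable {Q : Matrix V V ℝ} {D P R : Finset V} {a g : V → ℝ} {lam θ β : ℝ}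

lemma isSymm (h : RepulsionData Q D P R a g lam θ β) : Q.IsSymm := isSymm_of_posDef h.posDef

lemma charge_nonpos (h : RepulsionData Q D P R a g lam θ β) {w : V} (hw : w ∈ P ∪ R) :
    (Q *ᵥ g) w ≤ 0 := by
  rw [mulVec, dotProduct]
  refine Finset.sum_nonpos fun j _ => ?_
  rcases eq_or_ne w j with rfl | hj
  · rw [h.g_zero w hw, mul_zero]
  · exact mul_nonpos_of_nonpos_of_nonneg (h.offDiag w j hj) (h.g_nonneg j)

lemma a_le_g (h : RepulsionData Q D P R a g lam θ β) {v : V} (hv : v ∈ D) : a v ≤ g v := by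
  rw [← h.charge_D v hv, mulVec, dotProduct, ← Finset.add_sum_erase _ _ (Finset.mem_univ v),
    h.diag v hv, one_mul]
  have : ∑ j ∈ Finset.univ.erase v, Q v j * g j ≤ 0 := Finset.sum_nonpos fun j hj =>
    mul_nonpos_of_nonpos_of_nonneg (h.offDiag v j (Finset.ne_of_mem_erase hj).symm) (h.g_nonneg j)
  linarith

lemma sum_eq (h : RepulsionData Q D P R a g lam θ β) (x : V → ℝ) :
    (Q *ᵥ g) ⬝ᵥ x = ∑ v ∈ D, a v * x v + ∑ w ∈ P, (Q *ᵥ g) w * x w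
      + ∑ w ∈ R, (Q *ᵥ g) w * x w := by
  have hPR : Disjoint D (P ∪ R) := Finset.disjoint_union_right.2 ⟨h.disj_DP, h.disj_DR⟩
  rw [add_assoc, ← Finset.sum_union h.disj_PR, dotProduct,
    ← Finset.sum_subset (Finset.subset_univ (D ∪ (P ∪ R))), Finset.sum_union hPR]
  · rw [Finset.sum_congr rfl fun v hv => by rw [h.charge_D v hv]]
  · intro v _ hv
    rw [Finset.mem_union, not_or] at hv
    rw [h.charge_O v hv.1 hv.2, zero_mul]

lemma dotProduct_row (h : RepulsionData Q D P R a g lam θ β) :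
    g ⬝ᵥ Q *ᵥ 1 = ∑ v ∈ D, a v + ∑ w ∈ P, (Q *ᵥ g) w + ∑ w ∈ R, (Q *ᵥ g) w := by
  rw [dotProduct_mulVec_comm h.isSymm, dotProduct_comm, h.sum_eq]
  simp

lemma dotProduct_row_nonneg (h : RepulsionData Q D P R a g lam θ β) : 0 ≤ g ⬝ᵥ Q *ᵥ 1 :=
  Finset.sum_nonneg fun v _ => mul_nonneg (h.g_nonneg v) (h.row_nonneg v)

lemma sum_P_nonpos (h : RepulsionData Q D P R a g lam θ β) : ∑ w ∈ P, (Q *ᵥ g) w ≤ 0 :=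
  Finset.sum_nonpos fun _ hw => h.charge_nonpos (Finset.mem_union_left _ hw)

lemma sum_R_nonpos (h : RepulsionData Q D P R a g lam θ β) : ∑ w ∈ R, (Q *ᵥ g) w ≤ 0 :=
  Finset.sum_nonpos fun _ hw => h.charge_nonpos (Finset.mem_union_right _ hw)

/-- Every point of `D` sends at least a quarter of its mass to `P` or to the boundary. -/
lemma sum_g_le (h : RepulsionData Q D P R a g lam θ β) : ∑ v ∈ D, g v ≤ 4 * ∑ v ∈ D, a v := by
  have h1 : ∀ v ∈ D, g v / 4 ≤ g v * (Q *ᵥ 1) v + ∑ w ∈ P, -Q w v * g v := by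
    intro v hv
    have hs : ∀ w ∈ P, 0 ≤ -Q w v * g v := fun w hw => by
      have hwv : w ≠ v := fun e => Finset.disjoint_left.1 h.disj_DP hv (e ▸ hw)
      have := h.offDiag w v hwv
      exact mul_nonneg (by linarith) (h.g_nonneg v)
    rcases h.nbr v hv with ⟨w, hw, hq⟩ | hq
    · have h2 := Finset.single_le_sum hs hw
      have h3 : Q w v = Q v w := congrFun (congrFun h.isSymm v) w
      have h4 := mul_nonneg (h.g_nonneg v) (h.row_nonneg v)
      have h5 := h.g_nonneg v
      rw [h3] at h2
      nlinarith
    · have h2 := Finset.sum_nonneg hs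
      have h5 := h.g_nonneg v
      nlinarith
  have h2 := Finset.sum_le_sum h1
  rw [Finset.sum_add_distrib, ← Finset.sum_div] at h2
  have h3 : ∑ v ∈ D, g v * (Q *ᵥ 1) v ≤ g ⬝ᵥ Q *ᵥ 1 :=
    Finset.sum_le_sum_of_subset_of_nonneg (Finset.subset_univ D) fun v _ _ =>
      mul_nonneg (h.g_nonneg v) (h.row_nonneg v)
  have h4 : ∑ v ∈ D, ∑ w ∈ P, -Q w v * g v ≤ ∑ w ∈ P, -(Q *ᵥ g) w := by
    rw [Finset.sum_comm]
    refine Finset.sum_le_sum fun w hw => ?_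
    rw [mulVec, dotProduct, ← Finset.sum_neg_distrib]
    simp_rw [neg_mul]
    refine Finset.sum_le_sum_of_subset_of_nonneg (Finset.subset_univ D) fun v _ _ => ?_
    rcases eq_or_ne w v with rfl | hwv
    · rw [h.g_zero w (Finset.mem_union_left _ hw)]; simp
    · have := mul_nonpos_of_nonpos_of_nonneg (h.offDiag w v hwv) (h.g_nonneg v)
      linarith
  rw [Finset.sum_neg_distrib] at h4
  have h5 := h.dotProduct_row
  have h6 := h.sum_R_nonpos
  linarith

lemma dotProduct_charge (h : RepulsionData Q D P R a g lam θ β) :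
    g ⬝ᵥ Q *ᵥ g = ∑ v ∈ D, a v * g v := by
  rw [dotProduct_comm, h.sum_eq, Finset.sum_eq_zero (s := P), Finset.sum_eq_zero (s := R)]
  · ring
  · intro w hw; rw [h.g_zero w (Finset.mem_union_right _ hw), mul_zero]
  · intro w hw; rw [h.g_zero w (Finset.mem_union_left _ hw), mul_zero]

lemma dotProduct_charge_le (h : RepulsionData Q D P R a g lam θ β) :
    ∑ v ∈ D, a v * g v ≤ 4 * β * ∑ v ∈ D, a v := by
  rw [Finset.mul_sum]
  refine Finset.sum_le_sum fun v hv => ?_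
  rw [mul_comm]
  exact mul_le_mul_of_nonneg_right (h.g_le v hv) (h.a_nonneg v)

/-- Raising all thresholds on `D` from `0` to `s g`. -/
lemma mass_signBox_le (h : RepulsionData Q D P R a g lam θ β) {s : ℝ} (hs : 0 ≤ s)
    (hs4 : ∀ v ∈ D, s * g v ≤ 4) :
    mass Q (lam • Q *ᵥ 1) (signBox D P R (s • g))
      ≤ Real.exp (hazardConst θ * (s * ∑ v ∈ D, g v)) *
        mass Q (lam • Q *ᵥ 1) (signBox D P R 0) := by
  set κ := lam • Q *ᵥ (1 : V → ℝ)
  have key : ∀ F : Finset V, F ⊆ D →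
      mass Q κ (signBox D P R fun v => if v ∈ F then s * g v else 0)
        ≤ Real.exp (hazardConst θ * (s * ∑ v ∈ F, g v)) * mass Q κ (signBox D P R 0) := by
    intro F
    induction F using Finset.induction_on with
    | empty => intro _; simp [Pi.zero_def]
    | insert v F hv ih =>
      intro hF
      have hvD : v ∈ D := hF (Finset.mem_insert_self _ _)
      have h1 := mass_signBox_update_le h.posDef h.offDiag (P := P) (R := R) hvD (by
        rw [Finset.mem_union, not_or]
        exact ⟨Finset.disjoint_left.1 h.disj_DP hvD, Finset.disjoint_left.1 h.disj_DR hvD⟩)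
        (h.diag v hvD) h.theta_nonneg (h.barrier v hvD)
        (fun v => if v ∈ F then s * g v else 0) le_rfl (mul_nonneg hs (h.g_nonneg v)) (hs4 v hvD)
      have e1 : Function.update (fun v => if v ∈ F then s * g v else 0) v (s * g v)
          = fun w => if w ∈ insert v F then s * g w else 0 := by
        ext w
        rcases eq_or_ne w v with rfl | hw <;> simp [*]
      have e2 : Function.update (fun v => if v ∈ F then s * g v else 0) v 0
          = fun w => if w ∈ F then s * g w else 0 := by
        ext w
        rcases eq_or_ne w v with rfl | hw <;> simp [*]
      rw [e1, e2, sub_zero] at h1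
      refine h1.trans ((mul_le_mul_of_nonneg_left
        (ih ((Finset.subset_insert _ _).trans hF)) (Real.exp_pos _).le).trans_eq ?_)
      rw [← mul_assoc, ← Real.exp_add, Finset.sum_insert hv]
      ring_nf
  have h1 := key D subset_rfl
  convert h1 using 2
  ext x
  simp only [signBox, Set.mem_ofPred_eq, Pi.smul_apply, smul_eq_mul]
  refine and_congr_left fun _ => forall₂_congr fun v hv => by simp [hv]

/-- The field on `P` weighted by the charge that `g` absorbs there. -/
noncomputable def inflow (Q : Matrix V V ℝ) (P : Finset V) (g x : V → ℝ) : ℝ :=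
  ∑ w ∈ P, -(Q *ᵥ g) w * x w

lemma measurable_inflow : Measurable (inflow Q P g) := by
  unfold inflow
  fun_prop

lemma dotProduct_sub_charge (h : RepulsionData Q D P R a g lam θ β) (x : V → ℝ) :
    g ⬝ᵥ (lam • Q *ᵥ 1 - Q *ᵥ x)
      = lam * (g ⬝ᵥ Q *ᵥ 1) - ∑ v ∈ D, a v * x v + inflow Q P g x
        - ∑ w ∈ R, (Q *ᵥ g) w * x w := by
  rw [dotProduct_sub, dotProduct_smul, smul_eq_mul, dotProduct_mulVec_comm h.isSymm g x,
    dotProduct_comm x, h.sum_eq, inflow]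
  simp only [neg_mul, Finset.sum_neg_distrib]
  ring

/-- The inflow is unlikely to be large: translating the field by `g / β` turns a large inflow into a
large density, while it only raises the thresholds on `D` by a bounded amount. -/
lemma mass_inflow_le (h : RepulsionData Q D P R a g lam θ β) :
    mass Q (lam • Q *ᵥ 1) (signBox D P R 0 ∩
        {x | (4 + 4 * hazardConst θ) * ∑ v ∈ D, a v < inflow Q P g x})
      ≤ Real.exp (-((∑ v ∈ D, a v) / β)) * mass Q (lam • Q *ᵥ 1) (signBox D P R 0) := by
  set H := ∑ v ∈ D, a v with hH
  set M := 4 + 4 * hazardConst θ with hM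
  set κ := lam • Q *ᵥ (1 : V → ℝ) with hκ
  set E := signBox D P R 0 with hE
  have hβ := h.beta_pos
  have hH0 : 0 ≤ H := Finset.sum_nonneg fun v _ => h.a_nonneg v
  have htr := mass_translate (κ := κ) h.isSymm E (β⁻¹ • g)
  have hpre : (fun x => x - β⁻¹ • g) ⁻¹' E = signBox D P R (β⁻¹ • g) := by
    ext x
    simp only [hE, signBox, Set.mem_preimage, Set.mem_ofPred_eq, Pi.sub_apply, Pi.smul_apply,
      smul_eq_mul, Pi.zero_apply, sub_neg]
    refine and_congr_right fun _ => and_congr (forall₂_congr fun w hw => ?_)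
      (forall₂_congr fun w hw => ?_)
    · rw [h.g_zero w (Finset.mem_union_left _ hw)]; simp
    · rw [h.g_zero w (Finset.mem_union_right _ hw)]; simp
  rw [hpre] at htr
  have hbox := h.mass_signBox_le (inv_nonneg.2 hβ.le) fun v hv => by
    rw [inv_mul_le_iff₀ hβ]; linarith [h.g_le v hv]
  rw [htr] at hbox
  have hint : Integrable fun x => Real.exp ((β⁻¹ • g) ⬝ᵥ (κ - Q *ᵥ x)
      - ((β⁻¹ • g) ⬝ᵥ Q *ᵥ (β⁻¹ • g)) / 2) * gaussWeight Q κ x := by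
    have := (integrable_gaussWeight h.posDef κ).comp_add_right (β⁻¹ • g)
    refine this.congr (ae_of_all _ fun x => ?_)
    simp only [gaussWeight_add h.isSymm, mul_comm]
  set E' := E ∩ {x | M * H < inflow Q P g x} with hE'
  have hmE' : MeasurableSet E' := (measurableSet_signBox D P R 0).inter
    (measurableSet_lt measurable_const measurable_inflow)
  have hlow : Real.exp ((M - 3) * (H / β)) * mass Q κ E' ≤ ∫ x in E, Real.exp ((β⁻¹ • g) ⬝ᵥ
      (κ - Q *ᵥ x) - ((β⁻¹ • g) ⬝ᵥ Q *ᵥ (β⁻¹ • g)) / 2) * gaussWeight Q κ x := by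
    rw [mass, ← integral_const_mul]
    refine le_trans (setIntegral_mono_on
      ((integrable_gaussWeight h.posDef _).const_mul _).integrableOn hint.integrableOn hmE'
      fun x hx => ?_) (setIntegral_mono_set hint.integrableOn
        (ae_of_all _ fun x => (mul_pos (Real.exp_pos _) (gaussWeight_pos x)).le)
        (show E' ⊆ E from Set.inter_subset_left).eventuallyLE)
    refine mul_le_mul_of_nonneg_right (Real.exp_le_exp.2 ?_) (gaussWeight_pos x).le
    obtain ⟨⟨hx1, hx2, hx3⟩, hx4⟩ := hx
    rw [smul_dotProduct, mulVec_smul, smul_dotProduct, dotProduct_smul, h.dotProduct_sub_charge,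
      h.dotProduct_charge]
    have i1 : ∑ v ∈ D, a v * x v ≤ 0 := Finset.sum_nonpos fun v hv =>
      mul_nonpos_of_nonneg_of_nonpos (h.a_nonneg v) (hx1 v hv).le
    have i2 : ∑ w ∈ R, (Q *ᵥ g) w * x w ≤ H := by
      calc ∑ w ∈ R, (Q *ᵥ g) w * x w ≤ ∑ w ∈ R, -(Q *ᵥ g) w := by
            refine Finset.sum_le_sum fun w hw => ?_
            have := h.charge_nonpos (Finset.mem_union_right P hw)
            nlinarith [(hx3 w hw).1]
        _ = -∑ w ∈ R, (Q *ᵥ g) w := Finset.sum_neg_distrib _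
        _ ≤ H := by
            have := h.dotProduct_row
            have := h.dotProduct_row_nonneg
            have := h.sum_P_nonpos
            linarith
    have i3 := mul_nonneg h.lam_nonneg h.dotProduct_row_nonneg
    have i4 := h.dotProduct_charge_le
    have i5 : (M - 1) * H ≤ lam * (g ⬝ᵥ Q *ᵥ 1) - ∑ v ∈ D, a v * x v + inflow Q P g x
        - ∑ w ∈ R, (Q *ᵥ g) w * x w := by
      have : M * H < inflow Q P g x := hx4
      linarith
    simp only [smul_eq_mul]
    have i6 : β⁻¹ * ((M - 1) * H) ≤ β⁻¹ * (lam * (g ⬝ᵥ Q *ᵥ 1) - ∑ v ∈ D, a v * x v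
        + inflow Q P g x - ∑ w ∈ R, (Q *ᵥ g) w * x w) :=
      mul_le_mul_of_nonneg_left i5 (inv_nonneg.2 hβ.le)
    have i7 : β⁻¹ * (β⁻¹ * ∑ v ∈ D, a v * g v) ≤ 4 * (H / β) := by
      calc β⁻¹ * (β⁻¹ * ∑ v ∈ D, a v * g v) ≤ β⁻¹ * (β⁻¹ * (4 * β * H)) := by gcongr
        _ = 4 * (H / β) := by field_simp
    have i8 : β⁻¹ * ((M - 1) * H) = (M - 1) * (H / β) := by ring
    linarith
  have hg := h.sum_g_le
  have hC := hazardConst_pos θ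
  have hexp : Real.exp (hazardConst θ * (β⁻¹ * ∑ v ∈ D, g v))
      ≤ Real.exp (4 * hazardConst θ * (H / β)) := by
    apply Real.exp_le_exp.2
    calc hazardConst θ * (β⁻¹ * ∑ v ∈ D, g v) ≤ hazardConst θ * (β⁻¹ * (4 * H)) := by gcongr
      _ = _ := by ring
  have h1 := hlow.trans (hbox.trans (mul_le_mul_of_nonneg_right hexp (mass_nonneg E)))
  calc mass Q κ E' = Real.exp (-((M - 3) * (H / β))) *
        (Real.exp ((M - 3) * (H / β)) * mass Q κ E') := by
        rw [← mul_assoc, ← Real.exp_add]; simp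
    _ ≤ Real.exp (-((M - 3) * (H / β))) *
        (Real.exp (4 * hazardConst θ * (H / β)) * mass Q κ E) := by gcongr
    _ = Real.exp (-(H / β)) * mass Q κ E := by
        rw [← mul_assoc, ← Real.exp_add, hM]; ring_nf

end RepulsionData

end Repulsion

/-! ### Repulsion under the tilted law -/

section Repulsion
open Matrix

variable {V : Type*} [Fintype V] [DecidableEq V]

lemma integrable_grad_mul_gaussWeight {Q : Matrix V V ℝ} (hP : Q.PosDef) (κ h : V → ℝ) :
    Integrable fun x => h ⬝ᵥ (κ - Q *ᵥ x) * gaussWeight Q κ x := by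
  have h1 := ((integrable_gaussWeight hP κ).const_mul (h ⬝ᵥ κ)).sub
    (integrable_dotProduct_mul_gaussWeight hP κ (Q *ᵥ h))
  refine h1.congr (ae_of_all _ fun x => ?_)
  simp only [Pi.sub_apply, dotProduct_sub]
  rw [dotProduct_mulVec_comm (isSymm_of_posDef hP) h x, dotProduct_comm x]
  ring

/-- Translating a set and bounding the density ratio by `1 + y ≤ exp y` gives an integration by
parts inequality, in which `κ - Q x` is the gradient of the logarithm of the density. -/
lemma mass_translate_ge {Q : Matrix V V ℝ} (hP : Q.PosDef) (κ : V → ℝ) (S : Set (V → ℝ))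
    (h : V → ℝ) :
    mass Q κ S + (∫ x in S, h ⬝ᵥ (κ - Q *ᵥ x) * gaussWeight Q κ x)
        - (h ⬝ᵥ Q *ᵥ h) / 2 * mass Q κ S
      ≤ mass Q κ ((fun x => x - h) ⁻¹' S) := by
  have hsym := isSymm_of_posDef hP
  have hint : Integrable fun x => Real.exp (h ⬝ᵥ (κ - Q *ᵥ x)
      - (h ⬝ᵥ Q *ᵥ h) / 2) * gaussWeight Q κ x := by
    refine ((integrable_gaussWeight hP κ).comp_add_right h).congr (ae_of_all _ fun x => ?_)
    simp only [gaussWeight_add hsym, mul_comm]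
  have hint2 := integrable_grad_mul_gaussWeight hP κ h
  have hint3 := integrable_gaussWeight hP κ
  have hint4 : Integrable fun x => gaussWeight Q κ x + h ⬝ᵥ (κ - Q *ᵥ x) * gaussWeight Q κ x :=
    hint3.add hint2
  rw [mass_translate hsym, mass, ← integral_const_mul,
    ← integral_add hint3.integrableOn hint2.integrableOn,
    ← integral_sub hint4.integrableOn (hint3.const_mul _).integrableOn]
  refine setIntegral_mono (hint4.sub (hint3.const_mul _)).integrableOn
    hint.integrableOn fun x => ?_
  have := mul_le_mul_of_nonneg_right (Real.add_one_le_exp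
    (h ⬝ᵥ (κ - Q *ᵥ x) - (h ⬝ᵥ Q *ᵥ h) / 2)) (gaussWeight_pos (Q := Q) (κ := κ) x).le
  simp only at this ⊢
  linarith

lemma nonneg_of_forall_le {I c : ℝ} (h : ∀ η > 0, -(η * c) ≤ I) : 0 ≤ I := by
  by_contra! hI
  rcases le_or_gt c 0 with hc | hc
  · have := h 1 one_pos; linarith
  · have := h (-I / (2 * c)) (by apply div_pos <;> linarith)
    have e : -I / (2 * c) * c = -I / 2 := by field_simp
    linarith

namespace RepulsionData

variable {Q : Matrix V V ℝ} {D P R : Finset V} {a g : V → ℝ} {lam θ β : ℝ}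

/-- The conditioning event restricted to configurations with inflow at most `L`. -/
def tameBox (Q : Matrix V V ℝ) (D P R : Finset V) (g : V → ℝ) (L : ℝ) : Set (V → ℝ) :=
  signBox D P R 0 ∩ {x | inflow Q P g x ≤ L}

lemma measurableSet_tameBox (L : ℝ) : MeasurableSet (tameBox Q D P R g L) :=
  (measurableSet_signBox D P R 0).inter (measurableSet_le measurable_inflow measurable_const)

lemma inflow_congr {x y : V → ℝ} (hxy : ∀ w ∈ P, x w = y w) :
    inflow Q P g x = inflow Q P g y :=
  Finset.sum_congr rfl fun w hw => by rw [hxy w hw]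

lemma mem_tameBox_of_le {L : ℝ} {x y : V → ℝ}
    (hD : ∀ v ∈ D, y v ≤ x v) (hPR : ∀ w ∈ P ∪ R, y w = x w) (hx : x ∈ tameBox Q D P R g L) :
    y ∈ tameBox Q D P R g L := by
  obtain ⟨⟨h1, h2, h3⟩, h4⟩ := hx
  refine ⟨⟨fun v hv => (hD v hv).trans_lt (h1 v hv), fun w hw => ?_, fun w hw => ?_⟩, ?_⟩
  · rw [hPR w (Finset.mem_union_left _ hw)]; exact h2 w hw
  · rw [hPR w (Finset.mem_union_right _ hw)]; exact h3 w hw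
  · rw [Set.mem_ofPred_eq, inflow_congr fun w hw => hPR w (Finset.mem_union_left _ hw)]
    exact h4

section Tilted

variable (κ : V → ℝ) (L : ℝ)

/-- The field at a point `v` of `D` is unlikely to lie in `[-ε, 0)`, by comparison with the
configuration lowered by `ε` at `v`. -/
lemma mass_near_zero_le (h : RepulsionData Q D P R a g lam θ β) {v : V} (hv : v ∈ D) {ε : ℝ}
    (hε : 0 < ε) :
    mass Q κ (tameBox Q D P R g L ∩ {x | -ε ≤ x v})
      ≤ ε * (∫ x in tameBox Q D P R g L, (κ - Q *ᵥ x) v * gaussWeight Q κ x)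
        + ε ^ 2 / 2 * mass Q κ (tameBox Q D P R g L) := by
  set S := tameBox Q D P R g L
  have h1 := mass_translate_ge h.posDef κ S (Pi.single v (-ε))
  have e1 : ∀ x, (Pi.single v (-ε) : V → ℝ) ⬝ᵥ (κ - Q *ᵥ x) * gaussWeight Q κ x
      = -ε * ((κ - Q *ᵥ x) v * gaussWeight Q κ x) := fun x => by
    rw [single_dotProduct, mul_assoc]
  have e2 : (Pi.single v (-ε) : V → ℝ) ⬝ᵥ Q *ᵥ Pi.single v (-ε) = ε ^ 2 := by
    rw [single_dotProduct, mulVec_single]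
    simp only [Pi.smul_apply, MulOpposite.smul_eq_mul_unop, MulOpposite.unop_op, col_apply,
      h.diag v hv]
    ring
  simp_rw [e1] at h1
  rw [integral_const_mul, e2] at h1
  have hvPR : ∀ w ∈ P ∪ R, w ≠ v := by
    rintro w hw rfl
    rcases Finset.mem_union.1 hw with hw | hw
    · exact Finset.disjoint_left.1 h.disj_DP hv hw
    · exact Finset.disjoint_left.1 h.disj_DR hv hw
  have h2 : (fun x => x - Pi.single v (-ε)) ⁻¹' S ⊆ S \ {x | -ε ≤ x v} := by
    intro x hx
    refine ⟨mem_tameBox_of_le (fun w _ => ?_) (fun w hw => ?_) hx, ?_⟩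
    · simp only [Pi.sub_apply]
      rcases eq_or_ne w v with rfl | hw <;> simp [*, hε.le]
    · simp [hvPR w hw]
    · have := hx.1.1 v hv
      simp only [Pi.sub_apply, Pi.single_eq_same, Pi.zero_apply] at this
      simp only [Set.mem_ofPred_eq, not_le]
      linarith
  have h3 := h1.trans (mass_mono h.posDef h2)
  have mA : MeasurableSet {x : V → ℝ | -ε ≤ x v} :=
    measurableSet_le measurable_const (measurable_pi_apply v)
  have h4 := mass_inter_add_diff h.posDef (κ := κ) S mA
  linarith

lemma integral_grad_nonneg (h : RepulsionData Q D P R a g lam θ β) {v : V} (hv : v ∈ D) :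
    0 ≤ ∫ x in tameBox Q D P R g L, (κ - Q *ᵥ x) v * gaussWeight Q κ x := by
  refine nonneg_of_forall_le (c := mass Q κ (tameBox Q D P R g L) / 2) fun η hη => ?_
  have h1 := (mass_nonneg _).trans (h.mass_near_zero_le κ L hv hη)
  by_contra! hc
  nlinarith

/-- The coordinates outside `D`, `P` and `R` are not constrained, so that integration by parts in
these directions produces no boundary term. -/
lemma integral_grad_free_nonneg (h : RepulsionData Q D P R a g lam θ β) {k : V → ℝ}
    (hk : ∀ v ∈ D ∪ (P ∪ R), k v = 0) :
    0 ≤ ∫ x in tameBox Q D P R g L, k ⬝ᵥ (κ - Q *ᵥ x) * gaussWeight Q κ x := by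
  set S := tameBox Q D P R g L
  refine nonneg_of_forall_le (c := (k ⬝ᵥ Q *ᵥ k) / 2 * mass Q κ S) fun η hη => ?_
  have h3 := mass_translate_ge h.posDef κ S (-(η • k))
  have h4 : (fun x => x - -(η • k)) ⁻¹' S ⊆ S := by
    intro x hx
    refine mem_tameBox_of_le (fun w hw => ?_) (fun w hw => ?_) hx
    · simp [hk w (Finset.mem_union_left _ hw)]
    · simp [hk w (Finset.mem_union_right _ hw)]
  have h5 := h3.trans (mass_mono h.posDef h4)
  have e1 : ∀ x, (-(η • k)) ⬝ᵥ (κ - Q *ᵥ x) * gaussWeight Q κ x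
      = -η * (k ⬝ᵥ (κ - Q *ᵥ x) * gaussWeight Q κ x) := fun x => by
    rw [neg_dotProduct, smul_dotProduct, smul_eq_mul]; ring
  have e2 : (-(η • k)) ⬝ᵥ Q *ᵥ (-(η • k)) = η ^ 2 * (k ⬝ᵥ Q *ᵥ k) := by
    rw [mulVec_neg, neg_dotProduct, dotProduct_neg, mulVec_smul, smul_dotProduct,
      dotProduct_smul, smul_eq_mul, smul_eq_mul]; ring
  simp_rw [e1] at h5
  rw [integral_const_mul, e2] at h5
  by_contra! hc
  nlinarith

end Tilted

/-- The weighted field is repelled from `0` on average, under the law tilted by `t a`. -/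
lemma integral_weightedField_ge (h : RepulsionData Q D P R a g lam θ β) {M Θ t : ℝ}
    (hM : 0 ≤ M) (hΘ : Θ = 1 + M + lam) (ht : t = Θ / β) :
    (∑ v ∈ D, a v) / (40 * Θ) *
        mass Q (lam • Q *ᵥ 1 + t • a) (tameBox Q D P R g (M * ∑ v ∈ D, a v))
      ≤ ∫ x in tameBox Q D P R g (M * ∑ v ∈ D, a v),
          -(∑ v ∈ D, a v * x v) * gaussWeight Q (lam • Q *ᵥ 1 + t • a) x := by
  set H := ∑ v ∈ D, a v with hH
  set κ := lam • Q *ᵥ (1 : V → ℝ) + t • a with hκ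
  set S := tameBox Q D P R g (M * H) with hS
  have hP := h.posDef
  have hβ := h.beta_pos
  have hlam := h.lam_nonneg
  have hΘ1 : 1 ≤ Θ := by linarith
  have ht0 : 0 ≤ t := by rw [ht]; positivity
  have htβ : t * β = Θ := by rw [ht]; field_simp
  have hH0 : 0 ≤ H := Finset.sum_nonneg fun v _ => h.a_nonneg v
  set m := mass Q κ S
  have hm : 0 ≤ m := mass_nonneg _
  have mS : MeasurableSet S := measurableSet_tameBox _
  have hgw := integrable_gaussWeight hP κ
  have hcoord : ∀ v : V, Integrable fun x : V → ℝ => x v * gaussWeight Q κ x := fun v => by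
    simpa using integrable_dotProduct_mul_gaussWeight hP κ (Pi.single v 1)
  have hYint : Integrable fun x : V → ℝ => -(∑ v ∈ D, a v * x v) * gaussWeight Q κ x := by
    have : Integrable fun x : V → ℝ => ∑ v ∈ D, -a v * (x v * gaussWeight Q κ x) :=
      integrable_finsetSum _ fun v _ => (hcoord v).const_mul _
    refine this.congr (ae_of_all _ fun x => ?_)
    simp only [neg_mul, Finset.sum_mul, Finset.sum_neg_distrib, mul_assoc]
  set Y := ∫ x in S, -(∑ v ∈ D, a v * x v) * gaussWeight Q κ x with hY
  set T : V → ℝ := fun v => ∫ x in S, (κ - Q *ᵥ x) v * gaussWeight Q κ x with hT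
  have hTint : ∀ v, Integrable fun x : V → ℝ => (κ - Q *ᵥ x) v * gaussWeight Q κ x := fun v => by
    simpa using integrable_grad_mul_gaussWeight hP κ (Pi.single v 1)
  have hT0 : ∀ v ∈ D, 0 ≤ T v := fun v hv => h.integral_grad_nonneg κ _ hv
  -- integration by parts in the direction `g` bounds the total boundary density on `D`
  have hTsum : ∑ v ∈ D, a v * T v ≤ Y + 5 * Θ * H * m := by
    have s1 : ∑ v ∈ D, a v * T v ≤ ∑ v ∈ D, g v * T v :=
      Finset.sum_le_sum fun v hv => mul_le_mul_of_nonneg_right (h.a_le_g hv) (hT0 v hv)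
    set k : V → ℝ := fun v => if v ∈ D then 0 else g v with hk
    have s2 := h.integral_grad_free_nonneg κ (M * H) (k := k) (by
      intro v hv
      rcases Finset.mem_union.1 hv with hv | hv
      · simp [hk, hv]
      · simp [hk, h.g_zero v hv])
    have s3 : ∑ v ∈ D, g v * T v = (∫ x in S, g ⬝ᵥ (κ - Q *ᵥ x) * gaussWeight Q κ x)
        - ∫ x in S, k ⬝ᵥ (κ - Q *ᵥ x) * gaussWeight Q κ x := by
      rw [← integral_sub (integrable_grad_mul_gaussWeight hP κ g).integrableOn
        (integrable_grad_mul_gaussWeight hP κ k).integrableOn]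
      simp_rw [hT, ← integral_const_mul]
      rw [← integral_finsetSum _ fun v _ => ((hTint v).const_mul _).integrableOn]
      refine integral_congr_ae (ae_of_all _ fun x => ?_)
      simp only
      rw [← sub_mul, ← sub_dotProduct, dotProduct]
      have e : ∀ v, (g - k) v = if v ∈ D then g v else 0 := fun v => by
        by_cases hv : v ∈ D <;> simp [hk, hv]
      simp_rw [e, ite_mul, zero_mul]
      rw [Finset.sum_ite_mem, Finset.univ_inter, Finset.sum_mul]
      exact Finset.sum_congr rfl fun v _ => (mul_assoc _ _ _).symm
    have s4 : ∫ x in S, g ⬝ᵥ (κ - Q *ᵥ x) * gaussWeight Q κ x ≤ Y + 5 * Θ * H * m := by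
      rw [hY, show m = ∫ x in S, gaussWeight Q κ x from rfl, ← integral_const_mul,
        ← integral_add hYint.integrableOn (hgw.const_mul _).integrableOn]
      refine setIntegral_mono_on (integrable_grad_mul_gaussWeight hP κ g).integrableOn
        (hYint.add (hgw.const_mul _)).integrableOn mS fun x hx => ?_
      rw [← add_mul]
      refine mul_le_mul_of_nonneg_right ?_ (gaussWeight_pos x).le
      obtain ⟨⟨hx1, hx2, hx3⟩, hx4⟩ := hx
      have e : g ⬝ᵥ (κ - Q *ᵥ x) = g ⬝ᵥ (lam • Q *ᵥ 1 - Q *ᵥ x) + t * (g ⬝ᵥ a) := by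
        rw [hκ, add_sub_right_comm, dotProduct_add, dotProduct_smul, smul_eq_mul]
      have e2 : g ⬝ᵥ a = ∑ v ∈ D, a v * g v := by
        rw [dotProduct, ← Finset.sum_subset (Finset.subset_univ D)]
        · exact Finset.sum_congr rfl fun v _ => mul_comm _ _
        · intro v _ hv; rw [h.a_zero v hv, mul_zero]
      rw [e, e2, h.dotProduct_sub_charge]
      have i1 := h.dotProduct_row
      have i2 := h.dotProduct_row_nonneg
      have i3 := h.sum_P_nonpos
      have i4 := h.sum_R_nonpos
      have i5 : 0 ≤ ∑ w ∈ R, (Q *ᵥ g) w * x w := Finset.sum_nonneg fun w hw =>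
        mul_nonneg_of_nonpos_of_nonpos (h.charge_nonpos (Finset.mem_union_right _ hw))
          (hx3 w hw).2.le
      have i6 : inflow Q P g x ≤ M * H := hx4
      have i7 : lam * (g ⬝ᵥ Q *ᵥ 1) ≤ lam * H :=
        mul_le_mul_of_nonneg_left (by linarith) hlam
      have i8 : t * ∑ v ∈ D, a v * g v ≤ 4 * Θ * H := by
        calc t * ∑ v ∈ D, a v * g v ≤ t * (4 * β * H) :=
              mul_le_mul_of_nonneg_left h.dotProduct_charge_le ht0
          _ = 4 * (t * β) * H := by ring
          _ = _ := by rw [htβ]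
      have i9 : (M + lam) * H ≤ Θ * H := mul_le_mul_of_nonneg_right (by linarith) hH0
      linarith
    linarith
  -- small enough for the bound `5 Θ H` on the boundary density to leave room
  set ε : ℝ := 1 / (10 * Θ) with hε
  have hε0 : 0 < ε := by positivity
  have hεΘ : ε * Θ = 1 / 10 := by rw [hε]; field_simp
  have hε1 : ε ≤ 1 / 10 := by nlinarith
  -- at each point of `D` the field exceeds `ε` in absolute value with good probability
  have hYlow : ε * (H * m - (ε * ∑ v ∈ D, a v * T v + ε ^ 2 / 2 * H * m)) ≤ Y := by
    have pt : ∀ v ∈ D, ε * (m - (ε * T v + ε ^ 2 / 2 * m))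
        ≤ ∫ x in S, -(x v * gaussWeight Q κ x) := by
      intro v hv
      have n1 := h.mass_near_zero_le κ (M * H) hv hε0
      have mA : MeasurableSet {x : V → ℝ | -ε ≤ x v} :=
        measurableSet_le measurable_const (measurable_pi_apply v)
      have n2 := mass_inter_add_diff hP (κ := κ) S mA
      have n3 : ε * mass Q κ (S \ {x | -ε ≤ x v}) ≤ ∫ x in S, -(x v * gaussWeight Q κ x) := by
        rw [mass, ← integral_const_mul]
        refine le_trans (setIntegral_mono_on (hgw.const_mul _).integrableOn
          (hcoord v).neg.integrableOn (mS.diff mA) fun x hx => ?_)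
          (setIntegral_mono_set (hcoord v).neg.integrableOn
            ((ae_restrict_iff' mS).2 (ae_of_all _ fun x hx => ?_))
            (show S \ {x | -ε ≤ x v} ⊆ S from Set.sdiff_subset).eventuallyLE)
        · have : x v < -ε := not_le.1 hx.2
          simp only [Pi.neg_apply]
          nlinarith [gaussWeight_pos (Q := Q) (κ := κ) x]
        · have : x v < 0 := hx.1.1 v hv
          simp only [Pi.zero_apply, Pi.neg_apply]
          nlinarith [gaussWeight_pos (Q := Q) (κ := κ) x]
      refine le_trans (mul_le_mul_of_nonneg_left ?_ hε0.le) n3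
      linarith
    have e : Y = ∑ v ∈ D, a v * ∫ x in S, -(x v * gaussWeight Q κ x) := by
      have hi : ∀ v : V, Integrable fun x : V → ℝ => a v * -(x v * gaussWeight Q κ x) :=
        fun v => (hcoord v).neg.const_mul _
      simp_rw [← integral_const_mul]
      rw [← integral_finsetSum _ fun v _ => (hi v).integrableOn]
      refine integral_congr_ae (ae_of_all _ fun x => ?_)
      simp only [mul_neg, Finset.sum_neg_distrib, neg_mul, Finset.sum_mul, mul_assoc]
    calc ε * (H * m - (ε * ∑ v ∈ D, a v * T v + ε ^ 2 / 2 * H * m))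
        = ∑ v ∈ D, a v * (ε * (m - (ε * T v + ε ^ 2 / 2 * m))) := by
          have : ∑ v ∈ D, a v * (ε * (m - (ε * T v + ε ^ 2 / 2 * m)))
              = ∑ v ∈ D, (a v * (ε * (m - ε ^ 2 / 2 * m)) - ε * ε * (a v * T v)) :=
            Finset.sum_congr rfl fun v _ => by ring
          rw [this, Finset.sum_sub_distrib, ← Finset.sum_mul, ← Finset.mul_sum, ← hH]
          ring
      _ ≤ _ := by
          rw [e]
          exact Finset.sum_le_sum fun v hv => mul_le_mul_of_nonneg_left (pt v hv) (h.a_nonneg v)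
  have hHm : 0 ≤ H * m := mul_nonneg hH0 hm
  have hY' : H / (40 * Θ) * m = ε * (H * m) / 4 := by rw [hε]; field_simp; ring
  rw [hY']
  have f1 : ε * ∑ v ∈ D, a v * T v ≤ ε * Y + 1 / 2 * (H * m) := by
    calc ε * ∑ v ∈ D, a v * T v ≤ ε * (Y + 5 * Θ * H * m) :=
          mul_le_mul_of_nonneg_left hTsum hε0.le
      _ = ε * Y + 5 * (ε * Θ) * (H * m) := by ring
      _ = _ := by rw [hεΘ]; ring
  have f2 : ε ^ 2 / 2 * H * m ≤ 1 / 200 * (H * m) := by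
    have : ε ^ 2 ≤ 1 / 100 := by nlinarith
    nlinarith
  have f3 : ε * (99 / 200 * (H * m) - ε * Y) ≤ Y :=
    le_trans (mul_le_mul_of_nonneg_left (by linarith) hε0.le) hYlow
  have f4 : ε ^ 2 ≤ 1 / 100 := by nlinarith
  by_contra! hcon
  have f5 : 0 ≤ ε * (H * m) := mul_nonneg hε0.le hHm
  rcases le_total 0 Y with hY0 | hY0
  · nlinarith
  · nlinarith

/-- By Jensen's inequality, the average repulsion under the tilted law turns into an exponential
bound for the untilted law. -/
lemma mass_weightedField_le (h : RepulsionData Q D P R a g lam θ β) {M Θ : ℝ}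
    (hM : 0 ≤ M) (hΘ : Θ = 1 + M + lam) :
    mass Q (lam • Q *ᵥ 1) (tameBox Q D P R g (M * ∑ v ∈ D, a v) ∩
        {x | -(1 / (80 * Θ)) * ∑ v ∈ D, a v < ∑ v ∈ D, a v * x v})
      ≤ Real.exp (-((∑ v ∈ D, a v) / (80 * β))) *
        mass Q (lam • Q *ᵥ 1) (tameBox Q D P R g (M * ∑ v ∈ D, a v)) := by
  obtain ⟨t, ht⟩ : ∃ t, t = Θ / β := ⟨_, rfl⟩
  have hY := h.integral_weightedField_ge hM hΘ ht
  set H := ∑ v ∈ D, a v with hH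
  set κ := lam • Q *ᵥ (1 : V → ℝ) with hκ
  set S := tameBox Q D P R g (M * H) with hS
  have hP := h.posDef
  have hβ := h.beta_pos
  have hlam := h.lam_nonneg
  have hΘ1 : 1 ≤ Θ := by linarith
  have ht0 : 0 ≤ t := by rw [ht]; positivity
  have hH0 : 0 ≤ H := Finset.sum_nonneg fun v _ => h.a_nonneg v
  have hdot : ∀ x : V → ℝ, (t • a) ⬝ᵥ x = t * ∑ v ∈ D, a v * x v := by
    intro x
    rw [smul_dotProduct, smul_eq_mul, dotProduct, ← Finset.sum_subset (Finset.subset_univ D)]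
    intro v _ hv; rw [h.a_zero v hv, zero_mul]
  have hrel : ∀ x, gaussWeight Q κ x
      = Real.exp (-(t * ∑ v ∈ D, a v * x v)) * gaussWeight Q (κ + t • a) x := by
    intro x
    rw [← gaussWeight_mul_exp, hdot, mul_comm, mul_assoc, ← Real.exp_add]
    simp
  have mS : MeasurableSet S := measurableSet_tameBox _
  have mY : Measurable fun x : V → ℝ => ∑ v ∈ D, a v * x v := by fun_prop
  have mA : MeasurableSet {x : V → ℝ | -(1 / (80 * Θ)) * H < ∑ v ∈ D, a v * x v} :=
    measurableSet_lt measurable_const mY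
  set m := mass Q (κ + t • a) S
  have hgw := integrable_gaussWeight hP (κ + t • a)
  have up : mass Q κ (S ∩ {x | -(1 / (80 * Θ)) * H < ∑ v ∈ D, a v * x v})
      ≤ Real.exp (t * (1 / (80 * Θ)) * H) * m := by
    refine le_trans ?_ (mul_le_mul_of_nonneg_left (mass_mono hP (κ := κ + t • a)
      (S := S ∩ {x | -(1 / (80 * Θ)) * H < ∑ v ∈ D, a v * x v}) Set.inter_subset_left)
      (Real.exp_pos _).le)
    rw [mass, mass, ← integral_const_mul]
    refine setIntegral_mono_on (integrable_gaussWeight hP κ).integrableOn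
      (hgw.const_mul _).integrableOn (mS.inter mA) fun x hx => ?_
    rw [hrel]
    refine mul_le_mul_of_nonneg_right (Real.exp_le_exp.2 ?_) (gaussWeight_pos x).le
    have : -(1 / (80 * Θ)) * H < ∑ v ∈ D, a v * x v := hx.2
    nlinarith
  set c := H / (40 * Θ) with hc
  have low : Real.exp (t * c) * m ≤ mass Q κ S := by
    have hYint : Integrable fun x : V → ℝ =>
        -(∑ v ∈ D, a v * x v) * gaussWeight Q (κ + t • a) x := by
      have : Integrable fun x : V → ℝ => ∑ v ∈ D, -a v * (x v * gaussWeight Q (κ + t • a) x) :=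
        integrable_finsetSum _ fun v _ => Integrable.const_mul (by
          simpa using integrable_dotProduct_mul_gaussWeight hP (κ + t • a) (Pi.single v 1)) _
      refine this.congr (ae_of_all _ fun x => ?_)
      simp only [neg_mul, Finset.sum_mul, Finset.sum_neg_distrib, mul_assoc]
    have j1 : Real.exp (t * c) * ((1 - t * c) * m
        + t * ∫ x in S, -(∑ v ∈ D, a v * x v) * gaussWeight Q (κ + t • a) x) ≤ mass Q κ S := by
      rw [show m = ∫ x in S, gaussWeight Q (κ + t • a) x from rfl, ← integral_const_mul,
        ← integral_const_mul, ← integral_add (hgw.const_mul _).integrableOn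
          (hYint.const_mul _).integrableOn, ← integral_const_mul]
      refine setIntegral_mono (((hgw.const_mul _).add (hYint.const_mul _)).const_mul _).integrableOn
        (integrable_gaussWeight hP κ).integrableOn fun x => ?_
      simp only
      rw [hrel, ← mul_assoc t, ← add_mul, ← mul_assoc]
      refine mul_le_mul_of_nonneg_right ?_ (gaussWeight_pos x).le
      have := Real.add_one_le_exp (t * -(∑ v ∈ D, a v * x v) - t * c)
      calc Real.exp (t * c) * (1 - t * c + t * -∑ v ∈ D, a v * x v)
          ≤ Real.exp (t * c) * Real.exp (t * -(∑ v ∈ D, a v * x v) - t * c) :=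
            mul_le_mul_of_nonneg_left (by linarith) (Real.exp_pos _).le
        _ = _ := by rw [← Real.exp_add]; ring_nf
    refine le_trans (mul_le_mul_of_nonneg_left ?_ (Real.exp_pos _).le) j1
    have := mul_le_mul_of_nonneg_left hY ht0
    linarith
  have e1 : t * (1 / (80 * Θ)) * H = -(H / (80 * β)) + t * c := by
    rw [ht, hc]; field_simp; ring
  rw [e1, Real.exp_add, mul_assoc] at up
  exact up.trans (mul_le_mul_of_nonneg_left low (Real.exp_pos _).le)

end RepulsionData

/-- The constant `Δ` of entropic repulsion, in terms of the bound `lam` on the boundary values and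
the charge `θ` of the barriers. -/
noncomputable def repulsionConst (lam θ : ℝ) : ℝ :=
  1 / (80 * (1 + (4 + 4 * hazardConst θ) + lam))

lemma repulsionConst_pos {lam θ : ℝ} (hlam : 0 ≤ lam) : 0 < repulsionConst lam θ := by
  have := hazardConst_pos θ
  unfold repulsionConst
  positivity

/-- Entropic repulsion for Gaussian weights. The constraints on `R` and the mean are first raised, by
stochastic monotonicity, and a large inflow is discarded. -/
theorem RepulsionData.mass_le {Q : Matrix V V ℝ} {D P R : Finset V} {a g : V → ℝ} {lam θ β : ℝ}
    (h : RepulsionData Q D P R a g lam θ β) {κ : V → ℝ} (hκ : κ ≤ lam • Q *ᵥ 1) :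
    mass Q κ ({x | (∀ v ∈ D, x v < 0) ∧ (∀ w ∈ P, 0 ≤ x w) ∧ ∀ w ∈ R, x w < 0} ∩
        {x | -repulsionConst lam θ * ∑ v ∈ D, a v < ∑ v ∈ D, a v * x v})
      ≤ 2 * Real.exp (-((∑ v ∈ D, a v) / (80 * β))) *
        mass Q κ {x | (∀ v ∈ D, x v < 0) ∧ (∀ w ∈ P, 0 ≤ x w) ∧ ∀ w ∈ R, x w < 0} := by
  set H := ∑ v ∈ D, a v with hH
  have hH0 : 0 ≤ H := Finset.sum_nonneg fun v _ => h.a_nonneg v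
  have hβ := h.beta_pos
  have hC := hazardConst_pos θ
  set A : Set (V → ℝ) := {x | -repulsionConst lam θ * H < ∑ v ∈ D, a v * x v} with hA
  set S₁ : Set (V → ℝ) := {x | (∀ v ∈ D, x v < 0) ∧ (∀ w ∈ P, 0 ≤ x w) ∧ ∀ w ∈ R, x w < 0}
    with hS₁
  set κ₂ := lam • Q *ᵥ (1 : V → ℝ)
  set E := signBox D P R (0 : V → ℝ) with hE
  have mY : Measurable fun x : V → ℝ => ∑ v ∈ D, a v * x v := by fun_prop
  have mA : MeasurableSet A := measurableSet_lt measurable_const mY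
  have mS₁ : MeasurableSet S₁ := (measurableSet_lt_on D 0).inter
    ((measurableSet_nonneg_on P).inter (measurableSet_lt_on R 0))
  have hfkg := mass_inter_mul_le h.posDef h.offDiag hκ mS₁ (measurableSet_signBox D P R 0) mA
    (fun x y hxy hx => lt_of_lt_of_le (show _ < _ from hx)
      (Finset.sum_le_sum fun v _ => mul_le_mul_of_nonneg_left (hxy v) (h.a_nonneg v)))
    (by
      rintro x ⟨hx1, hx2, hx3⟩ y ⟨hy1, hy2, hy3⟩
      refine ⟨⟨fun v hv => max_lt (hx1 v hv) (hy1 v hv), fun w hw =>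
        le_sup_of_le_left (hx2 w hw), fun w hw => ⟨le_sup_of_le_right (hy3 w hw).1,
        max_lt (hx3 w hw) (hy3 w hw).2⟩⟩, fun v hv => inf_lt_of_left_lt (hx1 v hv),
        fun w hw => le_inf (hx2 w hw) (hy2 w hw), fun w hw => inf_lt_of_left_lt (hx3 w hw)⟩)
  have hEpos : 0 < mass Q κ₂ E := by
    refine mass_pos_of_isOpen h.posDef
      (O := {x | ∀ v, x v ∈ if v ∈ P then Set.Ioi (0 : ℝ) else Set.Ioo (-1) 0}) ?_
      ⟨fun v => if v ∈ P then 1 else -1 / 2, fun v => ?_⟩ fun x hx => ?_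
    · have : {x : V → ℝ | ∀ v, x v ∈ if v ∈ P then Set.Ioi (0 : ℝ) else Set.Ioo (-1) 0}
          = ⋂ v, {x | x v ∈ if v ∈ P then Set.Ioi (0 : ℝ) else Set.Ioo (-1) 0} := by ext; simp
      rw [this]
      refine isOpen_iInter_of_finite fun v => IsOpen.preimage (continuous_apply v) ?_
      split_ifs
      · exact isOpen_Ioi
      · exact isOpen_Ioo
    · by_cases hv : v ∈ P <;> simp [hv]
      norm_num
    · have out : ∀ v, v ∉ P → x v ∈ Set.Ioo (-1 : ℝ) 0 := fun v hv => by simpa [hv] using hx v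
      refine ⟨fun v hv => (out v (Finset.disjoint_left.1 h.disj_DP hv)).2, fun w hw => ?_,
        fun w hw => ?_⟩
      · have : 0 < x w := by simpa [hw] using hx w
        exact this.le
      · have := out w (Finset.disjoint_right.1 h.disj_PR hw)
        exact ⟨this.1.le, this.2⟩
  set M := 4 + 4 * hazardConst θ with hM
  have hM0 : 0 ≤ M := by positivity
  have k1 := h.mass_inflow_le
  have k2 := h.mass_weightedField_le hM0 rfl
  have k3 : mass Q κ₂ (E ∩ A) ≤ 2 * Real.exp (-(H / (80 * β))) * mass Q κ₂ E := by
    have hcov : E ∩ A ⊆ (E ∩ {x | M * H < inflow Q P g x}) ∪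
        (RepulsionData.tameBox Q D P R g (M * H) ∩
          {x | -(1 / (80 * (1 + M + lam))) * H < ∑ v ∈ D, a v * x v}) := by
      rintro x ⟨hx1, hx2⟩
      rcases lt_or_ge (M * H) (RepulsionData.inflow Q P g x) with hx | hx
      · exact Or.inl ⟨hx1, hx⟩
      · exact Or.inr ⟨⟨hx1, hx⟩, hx2⟩
    have l1 := (mass_mono h.posDef (κ := κ₂) hcov).trans (mass_union_le h.posDef
      ((RepulsionData.measurableSet_tameBox _).inter (measurableSet_lt measurable_const mY)))
    have l2 : mass Q κ₂ (RepulsionData.tameBox Q D P R g (M * H)) ≤ mass Q κ₂ E :=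
      mass_mono h.posDef Set.inter_subset_left
    have l3 : Real.exp (-(H / β)) ≤ Real.exp (-(H / (80 * β))) := by
      apply Real.exp_le_exp.2
      rw [neg_le_neg_iff]
      gcongr
      linarith
    have l4 := mul_le_mul_of_nonneg_left l2 (Real.exp_pos (-(H / (80 * β)))).le
    have l5 := mul_le_mul_of_nonneg_right l3 hEpos.le
    linarith
  have k4 := hfkg.trans (mul_le_mul_of_nonneg_right k3 (mass_nonneg S₁))
  refine le_of_mul_le_mul_right (a := mass Q κ₂ E) ?_ hEpos
  linarith

end Repulsion

/-! ### The Dirichlet problem for a transient matrix -/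

section Dirichlet
open Matrix

variable {V : Type*} [Fintype V]

/-- A symmetric matrix with nonpositive off-diagonal entries and a strictly superharmonic positive
function `F`. Such a matrix is the generator of a transient reversible walk. -/
structure IsTransient (Q : Matrix V V ℝ) (F : V → ℝ) : Prop where
  isSymm : Q.IsSymm
  offDiag : ∀ i j, i ≠ j → Q i j ≤ 0
  pos : ∀ i, 0 < F i
  mulVec_pos : ∀ i, 0 < (Q *ᵥ F) i

namespace IsTransient

variable {Q : Matrix V V ℝ} {F : V → ℝ}

/-- The quadratic form is bounded below by `∑ i, (Q F) i / F i * x i ^ 2`. -/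
lemma posDef (h : IsTransient Q F) : Q.PosDef := by
  refine PosDef.of_dotProduct_mulVec_pos (by simpa [IsHermitian] using h.isSymm.eq) fun x hx => ?_
  rw [star_trivial]
  have key : ∑ i, x i ^ 2 / F i * (Q *ᵥ F) i ≤ x ⬝ᵥ Q *ᵥ x := by
    have h1 : ∀ i j, Q i j * ((x i ^ 2 / F i * F j + x j ^ 2 / F j * F i) / 2)
        ≤ x i * (Q i j * x j) := by
      intro i j
      have hi := h.pos i
      have hj := h.pos j
      rcases eq_or_ne i j with rfl | hij
      · apply le_of_eq; field_simp; ring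
      · have hq := h.offDiag i j hij
        have : x i * x j ≤ (x i ^ 2 / F i * F j + x j ^ 2 / F j * F i) / 2 := by
          rw [← sub_nonneg]
          have : (x i ^ 2 / F i * F j + x j ^ 2 / F j * F i) / 2 - x i * x j
              = (x i * F j - x j * F i) ^ 2 / (2 * (F i * F j)) := by field_simp; ring
          rw [this]; positivity
        nlinarith
    have h2 : ∑ i, ∑ j, Q i j * (x i ^ 2 / F i * F j) = ∑ i, x i ^ 2 / F i * (Q *ᵥ F) i := by
      simp only [mulVec, dotProduct, Finset.mul_sum]
      exact Finset.sum_congr rfl fun i _ => Finset.sum_congr rfl fun j _ => by ring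
    have h3 : ∑ i, ∑ j, Q i j * (x j ^ 2 / F j * F i) = ∑ i, x i ^ 2 / F i * (Q *ᵥ F) i := by
      rw [← h2, Finset.sum_comm]
      exact Finset.sum_congr rfl fun i _ => Finset.sum_congr rfl fun j _ => by
        rw [show Q j i = Q i j from congrFun (congrFun h.isSymm i) j]
    have h4 : ∑ i, ∑ j, Q i j * ((x i ^ 2 / F i * F j + x j ^ 2 / F j * F i) / 2)
        = ∑ i, x i ^ 2 / F i * (Q *ᵥ F) i := by
      rw [show ∑ i, ∑ j, Q i j * ((x i ^ 2 / F i * F j + x j ^ 2 / F j * F i) / 2)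
        = (∑ i, ∑ j, Q i j * (x i ^ 2 / F i * F j)
          + ∑ i, ∑ j, Q i j * (x j ^ 2 / F j * F i)) / 2 by
        simp only [← Finset.sum_add_distrib, Finset.sum_div]
        exact Finset.sum_congr rfl fun i _ => Finset.sum_congr rfl fun j _ => by ring, h2, h3]
      ring
    rw [← h4]
    simp only [mulVec, dotProduct, Finset.mul_sum]
    exact Finset.sum_le_sum fun i _ => Finset.sum_le_sum fun j _ => h1 i j
  refine lt_of_lt_of_le ?_ key
  obtain ⟨i, hi⟩ := Function.ne_iff.1 hx
  refine Finset.sum_pos' (fun j _ => mul_nonneg (div_nonneg (sq_nonneg _) (h.pos j).le)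
    (h.mulVec_pos j).le) ⟨i, Finset.mem_univ i, ?_⟩
  exact mul_pos (div_pos (by have : x i ≠ 0 := hi; positivity) (h.pos i)) (h.mulVec_pos i)

/-- The minimum principle: a function that is nonnegative on `W` and superharmonic off `W` is
nonnegative. -/
lemma nonneg_of_superharmonic (h : IsTransient Q F) (W : Set V) {x : V → ℝ}
    (hW : ∀ i ∈ W, 0 ≤ x i) (hx : ∀ i ∉ W, 0 ≤ (Q *ᵥ x) i) (i : V) : 0 ≤ x i := by
  by_contra! hi
  -- at a point where `x / F` is minimal, `x` is not superharmonic
  obtain ⟨k, -, hk⟩ :=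
    Finset.exists_min_image Finset.univ (fun j => x j / F j) ⟨i, Finset.mem_univ i⟩
  have hkneg : x k / F k < 0 :=
    (hk i (Finset.mem_univ i)).trans_lt (div_neg_of_neg_of_pos hi (h.pos i))
  have hxk : x k < 0 := by
    by_contra! hc
    exact absurd (div_nonneg hc (h.pos k).le) (not_le.2 hkneg)
  have hkW : k ∉ W := fun hkW => absurd (hW k hkW) (not_le.2 hxk)
  have h1 : (Q *ᵥ x) k ≤ x k / F k * (Q *ᵥ F) k := by
    simp only [mulVec, dotProduct, Finset.mul_sum]
    refine Finset.sum_le_sum fun j _ => ?_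
    have hj := h.pos j
    have hk' := h.pos k
    rcases eq_or_ne k j with rfl | hkj
    · apply le_of_eq; field_simp
    · have h2 : x k / F k * F j ≤ x j := by
        rw [← le_div_iff₀ hj]; exact hk j (Finset.mem_univ j)
      nlinarith [h.offDiag k j hkj]
  have := mul_neg_of_neg_of_pos hkneg (h.mulVec_pos k)
  linarith [hx k hkW]

lemma eq_zero_of_harmonic (h : IsTransient Q F) (W : Set V) {x : V → ℝ}
    (hW : ∀ i ∈ W, x i = 0) (hx : ∀ i ∉ W, (Q *ᵥ x) i = 0) : x = 0 := by
  ext i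
  refine le_antisymm ?_ (h.nonneg_of_superharmonic W (fun i hi => (hW i hi).ge)
    (fun i hi => (hx i hi).ge) i)
  have := h.nonneg_of_superharmonic W (x := -x) (fun i hi => by simp [hW i hi])
    (fun i hi => by rw [mulVec_neg, Pi.neg_apply, hx i hi, neg_zero]) i
  simpa using this

/-- Solution of the Dirichlet problem with zero boundary values on `W`. -/
lemma exists_dirichlet (h : IsTransient Q F) (W : Set V) (k : V → ℝ) :
    ∃ x : V → ℝ, (∀ i ∈ W, x i = 0) ∧ ∀ i ∉ W, (Q *ᵥ x) i = k i := by
  classical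
  let T : (V → ℝ) →ₗ[ℝ] (V → ℝ) :=
    { toFun := fun x i => if i ∈ W then x i else (Q *ᵥ x) i
      map_add' := fun x y => by
        ext i; by_cases hi : i ∈ W <;> simp [hi, mulVec_add]
      map_smul' := fun c x => by
        ext i; by_cases hi : i ∈ W <;> simp [hi, mulVec_smul] }
  have hT : ∀ x i, T x i = if i ∈ W then x i else (Q *ᵥ x) i := fun _ _ => rfl
  have hinj : Function.Injective T := by
    rw [injective_iff_map_eq_zero]
    intro x hx
    refine h.eq_zero_of_harmonic W (fun i hi => ?_) fun i hi => ?_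
    · have := congrFun hx i; rwa [hT, if_pos hi] at this
    · have := congrFun hx i; rwa [hT, if_neg hi] at this
  obtain ⟨x, hx⟩ := LinearMap.injective_iff_surjective.1 hinj fun i => if i ∈ W then 0 else k i
  refine ⟨x, fun i hi => ?_, fun i hi => ?_⟩
  · have := congrFun hx i; rwa [hT, if_pos hi, if_pos hi] at this
  · have := congrFun hx i; rwa [hT, if_neg hi, if_neg hi] at this

/-- Green's function killed at `v`, and a bound for it by a supersolution `T`. -/
lemma exists_pinned_green [DecidableEq V] (h : IsTransient Q F) (hrow : ∀ i, 0 ≤ (Q *ᵥ 1) i)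
    {v w : V} (hvw : w ≠ v) {T : V → ℝ} (hTv : 0 ≤ T v)
    (hT : ∀ i, i ≠ v → (Pi.single w 1 : V → ℝ) i ≤ (Q *ᵥ T) i) :
    ∃ u : V → ℝ, u v = 0 ∧ (∃ q ≤ 1, Q *ᵥ u = Pi.single w 1 - Pi.single v q) ∧ u w ≤ T w := by
  obtain ⟨u, hu0, hu⟩ := h.exists_dirichlet {v} (Pi.single w 1)
  have huv : u v = 0 := hu0 v rfl
  have hQu : Q *ᵥ u = Pi.single w 1 - Pi.single v (-(Q *ᵥ u) v) := by
    ext i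
    rcases eq_or_ne i v with rfl | hi
    · simp [hvw.symm]
    · rw [hu i (by simpa using hi)]; simp [hi]
  have hunn : ∀ i, 0 ≤ u i := h.nonneg_of_superharmonic {v} (fun i hi => (hu0 i hi).ge)
    fun i hi => by rw [hu i hi]; by_cases hiw : i = w <;> simp [hiw]
  refine ⟨u, huv, ⟨_, ?_, hQu⟩, ?_⟩
  · have h1 : (1 : V → ℝ) ⬝ᵥ Q *ᵥ u = u ⬝ᵥ Q *ᵥ 1 := dotProduct_mulVec_comm h.isSymm _ _
    have h2 : 0 ≤ u ⬝ᵥ Q *ᵥ 1 := Finset.sum_nonneg fun i _ => mul_nonneg (hunn i) (hrow i)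
    rw [← h1, hQu, dotProduct_sub, dotProduct_single, dotProduct_single] at h2
    simp only [Pi.one_apply, one_mul] at h2
    linarith
  · have := h.nonneg_of_superharmonic {v} (x := T - u)
      (fun i hi => by rw [Set.mem_singleton_iff.1 hi, Pi.sub_apply, huv]; simpa using hTv)
      (fun i hi => by
        rw [mulVec_sub, Pi.sub_apply, hu i hi]; exact sub_nonneg.2 (hT i (by simpa using hi))) w
    simpa using this

end IsTransient

end Dirichlet

/-! ### The network around a lattice point -/

/-- The four unit vectors of the lattice. -/
noncomputable def dir : Fin 4 → ℂ := ![1, Complex.I, -1, -Complex.I]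

lemma add_dir_mem_lattice {u : ℂ} (hu : u ∈ lattice) (d : Fin 4) : u + dir d ∈ lattice := by
  obtain ⟨⟨m, hm⟩, n, hn⟩ := hu
  fin_cases d
  · exact ⟨⟨m + 1, by simp [dir, hm]⟩, n, by simp [dir, hn]⟩
  · exact ⟨⟨m, by simp [dir, hm]⟩, n + 1, by simp [dir, hn]⟩
  · exact ⟨⟨m - 1, by simp [dir, hm]; ring⟩, n, by simp [dir, hn]⟩
  · exact ⟨⟨m, by simp [dir, hm]⟩, n - 1, by simp [dir, hn]; ring⟩

lemma norm_dir (d : Fin 4) : ‖dir d‖ = 1 := by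
  fin_cases d <;> simp [dir]

lemma add_mul_dir_mem_grid {u : ℂ} (hu : u ∈ lattice) (t : ℝ) (d : Fin 4) :
    u + t * dir d ∈ grid := by
  obtain ⟨⟨m, hm⟩, n, hn⟩ := hu
  fin_cases d
  · exact Or.inr ⟨n, by simp [dir, hn]⟩
  · exact Or.inl ⟨m, by simp [dir, hm]⟩
  · exact Or.inr ⟨n, by simp [dir, hn]⟩
  · exact Or.inl ⟨m, by simp [dir, hm]⟩

/-- A point at distance less than one in one of the four directions is no other lattice point. -/
lemma add_mul_dir_mem_lattice {u : ℂ} (hu : u ∈ lattice) {t : ℝ} (h0 : 0 < t) (h1 : t ≤ 1)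
    {d : Fin 4} (h : u + t * dir d ∈ lattice) : t = 1 := by
  obtain ⟨⟨m, hm⟩, n, hn⟩ := hu
  obtain ⟨⟨m', hm'⟩, n', hn'⟩ := h
  have key : ∀ k : ℤ, t = k → t = 1 := by
    intro k hk
    rw [hk] at h0 h1 ⊢
    have : k = 1 := by
      have a : (0 : ℤ) < k := by exact_mod_cast h0
      have b : k ≤ (1 : ℤ) := by exact_mod_cast h1
      omega
    simp [this]
  fin_cases d
  · exact key (m' - m) (by simp [dir, hm] at hm'; push_cast; linarith)
  · exact key (n' - n) (by simp [dir, hn] at hn'; push_cast; linarith)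
  · exact key (m - m') (by simp [dir, hm] at hm'; push_cast; linarith)
  · exact key (n - n') (by simp [dir, hn] at hn'; push_cast; linarith)

lemma add_mul_dir_injective {u : ℂ} {l : Fin 4 → ℝ} (hl : ∀ d, 0 < l d) :
    Function.Injective fun d => u + l d * dir d := by
  intro d e h
  have h' : (l d : ℂ) * dir d = l e * dir e := add_left_cancel h
  have hre := congrArg Complex.re h'
  have him := congrArg Complex.im h'
  have hd := hl d
  have he := hl e
  fin_cases d <;> fin_cases e <;> simp [dir] at hre him hd he ⊢ <;> linarith

/-- A segment of the metric graph issued from a lattice point goes in one of the four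
directions. -/
lemma exists_eq_add_mul_dir {u v : ℂ} (hu : u ∈ lattice) (huv : u ≠ v)
    (hseg : segment ℝ u v ⊆ grid) : ∃ d, ∃ t : ℝ, 0 < t ∧ v = u + t * dir d := by
  obtain ⟨⟨m, hm⟩, n, hn⟩ := hu
  set a := (v - u).re with ha
  set b := (v - u).im with hb
  have hvu : v = u + (a + b * Complex.I) := by
    rw [ha, hb, Complex.re_add_im]; ring
  by_cases hb0 : b = 0
  · have ha0 : a ≠ 0 := by
      rintro h; apply huv; rw [hvu, h, hb0]; simp
    rcases lt_or_gt_of_ne ha0 with h | h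
    · exact ⟨2, -a, by linarith, by rw [hvu, hb0]; simp [dir]⟩
    · exact ⟨0, a, h, by rw [hvu, hb0]; simp [dir]⟩
  by_cases ha0 : a = 0
  · rcases lt_or_gt_of_ne hb0 with h | h
    · exact ⟨3, -b, by linarith, by rw [hvu, ha0]; simp [dir]⟩
    · exact ⟨1, b, h, by rw [hvu, ha0]; simp [dir]⟩
  exfalso
  -- a point of an oblique segment close to its end `u` has no integer coordinate
  set t : ℝ := 1 / (2 * (1 + |a| + |b|)) with ht
  have hab : 0 < |a| := abs_pos.2 ha0
  have hbb : 0 < |b| := abs_pos.2 hb0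
  have ht0 : 0 < t := by positivity
  have hts : t * (1 + |a| + |b|) = 1 / 2 := by rw [ht]; field_simp
  have ht1 : t ≤ 1 := by nlinarith
  have key : ∀ (c : ℝ) (i j : ℤ), c ≠ 0 → |c| ≤ |a| + |b| → (i : ℝ) + t * c ≠ j := by
    intro c i j hc hcab h
    have h1 : |t * c| < 1 := by
      rw [abs_mul, abs_of_pos ht0]; nlinarith
    have h2 : t * c = ((j - i : ℤ) : ℝ) := by push_cast; linarith
    rw [h2, ← Int.cast_abs] at h1
    have h3 : |j - i| < 1 := by exact_mod_cast h1
    rw [Int.abs_lt_one_iff.1 h3, Int.cast_zero] at h2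
    exact (mul_ne_zero ht0.ne' hc) h2
  have hp : u + t * (a + b * Complex.I) ∈ grid := by
    refine hseg ⟨1 - t, t, by linarith, ht0.le, by ring, ?_⟩
    rw [hvu]
    simp only [Complex.real_smul, Complex.ofReal_sub, Complex.ofReal_one]
    ring
  rcases hp with ⟨j, hj⟩ | ⟨j, hj⟩
  · exact key a m j ha0 (by linarith) (by simpa [hm] using hj)
  · exact key b n j hb0 (by linarith) (by simpa [hn] using hj)

/-- The lattice points of `K` off the boundary: the points where the field fluctuates and the walk
is not yet killed. -/
def verts (K : Set ℂ) : Set ℂ := (lattice ∩ K) \ bdry K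

lemma isClosed_bdry {K : Set ℂ} (hK : IsCompact K) : IsClosed (bdry K) :=
  hK.isClosed.inter isClosed_closure

lemma finite_verts {K : Set ℂ} (hK : IsCompact K) : (verts K).Finite := by
  obtain ⟨C, hC⟩ := hK.isBounded.exists_norm_le
  obtain ⟨N, hN⟩ := exists_nat_ge C
  refine ((Set.finite_Icc ((-N, -N) : ℤ × ℤ) (N, N)).image
    fun p => (⟨p.1, p.2⟩ : ℂ)).subset ?_
  rintro z ⟨⟨⟨⟨m, hm⟩, n, hn⟩, hz⟩, -⟩
  have h1 : |(m : ℝ)| ≤ N := by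
    rw [← hm]; exact (Complex.abs_re_le_norm z).trans ((hC z hz).trans hN)
  have h2 : |(n : ℝ)| ≤ N := by
    rw [← hn]; exact (Complex.abs_im_le_norm z).trans ((hC z hz).trans hN)
  rw [abs_le] at h1 h2
  refine ⟨(m, n), ⟨⟨?_, ?_⟩, ?_, ?_⟩, Complex.ext hm.symm hn.symm⟩
  · exact_mod_cast h1.1
  · exact_mod_cast h2.1
  · exact_mod_cast h1.2
  · exact_mod_cast h2.2

/-- The network with vertex set `lattice ∪ bdry K` around `u`: its neighbours are the four points at
distance `l d` in the direction `dir d`. -/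
structure IsStar (K : Set ℂ) (u : ℂ) (l : Fin 4 → ℝ) : Prop where
  pos : ∀ d, 0 < l d
  le_one : ∀ d, l d ≤ 1
  mem : ∀ d, u + l d * dir d ∈ verts K ∪ bdry K
  joined_iff : ∀ v, Joined (lattice ∪ bdry K) u v ↔ ∃ d, v = u + l d * dir d

/-- A line issued from an interior point of `K` stays in `K` until it meets the boundary. -/
lemma add_mul_dir_mem {K : Set ℂ} (hK : IsCompact K) {u : ℂ} (hu : u ∈ verts K)
    {d : Fin 4} {l : ℝ} (hl : 0 < l)
    (hb : ∀ s : ℝ, 0 < s → s < l → u + s * dir d ∉ bdry K) : u + l * dir d ∈ K := by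
  obtain ⟨⟨hul, huK⟩, hub⟩ := hu
  have hcont : Continuous fun s : ℝ => u + s * dir d := by fun_prop
  set A : Set ℂ := (fun s : ℝ => u + s * dir d) '' Set.Ico 0 l with hA
  have hpre : IsPreconnected A := isPreconnected_Ico.image _ hcont.continuousOn
  have hAg : A ⊆ grid := by
    rintro _ ⟨s, -, rfl⟩; exact add_mul_dir_mem_grid hul s d
  have hAb : ∀ z ∈ A, z ∉ bdry K := by
    rintro _ ⟨s, ⟨h0, h1⟩, rfl⟩
    rcases h0.eq_or_lt with rfl | h0
    · simpa using hub
    · exact hb s h0 h1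
  have huA : u ∈ A := ⟨0, ⟨le_rfl, hl⟩, by simp⟩
  have hAK : A ⊆ K := by
    intro z hz
    by_contra hzK
    have h1 := hpre (closure (grid \ K))ᶜ Kᶜ isClosed_closure.isOpen_compl
      hK.isClosed.isOpen_compl (fun x hx => by
        by_cases hxK : x ∈ K
        · exact Or.inl fun hc => hAb x hx ⟨hxK, hc⟩
        · exact Or.inr hxK)
      ⟨u, huA, fun hc => hub ⟨huK, hc⟩⟩ ⟨z, hz, hzK⟩
    obtain ⟨x, hxA, hx1, hx2⟩ := h1
    exact hx1 (subset_closure ⟨hAg hxA, hx2⟩)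
  have : l ∈ closure (Set.Ico 0 l) := by
    rw [closure_Ico hl.ne]; exact ⟨hl.le, le_rfl⟩
  have h2 : u + l * dir d ∈ closure A := image_closure_subset_closure_image hcont ⟨l, this, rfl⟩
  exact hK.isClosed.closure_subset_iff.2 hAK h2

lemma add_mul_dir_mem_openSegment {u : ℂ} {d : Fin 4} {s l : ℝ} (h0 : 0 < s) (h1 : s < l) :
    u + s * dir d ∈ openSegment ℝ u (u + l * dir d) := by
  have hl : 0 < l := h0.trans h1
  refine ⟨1 - s / l, s / l, ?_, by positivity, by ring, ?_⟩
  · rw [sub_pos, div_lt_one hl]; exact h1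
  · simp only [Complex.real_smul, Complex.ofReal_sub, Complex.ofReal_one, Complex.ofReal_div]
    have : (l : ℂ) ≠ 0 := by exact_mod_cast hl.ne'
    field_simp
    ring

lemma exists_of_mem_segment {u : ℂ} {d : Fin 4} {l : ℝ} {z : ℂ}
    (hz : z ∈ segment ℝ u (u + l * dir d)) : ∃ s : ℝ, z = u + s * dir d := by
  obtain ⟨a, b, -, -, hab, rfl⟩ := hz
  refine ⟨b * l, ?_⟩
  have : (a : ℂ) = 1 - b := by rw [eq_sub_iff_add_eq]; exact_mod_cast hab
  simp only [Complex.real_smul, Complex.ofReal_mul, this]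
  ring

lemma exists_of_mem_openSegment {u : ℂ} {d : Fin 4} {l : ℝ} (hl : 0 < l) {z : ℂ}
    (hz : z ∈ openSegment ℝ u (u + l * dir d)) :
    ∃ s : ℝ, 0 < s ∧ s < l ∧ z = u + s * dir d := by
  obtain ⟨a, b, ha, hb, hab, rfl⟩ := hz
  refine ⟨b * l, by positivity, by nlinarith, ?_⟩
  have : (a : ℂ) = 1 - b := by rw [eq_sub_iff_add_eq]; exact_mod_cast hab
  simp only [Complex.real_smul, Complex.ofReal_mul, this]
  ring

/-- The star of `u` is found by following the four directions up to the first lattice or boundary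
point. -/
lemma exists_isStar {K : Set ℂ} (hK : IsCompact K) {u : ℂ} (hu : u ∈ verts K) :
    ∃ l, IsStar K u l := by
  have hcl := isClosed_bdry hK
  have hul : u ∈ lattice := hu.1.1
  obtain ⟨δ, hδ, hball⟩ := Metric.isOpen_iff.1 hcl.isOpen_compl u hu.2
  have hdist : ∀ (s : ℝ) (d : Fin 4), 0 < s → s < δ → u + s * dir d ∉ bdry K := by
    intro s d h0 h1
    refine hball ?_
    rw [Metric.mem_ball, dist_eq_norm]
    simpa [norm_dir, abs_of_pos h0] using h1
  -- the first point of the network in direction `d`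
  have hex : ∀ d, ∃ l : ℝ, 0 < l ∧ l ≤ 1 ∧ (u + l * dir d ∈ lattice ∪ bdry K) ∧
      ∀ s, 0 < s → s < l → u + s * dir d ∉ lattice ∪ bdry K := by
    intro d
    set A : Set ℝ := insert 1 (Set.Icc (min δ 1) 1 ∩ (fun s : ℝ => u + s * dir d) ⁻¹' bdry K)
      with hA
    have hAc : IsCompact A := (isCompact_Icc.inter_right
      (hcl.preimage (by fun_prop))).insert 1
    obtain ⟨l, hlA, hl⟩ := hAc.exists_isLeast ⟨1, Set.mem_insert _ _⟩
    have hl1 : l ≤ 1 := hl (Set.mem_insert _ _)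
    have hl0 : 0 < l := by
      rcases hlA with rfl | ⟨⟨h, -⟩, -⟩
      · exact one_pos
      · exact (lt_min hδ one_pos).trans_le h
    refine ⟨l, hl0, hl1, ?_, fun s h0 h1 hs => ?_⟩
    · rcases hlA with rfl | ⟨-, h⟩
      · exact Or.inl (by simpa using add_dir_mem_lattice hul d)
      · exact Or.inr h
    · rcases hs with hs | hs
      · have := add_mul_dir_mem_lattice hul h0 (h1.le.trans hl1) hs
        linarith
      · have hsδ : δ ≤ s := by
          by_contra! hc; exact hdist s d h0 hc hs
        have : l ≤ s := hl (Or.inr ⟨⟨(min_le_left _ _).trans hsδ, h1.le.trans hl1⟩, hs⟩)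
        linarith
  choose l hl0 hl1 hlN hlmin using hex
  refine ⟨l, hl0, hl1, fun d => ?_, fun v => ⟨?_, ?_⟩⟩
  · have hmK : u + l d * dir d ∈ K := add_mul_dir_mem hK hu (hl0 d)
      fun s h0 h1 h => hlmin d s h0 h1 (Or.inr h)
    by_cases hb : u + l d * dir d ∈ bdry K
    · exact Or.inr hb
    · exact Or.inl ⟨⟨(hlN d).resolve_right hb, hmK⟩, hb⟩
  · rintro ⟨-, hvN, huv, hseg, hopen⟩
    obtain ⟨d, t, ht, rfl⟩ := exists_eq_add_mul_dir hul huv hseg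
    refine ⟨d, ?_⟩
    rcases lt_trichotomy t (l d) with h | h | h
    · exact absurd hvN (hlmin d t ht h)
    · rw [h]
    · exact absurd (show u + l d * dir d ∈ openSegment ℝ u (u + t * dir d) ∩ (lattice ∪ bdry K) from
        ⟨add_mul_dir_mem_openSegment (hl0 d) h, hlN d⟩) (by rw [hopen]; simp)
  · rintro ⟨d, rfl⟩
    refine ⟨Or.inl hul, hlN d, ?_, ?_, ?_⟩
    · intro h
      have : (l d : ℂ) * dir d = 0 := by
        have := h.symm; rwa [add_eq_left] at this
      have hn := congrArg norm this
      rw [norm_mul, norm_dir, mul_one, norm_zero, Complex.norm_real, norm_eq_zero] at hn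
      exact (hl0 d).ne' hn
    · intro z hz
      obtain ⟨s, rfl⟩ := exists_of_mem_segment hz
      exact add_mul_dir_mem_grid hul s d
    · rw [Set.eq_empty_iff_forall_notMem]
      rintro z ⟨hz, hzN⟩
      obtain ⟨s, h0, h1, rfl⟩ := exists_of_mem_openSegment (hl0 d) hz
      exact hlmin d s h0 h1 hzN

lemma conductance_comm (N : Set ℂ) (u v : ℂ) : conductance N u v = conductance N v u := by
  have : Joined N u v ↔ Joined N v u := by
    unfold Joined
    rw [segment_symm, openSegment_symm]
    tauto
  unfold conductance
  by_cases h : Joined N u v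
  · rw [if_pos h, if_pos (this.1 h), norm_sub_rev]
  · rw [if_neg h, if_neg fun h' => h (this.2 h')]

lemma conductance_nonneg (N : Set ℂ) (u v : ℂ) : 0 ≤ conductance N u v := by
  unfold conductance
  split_ifs <;> positivity

lemma conductance_self (N : Set ℂ) (u : ℂ) : conductance N u u = 0 := by
  unfold conductance
  exact if_neg fun h => h.2.2.1 rfl

namespace IsStar

variable {K : Set ℂ} {u : ℂ} {l : Fin 4 → ℝ}

lemma conductance_eq (h : IsStar K u l) (d : Fin 4) :
    conductance (lattice ∪ bdry K) u (u + l d * dir d) = (4 * l d)⁻¹ := by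
  rw [conductance, if_pos ((h.joined_iff _).2 ⟨d, rfl⟩)]
  simp [norm_dir, abs_of_pos (h.pos d)]

lemma conductance_eq_zero (h : IsStar K u l) {v : ℂ} (hv : ∀ d, v ≠ u + l d * dir d) :
    conductance (lattice ∪ bdry K) u v = 0 := by
  rw [conductance, if_neg]
  rw [h.joined_iff]
  rintro ⟨d, rfl⟩
  exact hv d rfl

/-- Sums over the neighbours of `u` in the network are sums over the four directions. -/
lemma finsum_conductance_mul (h : IsStar K u l) (F : ℂ → ℝ) :
    ∑ᶠ v, conductance (lattice ∪ bdry K) u v * F v = ∑ d, F (u + l d * dir d) / (4 * l d) := by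
  classical
  rw [finsum_eq_sum_of_support_subset (s := Finset.univ.image fun d => u + l d * dir d)]
  · rw [Finset.sum_image fun d _ e _ hde => add_mul_dir_injective h.pos hde]
    refine Finset.sum_congr rfl fun d _ => ?_
    rw [h.conductance_eq]
    ring
  · intro v hv
    by_contra hc
    refine hv ?_
    simp only
    rw [h.conductance_eq_zero, zero_mul]
    rintro d rfl
    exact hc (by simp)

lemma totalConductance_eq (h : IsStar K u l) :
    totalConductance (lattice ∪ bdry K) u = ∑ d, (4 * l d)⁻¹ := by
  have := h.finsum_conductance_mul fun _ => 1
  simp only [mul_one, one_div] at this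
  exact this

lemma totalConductance_pos (h : IsStar K u l) : 0 < totalConductance (lattice ∪ bdry K) u := by
  rw [h.totalConductance_eq]
  exact Finset.sum_pos (fun d _ => by have := h.pos d; positivity) Finset.univ_nonempty

lemma finsum_stepProb_mul (h : IsStar K u l) (F : ℂ → ℝ) :
    ∑ᶠ v, stepProb (lattice ∪ bdry K) u v * F v
      = (∑ d, F (u + l d * dir d) / (4 * l d)) / totalConductance (lattice ∪ bdry K) u := by
  have := h.finsum_conductance_mul fun v => F v / totalConductance (lattice ∪ bdry K) u
  rw [Finset.sum_div]
  convert this using 1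
  · refine finsum_congr fun v => ?_
    rw [stepProb]; ring
  · refine Finset.sum_congr rfl fun d _ => by ring

lemma eq_one_of_mem_lattice (h : IsStar K u l) (hu : u ∈ lattice) {d : Fin 4}
    (hd : u + l d * dir d ∈ lattice) : l d = 1 :=
  add_mul_dir_mem_lattice hu (h.pos d) (h.le_one d) hd

end IsStar

/-! ### First-step equations for the walk -/

section FirstStep

variable {K : Set ℂ}

/-- Sums over time of a sequence generated by a walk stopped on `S` are bounded by supersolutions,
and satisfy the first-step equation. -/
lemma first_step (hK : IsCompact K) {S : Set ℂ} (hS : bdry K ⊆ S) {f : ℕ → ℂ → ℝ}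
    (hf0 : ∀ u, 0 ≤ f 0 u) (hfS : ∀ n, ∀ u ∈ S, f (n + 1) u = 0)
    (hf : ∀ n, ∀ u ∉ S, f (n + 1) u = ∑ᶠ v, stepProb (lattice ∪ bdry K) u v * f n v)
    {Φ : ℂ → ℝ} (hΦ0 : ∀ u ∈ verts K ∪ bdry K, 0 ≤ Φ u)
    (hΦS : ∀ u ∈ verts K ∪ bdry K, u ∈ S → f 0 u ≤ Φ u)
    (hΦ : ∀ u ∈ verts K, u ∉ S → f 0 u + ∑ᶠ v, stepProb (lattice ∪ bdry K) u v * Φ v ≤ Φ u)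
    {u : ℂ} (hu : u ∈ verts K ∪ bdry K) :
    0 ≤ ∑' n, f n u ∧ (u ∈ S → ∑' n, f n u = f 0 u) ∧
      (u ∉ S → ∑' n, f n u
        = f 0 u + ∑ᶠ v, stepProb (lattice ∪ bdry K) u v * ∑' n, f n v) := by
  have hvert : ∀ u ∈ verts K ∪ bdry K, u ∉ S → u ∈ verts K := fun u hu huS =>
    hu.resolve_right fun h => huS (hS h)
  -- nonnegativity, and bounds for the partial sums
  have hnn : ∀ n, ∀ u ∈ verts K ∪ bdry K, 0 ≤ f n u := by
    intro n
    induction n with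
    | zero => exact fun u _ => hf0 u
    | succ n ih =>
      intro u hu
      by_cases huS : u ∈ S
      · exact (hfS n u huS).ge
      obtain ⟨l, hl⟩ := exists_isStar hK (hvert u hu huS)
      rw [hf n u huS, hl.finsum_stepProb_mul]
      exact div_nonneg (Finset.sum_nonneg fun d _ =>
        div_nonneg (ih _ (hl.mem d)) (by linarith [hl.pos d])) hl.totalConductance_pos.le
  have hpart : ∀ n, ∀ u ∈ verts K ∪ bdry K, ∑ k ∈ Finset.range n, f k u ≤ Φ u := by
    intro n
    induction n with
    | zero => exact fun u hu => by simpa using hΦ0 u hu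
    | succ n ih =>
      intro u hu
      rw [Finset.sum_range_succ']
      by_cases huS : u ∈ S
      · rw [Finset.sum_eq_zero fun k _ => hfS k u huS, zero_add]
        exact hΦS u hu huS
      refine le_trans ?_ (hΦ u (hvert u hu huS) huS)
      obtain ⟨l, hl⟩ := exists_isStar hK (hvert u hu huS)
      rw [add_comm, Finset.sum_congr rfl fun k _ => hf k u huS]
      simp only [hl.finsum_stepProb_mul]
      rw [← Finset.sum_div, Finset.sum_comm]
      gcongr with d
      · exact hl.totalConductance_pos.le
      · rw [← Finset.sum_div]
        have := hl.pos d
        gcongr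
        exact ih _ (hl.mem d)
  have hsum : ∀ u ∈ verts K ∪ bdry K, Summable fun n => f n u := fun u hu =>
    summable_of_sum_range_le (c := Φ u) (fun n => hnn n u hu) fun n => hpart n u hu
  refine ⟨tsum_nonneg fun n => hnn n u hu, fun huS => ?_, fun huS => ?_⟩
  · rw [(hsum u hu).tsum_eq_zero_add]
    simp [hfS _ u huS]
  · obtain ⟨l, hl⟩ := exists_isStar hK (hvert u hu huS)
    rw [(hsum u hu).tsum_eq_zero_add]
    congr 1
    simp only [hf _ u huS, hl.finsum_stepProb_mul]
    rw [tsum_div_const, Summable.tsum_finsetSum fun d _ => (hsum _ (hl.mem d)).div_const _]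
    simp only [tsum_div_const]

end FirstStep

/-- The confining function `C - |z|²` is superharmonic for the network. -/
lemma IsStar.sum_sub_norm_sq {K : Set ℂ} {u : ℂ} {l : Fin 4 → ℝ} (h : IsStar K u l) (C : ℝ) :
    ∑ d, ((C - ‖u‖ ^ 2) - (C - ‖u + l d * dir d‖ ^ 2)) / (4 * l d) = ∑ d, l d / 4 := by
  have h0 := h.pos 0
  have h1 := h.pos 1
  have h2 := h.pos 2
  have h3 := h.pos 3
  simp only [Complex.sq_norm, Complex.normSq_apply, Fin.sum_univ_four]
  simp [dir]
  field_simp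
  ring

/-- The first-step equation in divergence form. -/
lemma IsStar.sum_sub_eq {K : Set ℂ} {u : ℂ} {l : Fin 4 → ℝ} (h : IsStar K u l) (F : ℂ → ℝ) :
    ∑ d, (F u - F (u + l d * dir d)) / (4 * l d)
      = totalConductance (lattice ∪ bdry K) u
        * (F u - ∑ᶠ v, stepProb (lattice ∪ bdry K) u v * F v) := by
  have hT := h.totalConductance_pos
  rw [h.finsum_stepProb_mul, mul_sub, mul_div_cancel₀ _ hT.ne', h.totalConductance_eq,
    Finset.sum_mul, ← Finset.sum_sub_distrib]
  refine Finset.sum_congr rfl fun d _ => ?_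
  have := h.pos d
  field_simp

/-! ### Harmonic measure and Green's function -/

section HarmonicMeasure

variable {K : Set ℂ}

lemma exists_confining (hK : IsCompact K) : ∃ C : ℝ, ∀ z ∈ K, 0 < C - ‖z‖ ^ 2 := by
  obtain ⟨C, hC⟩ := hK.isBounded.exists_norm_le
  refine ⟨C ^ 2 + 1, fun z hz => ?_⟩
  have := pow_le_pow_left₀ (norm_nonneg z) (hC z hz) 2
  linarith

lemma mem_of_mem_verts_union {u : ℂ} (hu : u ∈ verts K ∪ bdry K) : u ∈ K :=
  hu.elim (fun h => h.1.2) fun h => h.1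

/-- A target set and a starting point in the network do not add vertices to it. -/
lemma hm_eq {W : Set ℂ} (hW : W ⊆ lattice) {u : ℂ} (hu : u ∈ lattice ∪ bdry K) (w : ℂ) :
    hm K W u w = ∑' n, firstHitProb (lattice ∪ bdry K) (W ∪ bdry K) n u w := by
  have : lattice ∪ bdry K ∪ W ∪ {u} = lattice ∪ bdry K := by
    rw [Set.union_eq_left.2 (hW.trans Set.subset_union_left),
      Set.union_eq_left.2 (Set.singleton_subset_iff.2 hu)]
  rw [hm, this]

lemma verts_union_subset : verts K ∪ bdry K ⊆ lattice ∪ bdry K :=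
  Set.union_subset_union_left _ fun _ h => h.1.1

/-- Harmonic measure is nonnegative, has the boundary values of an indicator function, and is
harmonic off the target set. -/
lemma hm_first_step (hK : IsCompact K) {W : Set ℂ} (hW : W ⊆ lattice) (w : ℂ) {u : ℂ}
    (hu : u ∈ verts K ∪ bdry K) :
    0 ≤ hm K W u w ∧ (u ∈ W ∪ bdry K → hm K W u w = if u = w then 1 else 0) ∧
      (u ∉ W ∪ bdry K → ∀ l, IsStar K u l →
        ∑ d, (hm K W u w - hm K W (u + l d * dir d) w) / (4 * l d) = 0) := by
  have key := fun (u : ℂ) (hu : u ∈ verts K ∪ bdry K) =>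
    first_step hK (S := W ∪ bdry K) Set.subset_union_right
    (f := fun n u => firstHitProb (lattice ∪ bdry K) (W ∪ bdry K) n u w)
    (fun u => by simp only [firstHitProb]; split_ifs <;> simp)
    (fun n u hu => by simp only [firstHitProb, if_pos hu])
    (fun n u hu => by simp only [firstHitProb, if_neg hu]) (Φ := fun _ => 1)
    (fun _ _ => zero_le_one)
    (fun u _ _ => by simp only [firstHitProb]; split_ifs <;> simp)
    (fun u hu huS => by
      obtain ⟨l, hl⟩ := exists_isStar hK hu
      simp only [firstHitProb, huS, false_and, if_false, zero_add]
      rw [hl.finsum_stepProb_mul, hl.totalConductance_eq]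
      simp only [one_div]
      exact div_self_le_one _) (u := u) hu
  obtain ⟨k1, k2, k3⟩ := key u hu
  simp only [← hm_eq hW (verts_union_subset hu)] at k1 k2 k3
  refine ⟨k1, fun huS => ?_, fun huS l hl => ?_⟩
  · rw [k2 huS]; simp only [firstHitProb, huS, true_and]
  · have h3 := k3 huS
    simp only [firstHitProb, huS, false_and, if_false, zero_add] at h3
    have := hl.sum_sub_eq fun v => ∑' n, firstHitProb (lattice ∪ bdry K) (W ∪ bdry K) n v w
    simp only [← h3, ← hm_eq hW (verts_union_subset hu), sub_self, mul_zero,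
      ← hm_eq hW (verts_union_subset (hl.mem _))] at this
    exact this

lemma hm_nonneg (hK : IsCompact K) {W : Set ℂ} (hW : W ⊆ lattice) (w : ℂ) {u : ℂ} (hu : u ∈ verts K ∪ bdry K) : 0 ≤ hm K W u w :=
  (hm_first_step hK hW w hu).1

lemma hm_of_mem (hK : IsCompact K) {W : Set ℂ} (hW : W ⊆ lattice) {u w : ℂ} (hu : u ∈ verts K ∪ bdry K) (huW : u ∈ W ∪ bdry K) :
    hm K W u w = if u = w then 1 else 0 :=
  (hm_first_step hK hW w hu).2.1 huW

lemma green_eq {u v : ℂ} (hu : u ∈ lattice ∪ bdry K) (hv : v ∈ lattice ∪ bdry K) :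
    green K u v = (∑' n, killedProb (lattice ∪ bdry K) (bdry K) n u v)
      / totalConductance (lattice ∪ bdry K) v := by
  have : lattice ∪ bdry K ∪ {u, v} = lattice ∪ bdry K :=
    Set.union_eq_left.2 (Set.insert_subset hu (Set.singleton_subset_iff.2 hv))
  rw [green, this]

/-- Green's function vanishes on the boundary, and has a unit charge at its pole. -/
lemma green_first_step (hK : IsCompact K) {u v : ℂ}
    (hu : u ∈ verts K ∪ bdry K) (hv : v ∈ verts K) :
    (u ∈ bdry K → green K u v = 0) ∧
      (u ∉ bdry K → ∀ l, IsStar K u l →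
        ∑ d, (green K u v - green K (u + l d * dir d) v) / (4 * l d) = if u = v then 1 else 0) := by
  obtain ⟨C, hC⟩ := exists_confining hK
  obtain ⟨m, hm⟩ := exists_isStar hK hv
  set T := totalConductance (lattice ∪ bdry K) v with hT
  have hTpos : 0 < T := hm.totalConductance_pos
  -- the multiple of the confining function that has charge `T` at `v`
  set c : ℝ := T / ∑ d, m d / 4 with hc
  have hmpos : 0 < ∑ d, m d / 4 :=
    Finset.sum_pos (fun d _ => by have := hm.pos d; positivity) Finset.univ_nonempty
  have hc0 : 0 < c := by positivity
  have key := fun (u : ℂ) (hu : u ∈ verts K ∪ bdry K) =>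
    first_step hK (S := bdry K) subset_rfl
    (f := fun n u => killedProb (lattice ∪ bdry K) (bdry K) n u v)
    (fun u => by simp only [killedProb]; split_ifs <;> simp)
    (fun n u hu => by simp only [killedProb, if_pos hu])
    (fun n u hu => by simp only [killedProb, if_neg hu]) (Φ := fun z => c * (C - ‖z‖ ^ 2))
    (fun z hz => mul_nonneg hc0.le (hC z (mem_of_mem_verts_union hz)).le)
    (fun z hz hzb => by
      simp only [killedProb, hzb, not_true_eq_false, false_and, if_false]
      exact mul_nonneg hc0.le (hC z (mem_of_mem_verts_union hz)).le)
    (fun z hz hzb => by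
      obtain ⟨l, hl⟩ := exists_isStar hK hz
      have h1 := hl.sum_sub_eq fun z => c * (C - ‖z‖ ^ 2)
      have h2 := congrArg (fun t => c * t) (hl.sum_sub_norm_sq C)
      simp only [Finset.mul_sum] at h2
      have h3 : ∑ d, (c * (C - ‖z‖ ^ 2) - c * (C - ‖z + l d * dir d‖ ^ 2)) / (4 * l d)
          = ∑ d, c * (l d / 4) := by
        rw [← h2]; exact Finset.sum_congr rfl fun d _ => by ring
      rw [h3, ← Finset.mul_sum] at h1
      have hl0 : 0 ≤ ∑ d, l d / 4 := Finset.sum_nonneg fun d _ => by linarith [hl.pos d]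
      have hz0 := hl.totalConductance_pos
      simp only [killedProb, hzb, not_false_eq_true, true_and]
      split_ifs with hzv
      · subst hzv
        have hlm : ∑ d, m d / 4 = ∑ d, l d / 4 := by
          have e1 := hm.sum_sub_eq fun z => (C - ‖z‖ ^ 2)
          have e2 := hl.sum_sub_eq fun z => (C - ‖z‖ ^ 2)
          rw [hm.sum_sub_norm_sq] at e1
          rw [hl.sum_sub_norm_sq] at e2
          rw [e1, e2]
        rw [← hlm, hc, div_mul_cancel₀ _ hmpos.ne'] at h1
        have h4 := mul_left_cancel₀ hTpos.ne' ((mul_one T).trans h1)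
        rw [← hc] at h4
        linarith
      · have h4 := nonneg_of_mul_nonneg_right (h1 ▸ mul_nonneg hc0.le hl0) hz0
        linarith) (u := u) hu
  obtain ⟨k1, k2, k3⟩ := key u hu
  have hvN := verts_union_subset (Or.inl hv : v ∈ verts K ∪ bdry K)
  refine ⟨fun hub => ?_, fun hub l hl => ?_⟩
  · rw [green_eq (verts_union_subset hu) hvN, k2 hub]
    simp [killedProb, hub]
  · have h3 := k3 hub
    simp only [killedProb, hub, not_false_eq_true, true_and] at h3
    have := hl.sum_sub_eq fun z => ∑' n, killedProb (lattice ∪ bdry K) (bdry K) n z v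
    rw [sub_eq_of_eq_add h3] at this
    simp only [green_eq (verts_union_subset hu) hvN,
      green_eq (verts_union_subset (hl.mem _)) hvN]
    have h5 : ∀ x y z : ℝ, (x / T - y / T) / z = (x - y) / z / T := fun x y z => by ring
    simp only [← hT, h5]
    rw [← Finset.sum_div, this]
    split_ifs with huv
    · rw [huv, mul_one, div_self hTpos.ne']
    · rw [mul_zero, zero_div]

end HarmonicMeasure

/-! ### The network as a matrix -/

section NetworkMatrix
open Matrix

variable {K : Set ℂ}

open Classical in
/-- The generator of the walk killed on `bdry K`, as a matrix on the interior lattice points. -/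
noncomputable def netMatrix (K : Set ℂ) : Matrix (verts K) (verts K) ℝ := fun u v =>
  if u = v then totalConductance (lattice ∪ bdry K) u else -conductance (lattice ∪ bdry K) u v

lemma netMatrix_offDiag {u v : verts K} (huv : u ≠ v) :
    netMatrix K u v = -conductance (lattice ∪ bdry K) u v := if_neg huv

variable [Fintype (verts K)]

/-- Only the neighbours in `verts K` contribute: the walk is killed at the others. -/
lemma netMatrix_mulVec {u : verts K} {l : Fin 4 → ℝ} (h : IsStar K u l) (F : ℂ → ℝ) :
    (netMatrix K *ᵥ fun v : verts K => F v) u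
      = ∑ d, (F u - (verts K).indicator F (u + l d * dir d)) / (4 * l d) := by
  classical
  have h1 : ∀ v : verts K, netMatrix K u v * F v
      = (if u = v then totalConductance (lattice ∪ bdry K) u * F u else 0)
        - conductance (lattice ∪ bdry K) u v * F v := by
    intro v
    unfold netMatrix
    split_ifs with huv
    · subst huv; rw [conductance_self]; ring
    · ring
  have h2 : ∑ v : verts K, conductance (lattice ∪ bdry K) u v * F v
      = ∑ d, (verts K).indicator F (u + l d * dir d) / (4 * l d) := by
    rw [← h.finsum_conductance_mul, ← finsum_eq_sum_of_fintype,
      finsum_set_coe_eq_finsum_mem (f := fun v => conductance (lattice ∪ bdry K) u v * F v),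
      finsum_mem_def]
    refine finsum_congr fun v => ?_
    by_cases hv : v ∈ verts K <;> simp [hv]
  simp only [mulVec, dotProduct, h1]
  rw [Finset.sum_sub_distrib, h2, Finset.sum_ite_eq, if_pos (Finset.mem_univ _),
    h.totalConductance_eq, Finset.sum_mul, ← Finset.sum_sub_distrib]
  refine Finset.sum_congr rfl fun d _ => ?_
  have := h.pos d
  field_simp

/-- The killing rate of the walk. -/
lemma netMatrix_mulVec_one {u : verts K} {l : Fin 4 → ℝ} (h : IsStar K u l) :
    (netMatrix K *ᵥ 1) u = ∑ d, (bdry K).indicator 1 (u + l d * dir d) / (4 * l d) := by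
  have := netMatrix_mulVec h fun _ => 1
  rw [show (1 : verts K → ℝ) = fun _ => 1 from rfl, this]
  refine Finset.sum_congr rfl fun d _ => ?_
  congr 1
  rcases h.mem d with hd | hd
  · rw [Set.indicator_of_mem hd, Set.indicator_of_notMem hd.2, sub_self]
  · rw [Set.indicator_of_mem hd, Set.indicator_of_notMem fun h' => h'.2 hd, sub_zero, Pi.one_apply]

lemma netMatrix_mulVec_one_nonneg (hK : IsCompact K) (u : verts K) :
    0 ≤ (netMatrix K *ᵥ 1) u := by
  obtain ⟨l, hl⟩ := exists_isStar hK u.2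
  rw [netMatrix_mulVec_one hl]
  exact Finset.sum_nonneg fun d _ => div_nonneg (Set.indicator_nonneg (by simp) _)
    (by linarith [hl.pos d])

/-- Functions vanishing on the boundary. -/
lemma netMatrix_mulVec_of_eq_zero {u : verts K} {l : Fin 4 → ℝ} (h : IsStar K u l) {F : ℂ → ℝ}
    (hF : ∀ z ∈ bdry K, F z = 0) : (netMatrix K *ᵥ fun v : verts K => F v) u
      = ∑ d, (F u - F (u + l d * dir d)) / (4 * l d) := by
  rw [netMatrix_mulVec h]
  refine Finset.sum_congr rfl fun d _ => ?_
  rcases h.mem d with hd | hd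
  · rw [Set.indicator_of_mem hd]
  · rw [Set.indicator_of_notMem fun h' => h'.2 hd, hF _ hd]

/-- Transience is witnessed by the confining function. -/
lemma exists_isTransient (hK : IsCompact K) : ∃ F, IsTransient (netMatrix K) F := by
  obtain ⟨C, hC⟩ := exists_confining hK
  refine ⟨fun u => C - ‖(u : ℂ)‖ ^ 2, ⟨?_, fun u v huv => ?_, fun u => hC u u.2.1.2, fun u => ?_⟩⟩
  · ext u v
    rw [transpose_apply]
    rcases eq_or_ne u v with rfl | huv
    · rfl
    · rw [netMatrix_offDiag huv, netMatrix_offDiag huv.symm, conductance_comm]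
  · rw [netMatrix_offDiag huv]
    exact neg_nonpos.2 (conductance_nonneg _ _ _)
  · obtain ⟨l, hl⟩ := exists_isStar hK u.2
    rw [netMatrix_mulVec hl fun z => C - ‖z‖ ^ 2]
    have h1 : 0 < ∑ d, l d / 4 :=
      Finset.sum_pos (fun d _ => by have := hl.pos d; positivity) Finset.univ_nonempty
    refine h1.trans_le ?_
    rw [← hl.sum_sub_norm_sq C]
    refine Finset.sum_le_sum fun d _ => ?_
    have := hl.pos d
    gcongr
    exact Set.indicator_le_self' (fun _ _ => (hC _ (mem_of_mem_verts_union (hl.mem d))).le) _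

lemma isTransient_posDef (hK : IsCompact K) : (netMatrix K).PosDef :=
  (exists_isTransient hK).choose_spec.posDef

lemma netMatrix_mul_green (hK : IsCompact K) [DecidableEq (verts K)] :
    netMatrix K * (.of fun u v : verts K => green K u v) = 1 := by
  ext u v
  obtain ⟨l, hl⟩ := exists_isStar hK u.2
  have h1 := netMatrix_mulVec_of_eq_zero hl (F := fun z => green K z v)
    fun z hz => (green_first_step hK (Or.inr hz) v.2).1 hz
  have h2 := (green_first_step hK (Or.inl u.2) v.2).2 u.2.2 l hl
  rw [h2] at h1
  rw [mul_apply, one_apply]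
  simp only [← Subtype.coe_inj]
  exact h1

section
variable (hK : IsCompact K) {W : Set ℂ} (hW : W ⊆ lattice)
include hK hW

/-- Hitting an interior point is a harmonic function off the target set. -/
lemma netMatrix_mulVec_hm_interior {w : ℂ} (hw : w ∉ bdry K) {u : verts K} (hu : (u : ℂ) ∉ W) :
    (netMatrix K *ᵥ fun v : verts K => hm K W v w) u = 0 := by
  obtain ⟨l, hl⟩ := exists_isStar hK u.2
  rw [netMatrix_mulVec_of_eq_zero hl (F := fun z => hm K W z w)]
  · exact (hm_first_step hK hW w (Or.inl u.2)).2.2 (by simp [hu, u.2.2]) l hl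
  · intro z hz
    rw [hm_of_mem hK hW (Or.inr hz) (Or.inr hz), if_neg]
    rintro rfl
    exact hw hz

/-- The exit probability through a boundary point `w` has as charge the conductances to `w`. -/
lemma netMatrix_mulVec_hm_bdry {w : ℂ} (hw : w ∈ bdry K) {u : verts K} (hu : (u : ℂ) ∉ W) :
    (netMatrix K *ᵥ fun v : verts K => hm K W v w) u = conductance (lattice ∪ bdry K) u w := by
  classical
  obtain ⟨l, hl⟩ := exists_isStar hK u.2
  have h1 := (hm_first_step hK hW w (Or.inl u.2)).2.2 (by simp [hu, u.2.2]) l hl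
  have h2 := hl.finsum_conductance_mul fun v => if v = w then 1 else 0
  have h3 : ∑ᶠ v, conductance (lattice ∪ bdry K) u v * (if v = w then 1 else 0)
      = conductance (lattice ∪ bdry K) u w := by
    rw [finsum_eq_single _ w fun v hv => by simp [hv]]
    simp
  rw [netMatrix_mulVec hl fun z => hm K W z w, ← h3, h2]
  refine Eq.trans ?_ ((congrArg (_ + ·) h1).trans (add_zero _))
  rw [← Finset.sum_add_distrib]
  refine Finset.sum_congr rfl fun d _ => ?_
  rw [← add_div]
  congr 1
  rcases hl.mem d with hd | hd
  · rw [Set.indicator_of_mem hd, if_neg]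
    · ring
    · rintro rfl
      exact hd.2 hw
  · rw [Set.indicator_of_notMem fun h' => h'.2 hd, hm_of_mem hK hW (Or.inr hd) (Or.inr hd)]
    ring

variable {γ : verts K → ℝ} (hγ : ∀ u : verts K, (u : ℂ) ∈ W → γ u = 0)
include hγ

/-- Duality between harmonic measure and the potential `γ` of a charge: the charge absorbed at an
interior point of `W`. -/
lemma mulVec_potential {w : verts K} (hw : (w : ℂ) ∈ W) {k : verts K → ℝ}
    (hk : ∀ u : verts K, (u : ℂ) ∉ W → (netMatrix K *ᵥ γ) u = k u)
    (hkW : ∀ u : verts K, (u : ℂ) ∈ W → k u = 0) :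
    (netMatrix K *ᵥ γ) w = -∑ u, k u * hm K W u w := by
  classical
  obtain ⟨F, hF⟩ := exists_isTransient hK
  have h1 := dotProduct_mulVec_comm hF.isSymm γ fun v : verts K => hm K W v w
  have h2 : γ ⬝ᵥ netMatrix K *ᵥ (fun v : verts K => hm K W v w) = 0 :=
    Finset.sum_eq_zero fun u _ => by
      by_cases hu : (u : ℂ) ∈ W
      · rw [hγ u hu, zero_mul]
      · rw [netMatrix_mulVec_hm_interior hK hW w.2.2 hu, mul_zero]
  have h3 : (fun v : verts K => hm K W v w) ⬝ᵥ netMatrix K *ᵥ γ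
      = (netMatrix K *ᵥ γ) w + ∑ u, k u * hm K W u w := by
    have h4 : ∀ u : verts K, hm K W u w * (netMatrix K *ᵥ γ) u
        = (if w = u then (netMatrix K *ᵥ γ) w else 0) + k u * hm K W u w := by
      intro u
      by_cases hu : (u : ℂ) ∈ W
      · rw [hkW u hu, hm_of_mem hK hW (Or.inl u.2) (Or.inl hu)]
        by_cases huw : w = u
        · subst huw; simp
        · rw [if_neg (fun h => huw (Subtype.ext h.symm)), if_neg huw]; ring
      · rw [hk u hu, if_neg (by rintro rfl; exact hu hw)]; ring
    simp only [dotProduct, h4]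
    rw [Finset.sum_add_distrib, Finset.sum_ite_eq, if_pos (Finset.mem_univ _)]
  rw [h1, h3] at h2
  linarith

/-- The charge absorbed at a boundary point. -/
lemma sum_conductance_mul_potential {w : ℂ} (hw : w ∈ bdry K) {k : verts K → ℝ}
    (hk : ∀ u : verts K, (u : ℂ) ∉ W → (netMatrix K *ᵥ γ) u = k u)
    (hkW : ∀ u : verts K, (u : ℂ) ∈ W → k u = 0) :
    ∑ u : verts K, γ u * conductance (lattice ∪ bdry K) u w = ∑ u, k u * hm K W u w := by
  obtain ⟨F, hF⟩ := exists_isTransient hK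
  have h1 := dotProduct_mulVec_comm hF.isSymm γ fun v : verts K => hm K W v w
  have h2 : γ ⬝ᵥ netMatrix K *ᵥ (fun v : verts K => hm K W v w)
      = ∑ u : verts K, γ u * conductance (lattice ∪ bdry K) u w :=
    Finset.sum_congr rfl fun u _ => by
      by_cases hu : (u : ℂ) ∈ W
      · rw [hγ u hu, zero_mul, zero_mul]
      · rw [netMatrix_mulVec_hm_bdry hK hW hw hu]
  rw [← h2, h1]
  refine Finset.sum_congr rfl fun u _ => ?_
  simp only
  by_cases hu : (u : ℂ) ∈ W
  · rw [hkW u hu, hm_of_mem hK hW (Or.inl u.2) (Or.inl hu), if_neg]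
    · ring
    · intro h
      exact u.2.2 (h ▸ hw)
  · rw [hk u hu, mul_comm]

end

/-- The harmonic extension of boundary values bounded by `lam` has generator at most `lam` times
the killing rate. -/
lemma netMatrix_mulVec_mean_le (hK : IsCompact K) {f : ℂ → ℝ} {lam : ℝ}
    (hf : ∀ z ∈ bdry K, |f z| ≤ lam) :
    netMatrix K *ᵥ (fun u : verts K => ∑ᶠ w ∈ bdry K, hm K ∅ u w * f w)
      ≤ lam • netMatrix K *ᵥ 1 := by
  classical
  have hE : (∅ : Set ℂ) ⊆ lattice := Set.empty_subset _
  choose l hl using fun u : verts K => exists_isStar hK u.2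
  -- the boundary points adjacent to `verts K`, the only ones that are charged by harmonic measure
  set Z : Finset ℂ := (Finset.univ.image fun p : verts K × Fin 4 =>
    (p.1 : ℂ) + l p.1 p.2 * dir p.2).filter (· ∈ bdry K) with hZ
  have hZmem : ∀ (u : verts K) d, (u : ℂ) + l u d * dir d ∈ bdry K → (u : ℂ) + l u d * dir d ∈ Z := by
    intro u d h
    rw [hZ, Finset.mem_filter]
    exact ⟨Finset.mem_image.2 ⟨(u, d), Finset.mem_univ _, rfl⟩, h⟩
  have hZb : ∀ z ∈ Z, z ∈ bdry K := fun z hz => (Finset.mem_filter.1 hz).2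
  have hzero : ∀ w ∈ bdry K, w ∉ Z → ∀ u : verts K, hm K ∅ u w = 0 := by
    intro w hw hwZ u
    obtain ⟨F, hF⟩ := exists_isTransient hK
    refine congrFun (hF.eq_zero_of_harmonic ∅ (x := fun v : verts K => hm K ∅ v w) (by simp)
      fun i _ => ?_) u
    rw [netMatrix_mulVec_hm_bdry hK hE hw (by simp), (hl i).conductance_eq_zero]
    rintro d rfl
    exact hwZ (hZmem i d hw)
  have hmean : ∀ u : verts K, ∑ᶠ w ∈ bdry K, hm K ∅ u w * f w = ∑ w ∈ Z, hm K ∅ u w * f w := by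
    intro u
    rw [finsum_mem_def]
    rw [finsum_eq_sum_of_support_subset (s := Z)]
    · refine Finset.sum_congr rfl fun w hw => ?_
      rw [Set.indicator_of_mem (hZb w hw)]
    · intro w hw
      by_contra hc
      refine hw ?_
      by_cases hwb : w ∈ bdry K
      · rw [Set.indicator_of_mem hwb, hzero w hwb hc, zero_mul]
      · rw [Set.indicator_of_notMem hwb]
  intro u
  have h1 : (netMatrix K *ᵥ fun u : verts K => ∑ w ∈ Z, hm K ∅ u w * f w) u
      = ∑ w ∈ Z, conductance (lattice ∪ bdry K) u w * f w := by
    have : (fun u : verts K => ∑ w ∈ Z, hm K ∅ u w * f w)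
        = ∑ w ∈ Z, f w • fun u : verts K => hm K ∅ u w := by
      ext u; simp [mul_comm]
    rw [this, mulVec_sum, Finset.sum_apply]
    refine Finset.sum_congr rfl fun w hw => ?_
    rw [mulVec_smul, Pi.smul_apply, netMatrix_mulVec_hm_bdry hK hE (hZb w hw) (by simp),
      smul_eq_mul, mul_comm]
  have h2 : ∑ w ∈ Z, conductance (lattice ∪ bdry K) u w = (netMatrix K *ᵥ 1) u := by
    rw [netMatrix_mulVec_one (hl u), ← (hl u).finsum_conductance_mul,
      finsum_eq_sum_of_support_subset (s := Z)]
    · refine Finset.sum_congr rfl fun w hw => ?_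
      rw [Set.indicator_of_mem (hZb w hw), Pi.one_apply, mul_one]
    · intro w hw
      by_contra hc
      refine hw ?_
      by_cases hwb : w ∈ bdry K
      · simp only
        rw [(hl u).conductance_eq_zero, zero_mul]
        rintro d rfl
        exact hc (hZmem u d hwb)
      · simp [hwb]
  simp only [hmean]
  rw [h1, Pi.smul_apply, ← h2, smul_eq_mul, Finset.mul_sum]
  refine Finset.sum_le_sum fun w hw => ?_
  rw [mul_comm]
  exact mul_le_mul_of_nonneg_right (le_of_abs_le (hf w (hZb w hw))) (conductance_nonneg _ _ _)

end NetworkMatrix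

/-! ### Logarithmic potentials on the lattice -/

/-- An explicit substitute for the potential kernel of the walk: it is zero at the origin, and
superharmonic elsewhere (`sum_logPot_le`). Off the origin it is `log (|z|² - 1 / 2) + log 128`, where
the second constant is large enough for superharmonicity next to the origin. -/
noncomputable def logPot (z : ℂ) : ℝ := if z = 0 then 0 else Real.log (128 * Complex.normSq z - 64)

lemma one_le_normSq {z : ℂ} (hz : z ∈ lattice) (h0 : z ≠ 0) : 1 ≤ Complex.normSq z := by
  obtain ⟨⟨m, hm⟩, n, hn⟩ := hz
  have h1 : 0 < Complex.normSq z := Complex.normSq_pos.2 h0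
  rw [Complex.normSq_apply, hm, hn] at h1 ⊢
  exact_mod_cast h1

lemma log_add_four_le {a b c d e : ℝ} (ha : 0 < a) (hb : 0 < b) (hc : 0 < c) (hd : 0 < d)
    (h : a * b * c * d ≤ e ^ 4) :
    Real.log a + Real.log b + Real.log c + Real.log d ≤ 4 * Real.log e := by
  rw [← Real.log_mul ha.ne' hb.ne', ← Real.log_mul (by positivity) hc.ne',
    ← Real.log_mul (by positivity) hd.ne']
  calc _ ≤ Real.log (e ^ 4) := Real.log_le_log (by positivity) h
    _ = _ := by rw [Real.log_pow]; norm_num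

lemma log_add_four_ge {a b c d e : ℝ} (ha : 0 < a) (hb : 0 < b) (hc : 0 < c) (hd : 0 < d)
    (he : 0 < e) (h : e ^ 4 ≤ a * b * c * d) :
    4 * Real.log e ≤ Real.log a + Real.log b + Real.log c + Real.log d := by
  rw [← Real.log_mul ha.ne' hb.ne', ← Real.log_mul (by positivity) hc.ne',
    ← Real.log_mul (by positivity) hd.ne']
  calc _ = Real.log (e ^ 4) := by rw [Real.log_pow]; norm_num
    _ ≤ _ := Real.log_le_log (by positivity) h

lemma log_sixtyfour_le_logPot {z : ℂ} (hz : z ∈ lattice) (h0 : z ≠ 0) :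
    Real.log 64 ≤ logPot z := by
  rw [logPot, if_neg h0]
  exact Real.log_le_log (by norm_num) (by linarith [one_le_normSq hz h0])

lemma normSq_add_dir (z : ℂ) (d : Fin 4) :
    Complex.normSq (z + dir d)
      = Complex.normSq z + 1 + 2 * (![z.re, z.im, -z.re, -z.im] : Fin 4 → ℝ) d := by
  fin_cases d <;> simp [dir, Complex.normSq_apply] <;> ring

lemma sum_logPot_le {z : ℂ} (hz : z ∈ lattice) (h0 : z ≠ 0) :
    ∑ d, logPot (z + dir d) ≤ 4 * logPot z := by
  have hs := one_le_normSq hz h0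
  -- `logPot` is the logarithm of the following function
  set E : ℂ → ℝ := fun z => if z = 0 then 1 else 128 * Complex.normSq z - 64 with hE
  have hlog : ∀ z, logPot z = Real.log (E z) := fun z => by
    simp only [logPot, hE]; split_ifs <;> simp
  have hpos : ∀ z ∈ lattice, 0 < E z := fun z hz => by
    simp only [hE]
    split_ifs with h
    · exact one_pos
    · linarith [one_le_normSq hz h]
  simp only [hlog, Fin.sum_univ_four]
  refine log_add_four_le (hpos _ (add_dir_mem_lattice hz 0)) (hpos _ (add_dir_mem_lattice hz 1))
    (hpos _ (add_dir_mem_lattice hz 2)) (hpos _ (add_dir_mem_lattice hz 3)) ?_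
  by_cases hd : ∃ d, z + dir d = 0
  · obtain ⟨d, hd⟩ := hd
    obtain rfl := eq_neg_of_add_eq_zero_left hd
    fin_cases d <;> simp [hE, dir, Complex.ext_iff, Complex.normSq_apply] <;> norm_num
  · push Not at hd
    simp only [hE, if_neg h0, if_neg (hd _), normSq_add_dir]
    simp only [Complex.normSq_apply, Matrix.cons_val]
    -- for `z = x + i y` this reduces to `4 x² y² ≤ (x² + y²)²`
    nlinarith [sq_nonneg (z.re ^ 2 - z.im ^ 2)]

/-- `log (|z|² + 1)` is subharmonic. -/
lemma le_sum_log_normSq (z : ℂ) :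
    4 * Real.log (Complex.normSq z + 1) ≤ ∑ d, Real.log (Complex.normSq (z + dir d) + 1) := by
  have h : ∀ z : ℂ, 0 < Complex.normSq z + 1 := fun z => by
    linarith [Complex.normSq_nonneg z]
  rw [Fin.sum_univ_four]
  refine log_add_four_ge (h _) (h _) (h _) (h _) (h _) ?_
  simp only [normSq_add_dir]
  simp only [Complex.normSq_apply, Matrix.cons_val]
  nlinarith [sq_nonneg (z.re * z.im), sq_nonneg (z.re ^ 2 + z.im ^ 2), sq_nonneg z.re,
    sq_nonneg z.im]

lemma sum_log_normSq_dir : ∑ d, Real.log (Complex.normSq (dir d) + 1) = 4 * Real.log 2 := by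
  have : ∀ d, Complex.normSq (dir d) + 1 = 2 := fun d => by
    rw [Complex.normSq_eq_norm_sq, norm_dir]; norm_num
  simp [this]

/-! ### Summability over the lattice -/

/-- The bound is chosen to telescope. -/
lemma sum_Icc_one_div_le (N : ℕ) :
    ∑ m ∈ Finset.Icc (-(N : ℤ)) N, 1 / (1 + (m : ℝ) ^ 2) ≤ 5 - 4 / ((N : ℝ) + 1) := by
  induction N with
  | zero => simp; norm_num
  | succ n ih =>
    have : Finset.Icc (-((n + 1 : ℕ) : ℤ)) ((n + 1 : ℕ) : ℤ)
        = insert ((n : ℤ) + 1) (insert (-((n : ℤ) + 1)) (Finset.Icc (-(n : ℤ)) n)) := by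
      ext m; simp only [Finset.mem_Icc, Finset.mem_insert]; omega
    rw [this, Finset.sum_insert, Finset.sum_insert]
    · push_cast
      have h1 : 1 / (1 + ((n : ℝ) + 1) ^ 2) + 1 / (1 + (-1 + -(n : ℝ)) ^ 2)
          ≤ 4 / (n + 1) - 4 / (n + 1 + 1) := by
        have hn : (0 : ℝ) ≤ n := n.cast_nonneg
        rw [show (-1 + -(n : ℝ)) ^ 2 = ((n : ℝ) + 1) ^ 2 by ring, ← add_div,
          div_sub_div _ _ (by positivity) (by positivity),
          div_le_div_iff₀ (by positivity) (by positivity)]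
        nlinarith [mul_nonneg hn hn, mul_nonneg (mul_nonneg hn hn) hn,
          mul_nonneg (mul_nonneg hn hn) (mul_nonneg hn hn)]
      have h2 : (-((n : ℝ) + 1)) ^ 2 = (-1 + -(n : ℝ)) ^ 2 := by ring
      rw [h2]
      linarith
    · simp
    · simp; omega

lemma sum_one_div_normSq_sq_le (s : Finset ℂ) (hs : ∀ z ∈ s, z ∈ lattice ∧ z ≠ 0) :
    ∑ z ∈ s, 1 / Complex.normSq z ^ 2 ≤ 9 / 4 * 25 := by
  classical
  obtain ⟨C, hC⟩ : ∃ C : ℕ, ∀ z ∈ s, ‖z‖ ≤ C := by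
    obtain ⟨C, hC⟩ := s.finite_toSet.isBounded.exists_norm_le
    obtain ⟨N, hN⟩ := exists_nat_ge C
    exact ⟨N, fun z hz => (hC z hz).trans hN⟩
  set B := Finset.Icc (-(C : ℤ)) C with hB
  have hsub : s ⊆ (B ×ˢ B).image fun p : ℤ × ℤ => (⟨p.1, p.2⟩ : ℂ) := by
    intro z hz
    obtain ⟨⟨⟨m, hm⟩, n, hn⟩, -⟩ := hs z hz
    have h1 : |(m : ℝ)| ≤ C := by rw [← hm]; exact (Complex.abs_re_le_norm z).trans (hC z hz)
    have h2 : |(n : ℝ)| ≤ C := by rw [← hn]; exact (Complex.abs_im_le_norm z).trans (hC z hz)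
    rw [abs_le] at h1 h2
    refine Finset.mem_image.2 ⟨(m, n), ?_, Complex.ext hm.symm hn.symm⟩
    rw [Finset.mem_product, hB, Finset.mem_Icc, Finset.mem_Icc]
    exact ⟨⟨by exact_mod_cast h1.1, by exact_mod_cast h1.2⟩,
      by exact_mod_cast h2.1, by exact_mod_cast h2.2⟩
  set G : ℂ → ℝ := fun z => 9 / 4 * (1 / (1 + z.re ^ 2) * (1 / (1 + z.im ^ 2))) with hG
  have hG0 : ∀ z, 0 ≤ G z := fun z => by positivity
  calc ∑ z ∈ s, 1 / Complex.normSq z ^ 2 ≤ ∑ z ∈ s, G z := by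
        refine Finset.sum_le_sum fun z hz => ?_
        have h1 := one_le_normSq (hs z hz).1 (hs z hz).2
        simp only [hG]
        rw [Complex.normSq_apply] at h1 ⊢
        rw [one_div_mul_one_div, mul_one_div, div_le_div_iff₀ (by positivity) (by positivity)]
        nlinarith [sq_nonneg (z.re ^ 2 - z.im ^ 2)]
    _ ≤ ∑ z ∈ (B ×ˢ B).image fun p : ℤ × ℤ => (⟨p.1, p.2⟩ : ℂ), G z :=
        Finset.sum_le_sum_of_subset_of_nonneg hsub fun _ _ _ => hG0 _
    _ = 9 / 4 * ((∑ m ∈ B, 1 / (1 + (m : ℝ) ^ 2)) * ∑ n ∈ B, 1 / (1 + (n : ℝ) ^ 2)) := by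
        rw [Finset.sum_image, Finset.sum_product, Finset.sum_mul_sum, Finset.mul_sum]
        · simp only [Finset.mul_sum, hG]
        · rintro ⟨a, b⟩ - ⟨c, d⟩ - h
          simpa [Complex.ext_iff] using h
    _ ≤ 9 / 4 * (5 * 5) := by
        have h := sum_Icc_one_div_le C
        have h0 : (0 : ℝ) ≤ 4 / ((C : ℝ) + 1) := by positivity
        have h1 : 0 ≤ ∑ m ∈ B, 1 / (1 + (m : ℝ) ^ 2) := Finset.sum_nonneg fun _ _ => by positivity
        gcongr <;> linarith
    _ = _ := by norm_num

/-! ### The network around an explored point -/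

lemma Nbr.exists_dir {v w : ℂ} (h : Nbr v w) : ∃ d, w = v + dir d := by
  obtain ⟨⟨⟨m, hm⟩, n, hn⟩, ⟨⟨m', hm'⟩, n', hn'⟩, h1⟩ := h
  have h2 : Complex.normSq (v - w) = 1 := by rw [Complex.normSq_eq_norm_sq, h1, one_pow]
  rw [Complex.normSq_apply, Complex.sub_re, Complex.sub_im, hm, hn, hm', hn'] at h2
  have h3 : (m - m') * (m - m') + (n - n') * (n - n') = 1 := by exact_mod_cast h2
  have hb : -1 ≤ m - m' ∧ m - m' ≤ 1 := by constructor <;> nlinarith [sq_nonneg (n - n')]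
  have hb' : -1 ≤ n - n' ∧ n - n' ≤ 1 := by constructor <;> nlinarith [sq_nonneg (m - m')]
  have hw : w = ⟨m', n'⟩ := Complex.ext hm' hn'
  have hv : v = ⟨m, n⟩ := Complex.ext hm hn
  obtain ⟨a, ha⟩ : ∃ a, a = m - m' := ⟨_, rfl⟩
  obtain ⟨b, hb2⟩ : ∃ b, b = n - n' := ⟨_, rfl⟩
  obtain rfl : m = m' + a := by omega
  obtain rfl : n = n' + b := by omega
  rw [← ha] at hb h3
  rw [← hb2] at hb' h3
  obtain ⟨h4, h5⟩ := hb
  obtain ⟨h6, h7⟩ := hb'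
  rw [hv, hw]
  interval_cases a <;> interval_cases b <;> simp at h3
  · exact ⟨0, by simp [dir, Complex.ext_iff]⟩
  · exact ⟨1, by simp [dir, Complex.ext_iff]⟩
  · exact ⟨3, by simp [dir, Complex.ext_iff]⟩
  · exact ⟨2, by simp [dir, Complex.ext_iff]⟩

lemma nbr_add_dir {v : ℂ} (hv : v ∈ lattice) (d : Fin 4) : Nbr v (v + dir d) :=
  ⟨hv, add_dir_mem_lattice hv d, by simp [norm_dir]⟩

/-- The metric graph near a lattice point consists of the four edges issued from it. -/
lemma exists_mem_segment {v z : ℂ} (hv : v ∈ lattice) (hz : z ∈ grid) (hvz : ‖z - v‖ < 1) :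
    ∃ d, z ∈ segment ℝ v (v + dir d) := by
  obtain ⟨⟨m, hm⟩, n, hn⟩ := hv
  have key : ∀ (d : Fin 4) (t : ℝ), 0 ≤ t → t < 1 → z = v + t * dir d →
      ∃ d, z ∈ segment ℝ v (v + dir d) := by
    rintro d t h0 h1 rfl
    refine ⟨d, 1 - t, t, by linarith, h0, by ring, ?_⟩
    simp only [Complex.real_smul, Complex.ofReal_sub, Complex.ofReal_one]
    ring
  have hre := (Complex.abs_re_le_norm (z - v)).trans_lt hvz
  have him := (Complex.abs_im_le_norm (z - v)).trans_lt hvz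
  rw [Complex.sub_re] at hre
  rw [Complex.sub_im] at him
  have hint : ∀ i j : ℤ, |(i : ℝ) - j| < 1 → i = j := fun i j h => by
    have : |i - j| < 1 := by exact_mod_cast h
    have := Int.abs_lt_one_iff.1 this
    omega
  rcases hz with ⟨i, hi⟩ | ⟨i, hi⟩
  · rw [hi, hm] at hre
    obtain rfl := hint _ _ hre
    rw [abs_lt] at him
    rcases le_total 0 (z.im - v.im) with h | h
    · exact key 1 _ h him.2 (Complex.ext (by simp [dir, hi, hm]) (by simp [dir]))
    · exact key 3 (v.im - z.im) (by linarith) (by linarith)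
        (Complex.ext (by simp [dir, hi, hm]) (by simp [dir]))
  · rw [hi, hn] at him
    obtain rfl := hint _ _ him
    rw [abs_lt] at hre
    rcases le_total 0 (z.re - v.re) with h | h
    · exact key 0 _ h hre.2 (Complex.ext (by simp [dir]) (by simp [dir, hi, hn]))
    · exact key 2 (v.re - z.re) (by linarith) (by linarith)
        (Complex.ext (by simp [dir]) (by simp [dir, hi, hn]))

/-- There is no boundary point at distance less than one from a lattice point whose four edges are
contained in `K`. -/
lemma notMem_bdry_of_norm_sub_lt {K : Set ℂ} {v z : ℂ} (hv : v ∈ lattice)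
    (hK : ∀ w, Nbr v w → segment ℝ v w ⊆ K) (hz : ‖z - v‖ < 1) : z ∉ bdry K := by
  rintro ⟨-, hc⟩
  obtain ⟨y, hy, hyg, hyK⟩ := mem_closure_iff.1 hc (Metric.ball v 1) Metric.isOpen_ball
    (by rwa [Metric.mem_ball, dist_eq_norm])
  rw [Metric.mem_ball, dist_eq_norm] at hy
  obtain ⟨d, hd⟩ := exists_mem_segment hv hyg hy
  exact hyK (hK _ (nbr_add_dir hv d) hd)

namespace IsStar

variable {K : Set ℂ} {u v : ℂ} {l : Fin 4 → ℝ}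

lemma eq_one (h : IsStar K v l) (hv : v ∈ lattice) (hfree : ∀ z, ‖z - v‖ < 1 → z ∉ bdry K)
    (d : Fin 4) : l d = 1 := by
  by_contra hne
  have hlt : l d < 1 := lt_of_le_of_ne (h.le_one d) hne
  have hb : v + l d * dir d ∉ bdry K := hfree _ (by
    simpa [norm_dir, abs_of_pos (h.pos d)] using hlt)
  exact hne (h.eq_one_of_mem_lattice hv ((h.mem d).resolve_right hb).1.1)

/-- A star cannot be cut by the boundary on its way to a point `v` whose edges are free. -/
lemma add_dir_ne (h : IsStar K u l) (hfree : ∀ z, ‖z - v‖ < 1 → z ∉ bdry K) {d : Fin 4}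
    (hd : u + l d * dir d ∈ bdry K) : u + dir d ≠ v := by
  rintro rfl
  refine hfree _ ?_ hd
  have : u + l d * dir d - (u + dir d) = ((l d - 1 : ℝ) : ℂ) * dir d := by push_cast; ring
  rw [this, norm_mul, norm_dir, mul_one, Complex.norm_real, Real.norm_eq_abs, abs_lt]
  constructor <;> linarith [h.pos d, h.le_one d]

end IsStar

/-! ### The barrier around an explored point -/

section Barrier
open Matrix

variable {K : Set ℂ} [Fintype (verts K)]

/-- Comparison of the network with the lattice: cutting an edge only helps superharmonicity. -/
lemma le_netMatrix_mulVec {u : verts K} {l : Fin 4 → ℝ} (h : IsStar K u l) {F : ℂ → ℝ} {c : ℝ}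
    (hc : ∀ d, (u : ℂ) + l d * dir d ∈ bdry K → c ≤ F u ∧ c ≤ F (u + dir d)) :
    ∑ d, (F u - F (u + dir d)) / 4 + c * (netMatrix K *ᵥ 1) u
      ≤ (netMatrix K *ᵥ fun v : verts K => F v) u := by
  rw [netMatrix_mulVec h, netMatrix_mulVec_one h, Finset.mul_sum, ← Finset.sum_add_distrib]
  refine Finset.sum_le_sum fun d _ => ?_
  have hl := h.pos d
  have hl1 := h.le_one d
  rcases h.mem d with hd | hd
  · rw [Set.indicator_of_mem hd, Set.indicator_of_notMem hd.2,
      h.eq_one_of_mem_lattice u.2.1.1 hd.1.1]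
    simp
  · rw [Set.indicator_of_mem hd, Set.indicator_of_notMem fun h' => h'.2 hd, Pi.one_apply]
    obtain ⟨h1, h2⟩ := hc d hd
    rw [← sub_nonneg]
    have : (F u - 0) / (4 * l d) - ((F u - F (u + dir d)) / 4 + c * (1 / (4 * l d)))
        = ((F u - c) * (1 - l d) + (F (u + dir d) - c) * l d) / (4 * l d) := by
      field_simp; ring
    rw [this]
    have := mul_nonneg (sub_nonneg.2 h1) (sub_nonneg.2 hl1)
    have := mul_nonneg (sub_nonneg.2 h2) hl.le
    positivity

/-- The charge at `v` of the barrier `max lam 10 * logPot (z - v)`, up to sign, with an allowance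
`lam` for the killing rate at `v`. -/
noncomputable def barrierCharge (lam : ℝ) : ℝ := max lam 10 * Real.log 64 + lam

lemma sub_mem_lattice {u v : ℂ} (hu : u ∈ lattice) (hv : v ∈ lattice) : u - v ∈ lattice := by
  obtain ⟨⟨m, hm⟩, n, hn⟩ := hu
  obtain ⟨⟨m', hm'⟩, n', hn'⟩ := hv
  exact ⟨⟨m - m', by simp [hm, hm']⟩, n - n', by simp [hn, hn']⟩

lemma log_normSq_sub_le (a b : ℂ) (ha : a ∈ lattice) :
    Real.log (Complex.normSq (a - b) + 1)
      ≤ logPot a + Real.log (Complex.normSq b + 1) + Real.log 2 := by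
  have hb := Complex.normSq_nonneg b
  have hab := Complex.normSq_nonneg (a - b)
  rw [logPot]
  split_ifs with h
  · rw [h, zero_sub, Complex.normSq_neg]
    linarith [Real.log_nonneg (by norm_num : (1 : ℝ) ≤ 2)]
  · have h1 := one_le_normSq ha h
    rw [← Real.log_mul (by linarith) (by linarith), ← Real.log_mul (by nlinarith) (by norm_num)]
    refine Real.log_le_log (by linarith) ?_
    have h2 : Complex.normSq (a - b) ≤ 2 * Complex.normSq a + 2 * Complex.normSq b := by
      simp only [Complex.normSq_apply, Complex.sub_re, Complex.sub_im]
      nlinarith [sq_nonneg (a.re + b.re), sq_nonneg (a.im + b.im)]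
    nlinarith

/-- A bound for Green's function killed at an explored point `v`: it is dominated by the supersolution
`logPot (x - v) - log (|x - w|² + 1)`, suitably shifted and scaled, whose second term carries the charge
at `w`. -/
lemma exists_pinned_green_le (hK : IsCompact K) [DecidableEq (verts K)] {v w : verts K}
    (hvw : w ≠ v) :
    ∃ u : verts K → ℝ, u v = 0 ∧
      (∃ q ≤ 1, netMatrix K *ᵥ u = Pi.single w 1 - Pi.single v q) ∧ u w ≤ 5 * logPot (w - v) := by
  obtain ⟨F, hF⟩ := exists_isTransient hK
  have hlog2 : 0 < Real.log 2 := Real.log_pos (by norm_num)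
  -- the shift makes `T` nonnegative, and the mean of `log (|x - w|² + 1)` around `w` is `log 2`
  set T : ℂ → ℝ := fun x => (logPot (x - v) - Real.log (Complex.normSq (x - w) + 1)
    + Real.log (Complex.normSq ((w : ℂ) - v) + 1) + Real.log 2) / Real.log 2 with hT
  have hT0 : ∀ x ∈ lattice, 0 ≤ T x := fun x hx => by
    have := log_normSq_sub_le (x - v) (w - v) (sub_mem_lattice hx v.2.1.1)
    rw [sub_sub_sub_cancel_right] at this
    exact div_nonneg (by linarith) hlog2.le
  obtain ⟨u, hu1, hu2, hu3⟩ := hF.exists_pinned_green (netMatrix_mulVec_one_nonneg hK) hvw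
    (T := fun x => T x) (hT0 v v.2.1.1) fun i hi => by
      obtain ⟨l, hl⟩ := exists_isStar hK i.2
      have h1 := le_netMatrix_mulVec hl (F := T) (c := 0) fun d _ =>
        ⟨hT0 _ i.2.1.1, hT0 _ (add_dir_mem_lattice i.2.1.1 d)⟩
      rw [zero_mul, add_zero] at h1
      refine le_trans ?_ h1
      have h2 := sum_logPot_le (sub_mem_lattice i.2.1.1 v.2.1.1)
        (sub_ne_zero.2 fun h => hi (Subtype.ext h))
      have h3 := le_sum_log_normSq ((i : ℂ) - w)
      have h4 : ∑ d, (T i - T (i + dir d)) / 4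
          = ((4 * logPot (i - v) - ∑ d, logPot (i - v + dir d))
            + (∑ d, Real.log (Complex.normSq ((i : ℂ) - w + dir d) + 1)
              - 4 * Real.log (Complex.normSq ((i : ℂ) - w) + 1))) / (4 * Real.log 2) := by
        simp only [hT, Fin.sum_univ_four, add_sub_right_comm]
        field_simp
        ring
      rw [h4, le_div_iff₀ (by positivity)]
      by_cases hiw : i = w
      · subst hiw
        rw [Pi.single_eq_same]
        have h5 := sum_log_normSq_dir
        simp only [sub_self, zero_add, map_zero, Real.log_one] at h3 ⊢
        linarith
      · rw [Pi.single_eq_of_ne hiw]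
        linarith
  refine ⟨u, hu1, hu2, hu3.trans ?_⟩
  have hne : (w : ℂ) - v ≠ 0 := sub_ne_zero.2 fun h => hvw (Subtype.ext h)
  have hwv := sub_mem_lattice w.2.1.1 v.2.1.1
  have h1 := log_sixtyfour_le_logPot hwv hne
  have h2 := one_le_normSq hwv hne
  have h3 : Real.log (Complex.normSq ((w : ℂ) - v) + 1) ≤ logPot (w - v) := by
    rw [logPot, if_neg hne]
    exact Real.log_le_log (by linarith) (by linarith)
  have h4 : Real.log 64 = 6 * Real.log 2 := by
    rw [show (64 : ℝ) = 2 ^ 6 by norm_num, Real.log_pow]; norm_num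
  have h5 := Real.log_two_gt_d9
  simp only [hT, sub_self, map_zero, zero_add, Real.log_one, sub_zero]
  rw [div_le_iff₀ hlog2]
  nlinarith

/-- The barrier at an explored point `v` is `α * logPot (z - v)`. The factor `α` is at least `lam` in
order to dominate the boundary values, and large enough for the exponents of Chernoff's inequality to
be at most `-2 * logPot (w - v)`, so that their exponentials have a small sum over the lattice. -/
lemma barrier_netMatrix (hK : IsCompact K) [DecidableEq (verts K)] {v : verts K}
    (hfree : ∀ z : ℂ, ‖z - v‖ < 1 → z ∉ bdry K) {W : Finset (verts K)} (hvW : v ∉ W) {lam : ℝ}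
    (hlam : 0 ≤ lam) :
    Barrier (netMatrix K) W v (lam • netMatrix K *ᵥ 1) (barrierCharge lam) := by
  set α := max lam 10 with hα
  have hα1 : lam ≤ α := le_max_left _ _
  have hα2 : 10 ≤ α := le_max_right _ _
  have hlog64 : (4 : ℝ) ≤ Real.log 64 := by
    have h4 : Real.log 64 = 6 * Real.log 2 := by
      rw [show (64 : ℝ) = 2 ^ 6 by norm_num, Real.log_pow]; norm_num
    linarith [Real.log_two_gt_d9]
  set B : ℂ → ℝ := fun z => α * logPot (z - v) with hB
  have hBv : B v = 0 := by simp [hB, logPot]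
  have hBlam : ∀ z ∈ lattice, z ≠ v → lam ≤ B z := fun z hz hzv => by
    have := log_sixtyfour_le_logPot (sub_mem_lattice hz v.2.1.1) (sub_ne_zero.2 hzv)
    simp only [hB]
    nlinarith
  have hne : ∀ w ∈ W, w ≠ v := fun w hw h => hvW (h ▸ hw)
  choose! u hu using fun (w : verts K) (hw : w ∈ W) => exists_pinned_green_le hK (hne w hw)
  refine ⟨fun z => B z, hBv, fun z => ?_, u, fun w hw => ⟨(hu w hw).1, (hu w hw).2.1⟩,
    fun _ => α / 10, fun _ _ => by positivity, ?_⟩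
  · obtain ⟨l, hl⟩ := exists_isStar hK z.2
    rw [Pi.smul_apply, smul_eq_mul, Pi.add_apply]
    rcases eq_or_ne z v with rfl | hzv
    · have hone := hl.eq_one z.2.1.1 hfree
      rw [Pi.single_eq_same, netMatrix_mulVec_one hl, netMatrix_mulVec hl]
      have hb : ∀ d, B (z + dir d) = α * Real.log 64 := fun d => by
        have hd0 : dir d ≠ 0 := by rw [← norm_ne_zero_iff, norm_dir]; norm_num
        simp only [hB, add_sub_cancel_left, logPot, if_neg hd0, Complex.normSq_eq_norm_sq,
          norm_dir]
        norm_num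
      have h1 : barrierCharge lam = ∑ _d : Fin 4, (α * Real.log 64 + lam) / 4 := by
        simp only [Finset.sum_const, Finset.card_univ, Fintype.card_fin, barrierCharge]
        rw [nsmul_eq_mul]; push_cast; ring
      rw [h1, Finset.mul_sum, ← Finset.sum_add_distrib]
      refine Finset.sum_le_sum fun d _ => ?_
      rcases hl.mem d with hd | hd
      · rw [Set.indicator_of_notMem hd.2, Set.indicator_of_mem hd, hBv, hone d]
        simp only [Complex.ofReal_one, one_mul, hb]
        linarith
      · rw [Set.indicator_of_mem hd, Set.indicator_of_notMem fun h' => h'.2 hd, hBv, hone d,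
          Pi.one_apply]
        nlinarith
    · rw [Pi.single_eq_of_ne hzv, add_zero]
      have h1 := le_netMatrix_mulVec hl (F := B) (c := lam) fun d hd =>
        ⟨hBlam _ z.2.1.1 fun h => hzv (Subtype.ext h),
          hBlam _ (add_dir_mem_lattice z.2.1.1 d) (hl.add_dir_ne hfree hd)⟩
      have h2 := sum_logPot_le (sub_mem_lattice z.2.1.1 v.2.1.1)
        (sub_ne_zero.2 fun h => hzv (Subtype.ext h))
      have h3 : 0 ≤ ∑ d, (B z - B (z + dir d)) / 4 := by
        have : ∑ d, (B z - B (z + dir d)) / 4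
            = α * (4 * logPot (z - v) - ∑ d, logPot (z - v + dir d)) / 4 := by
          simp only [hB, Fin.sum_univ_four, add_sub_right_comm]
          ring
        rw [this]
        have := mul_nonneg (by linarith : 0 ≤ α) (sub_nonneg.2 h2)
        positivity
      linarith
  · have hterm : ∀ w ∈ W, Real.exp (-(α / 10) * (B w - 1) + (α / 10) ^ 2 * u w w / 2)
        ≤ 1 / 64 ^ 2 * (1 / Complex.normSq ((w : ℂ) - v) ^ 2) := by
      intro w hw
      have hwv := sub_mem_lattice w.2.1.1 v.2.1.1
      have hwv0 : (w : ℂ) - v ≠ 0 := sub_ne_zero.2 fun h => hne w hw (Subtype.ext h)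
      have h1 := log_sixtyfour_le_logPot hwv hwv0
      have h2 := one_le_normSq hwv hwv0
      have hu5 := (hu w hw).2.2
      have h3 : -(α / 10) * (B w - 1) + (α / 10) ^ 2 * u w w / 2 ≤ -2 * logPot (w - v) := by
        simp only [hB]
        set b := logPot ((w : ℂ) - v)
        have hb4 : 4 ≤ b := hlog64.trans h1
        have hα100 : 100 ≤ α ^ 2 := by nlinarith
        have e1 : (α / 10) ^ 2 * u w w / 2 ≤ (α / 10) ^ 2 * (5 * b) / 2 := by gcongr
        have e2 : α / 10 ≤ α ^ 2 * b / 400 := by nlinarith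
        nlinarith
      refine (Real.exp_le_exp.2 h3).trans ?_
      rw [logPot, if_neg hwv0, show ∀ x : ℝ, -2 * x = -(x + x) by intro x; ring, Real.exp_neg,
        Real.exp_add, Real.exp_log (by linarith), one_div_mul_one_div, ← one_div]
      refine one_div_le_one_div_of_le (by positivity) ?_
      nlinarith
    refine (Finset.sum_le_sum hterm).trans ?_
    rw [← Finset.mul_sum]
    have h1 := sum_one_div_normSq_sq_le (W.image fun w : verts K => (w : ℂ) - v) fun z hz => by
      obtain ⟨w, hw, rfl⟩ := Finset.mem_image.1 hz
      exact ⟨sub_mem_lattice w.2.1.1 v.2.1.1, sub_ne_zero.2 fun h => hne w hw (Subtype.ext h)⟩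
    rw [Finset.sum_image fun a _ b _ h => Subtype.ext (sub_left_injective h)] at h1
    linarith

end Barrier

/-! ### Repulsion data of the explored set -/

section Explored
open Matrix

variable {K : Set ℂ} {U I Im Ip : Finset ℂ}

lemma mem_verts_or_mem_bdry {z : ℂ} (hz : z ∈ K ∩ lattice) : z ∈ verts K ∪ bdry K := by
  by_cases h : z ∈ bdry K
  · exact Or.inr h
  · exact Or.inl ⟨⟨hz.2, hz.1⟩, h⟩

lemma mem_reach {v : ℂ} : v ∈ reach K U I ↔ v ∈ I ∧ 0 < hmSum K U I v := by
  classical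
  rw [reach, Finset.mem_filter]

lemma hmSum_nonneg (h : Admissible K U I) {W : Set ℂ} (hW : W ⊆ lattice) (w : ℂ) :
    0 ≤ hmSum K U W w :=
  Finset.sum_nonneg fun _ hu =>
    hm_nonneg h.domain.isCompact hW w (mem_verts_or_mem_bdry (h.subset_U hu))

/-- Harmonic measure from `U` splits into a sum over the interior points of `U` off `W`, and the
contribution of a point of `U` that is itself in the target set. -/
lemma hmSum_eq (h : Admissible K U I) [Fintype (verts K)] {W : Set ℂ} (hW : W ⊆ lattice) {w : ℂ}
    (hw : w ∈ W ∪ bdry K) [DecidablePred (· ∈ W)] :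
    hmSum K U W w = ∑ u : verts K, (if (u : ℂ) ∈ U ∧ (u : ℂ) ∉ W then 1 else 0) * hm K W u w
      + if w ∈ U then 1 else 0 := by
  classical
  have h1 : ∀ u ∈ U, hm K W u w = (if u ∈ verts K ∧ u ∉ W then hm K W u w else 0)
      + if w = u then 1 else 0 := by
    intro u hu
    have huK := mem_verts_or_mem_bdry (h.subset_U hu)
    by_cases huW : u ∈ W ∪ bdry K
    · rw [if_neg, hm_of_mem h.domain.isCompact hW huK huW, zero_add]
      · simp only [eq_comm]
      · rintro ⟨h1, h2⟩
        exact huW.elim h2 h1.2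
    · rw [if_pos, if_neg, add_zero]
      · rintro rfl; exact huW hw
      · exact ⟨huK.resolve_right fun h' => huW (Or.inr h'), fun h' => huW (Or.inl h')⟩
  rw [hmSum, Finset.sum_congr rfl h1, Finset.sum_add_distrib, Finset.sum_ite_eq]
  congr 1
  rw [Finset.sum_set_coe (verts K)
    (f := fun u => (if u ∈ U ∧ u ∉ W then 1 else 0) * hm K W u w)]
  simp only [ite_mul, one_mul, zero_mul]
  rw [← Finset.sum_filter, ← Finset.sum_filter]
  refine Finset.sum_congr ?_ fun _ _ => rfl
  ext u
  simp only [Finset.mem_filter, Set.mem_toFinset]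
  tauto

/-- Points of `U` in `I` are reached at once. -/
lemma mem_reach_of_mem (h : Admissible K U I) {v : ℂ} (hvU : v ∈ U) (hvI : v ∈ I) :
    v ∈ reach K U I := by
  have hIl : (I : Set ℂ) ⊆ lattice := fun z hz => (h.subset_I hz).2
  refine mem_reach.2 ⟨hvI, ?_⟩
  have h1 : hm K I v v = 1 := by
    rw [hm_of_mem h.domain.isCompact hIl (mem_verts_or_mem_bdry (h.subset_U hvU)) (Or.inl hvI),
      if_pos rfl]
  calc (0 : ℝ) < hm K I v v := by rw [h1]; exact one_pos
    _ ≤ hmSum K U I v := Finset.single_le_sum (f := fun u => hm K I u v) (fun u hu =>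
      hm_nonneg h.domain.isCompact hIl v (mem_verts_or_mem_bdry (h.subset_U hu))) hvU

lemma notMem_bdry_of_mem_reach (h : Admissible K U I) {v : ℂ} (hv : v ∈ reach K U I) {z : ℂ}
    (hz : ‖z - v‖ < 1) : z ∉ bdry K :=
  notMem_bdry_of_norm_sub_lt (h.subset_I (mem_reach.1 hv).1).2 (h.edges_subset v hv) hz

/-- Explored points are interior, because their four edges are contained in `K`. -/
lemma mem_verts_of_mem_reach (h : Admissible K U I) {v : ℂ} (hv : v ∈ reach K U I) :
    v ∈ verts K :=
  (mem_verts_or_mem_bdry (h.subset_I (mem_reach.1 hv).1)).resolve_right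
    (notMem_bdry_of_mem_reach h hv (by simp))

lemma sum_reach_eq [Fintype (verts K)] (h : Admissible K U I) (G : ℂ → ℝ) :
    ∑ v ∈ reach K U I, G v
      = ∑ v ∈ Finset.univ.filter fun v : verts K => (v : ℂ) ∈ reach K U I, G v := by
  classical
  rw [Finset.sum_filter, Finset.sum_set_coe (verts K)
    (f := fun v => if v ∈ reach K U I then G v else 0), ← Finset.sum_filter]
  refine Finset.sum_congr ?_ fun _ _ => rfl
  ext v
  simp only [Finset.mem_filter, Set.mem_toFinset]
  exact ⟨fun hv => ⟨mem_verts_of_mem_reach h hv, hv⟩, fun hv => hv.2⟩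

lemma hmTotal_eq (h : Admissible K U I) : hmTotal K U I = ∑ v ∈ reach K U I, hmSum K U I v := by
  classical
  rw [hmTotal, reach, Finset.sum_filter]
  refine Finset.sum_congr rfl fun w _ => ?_
  split_ifs with hw
  · rfl
  · exact le_antisymm (not_lt.1 hw) (hmSum_nonneg h (fun z hz => (h.subset_I hz).2) w)

lemma xi_mul_hmTotal (hH : 0 < hmTotal K U I) : xi K U I * hmTotal K U I
    = sSup ((fun w => hmSum K U (↑I \ ↑(reach K U I)) w) '' (reach' K U I : Set ℂ)) := by
  rw [xi]; field_simp

lemma hmSum_le_xi_mul (hH : 0 < hmTotal K U I) {w : ℂ} (hw : w ∈ I)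
    (hpos : 0 < hmSum K U (↑I \ ↑(reach K U I)) w) :
    hmSum K U (↑I \ ↑(reach K U I)) w ≤ xi K U I * hmTotal K U I := by
  classical
  rw [xi_mul_hmTotal hH]
  refine le_csSup ((Finset.finite_toSet _).image _).bddAbove ⟨w, ?_, rfl⟩
  rw [Finset.mem_coe, reach', Finset.mem_filter]
  exact ⟨hw, hpos⟩

/-- The edge from an explored point to a neighbour has conductance `1 / 4`. -/
lemma conductance_of_mem_reach (h : Admissible K U I) {v w : ℂ} (hv : v ∈ reach K U I)
    (hvw : Nbr v w) : conductance (lattice ∪ bdry K) v w = 1 / 4 := by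
  have hvv := mem_verts_of_mem_reach h hv
  obtain ⟨l, hl⟩ := exists_isStar h.domain.isCompact hvv
  obtain ⟨d, rfl⟩ := hvw.exists_dir
  have := hl.conductance_eq d
  rw [hl.eq_one hvv.1.1 (fun z => notMem_bdry_of_mem_reach h hv) d] at this
  simpa using this

/-- The potential of the repulsion data is the difference `γ - δ` of the potentials of `U` absorbed on
`I \ D` and on `I`. -/
lemma exists_repulsionData [Fintype (verts K)] [DecidableEq (verts K)] (h : Admissible K U I)
    (hI : Im ∪ Ip = I) (hdisj : Disjoint Im Ip)
    (hD : reach K U I ⊆ Im) (hnbr : ∀ v ∈ reach K U I, ∃ w ∈ Ip, Nbr v w)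
    (hH : 0 < hmTotal K U I) {lam : ℝ} (hlam : 0 ≤ lam) :
    ∃ g, RepulsionData (netMatrix K) {v : verts K | (v : ℂ) ∈ reach K U I}
      {v : verts K | (v : ℂ) ∈ Ip} {v : verts K | (v : ℂ) ∈ Im ∧ (v : ℂ) ∉ reach K U I}
      (fun v => if (v : ℂ) ∈ reach K U I then hmSum K U I v else 0) g lam (barrierCharge lam)
      (xi K U I * hmTotal K U I) := by
  classical
  have hK := h.domain.isCompact
  have hIl : (I : Set ℂ) ⊆ lattice := fun z hz => (h.subset_I hz).2
  set W : Set ℂ := ↑I \ ↑(reach K U I) with hW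
  have hWl : W ⊆ lattice := fun z hz => hIl hz.1
  have hWU : ∀ z ∈ W, z ∉ U := fun z hz hzU => hz.2 (mem_reach_of_mem h hzU hz.1)
  have hIp : ∀ z ∈ Ip, z ∈ W := fun z hz =>
    ⟨by rw [← hI]; exact Finset.mem_coe.2 (Finset.mem_union_right _ hz),
      fun hr => Finset.disjoint_left.1 hdisj (hD hr) hz⟩
  have hWsplit : ∀ z, z ∈ W ↔ z ∈ Ip ∨ (z ∈ Im ∧ z ∉ reach K U I) := fun z => by
    refine ⟨fun hz => ?_, fun hz => hz.elim (hIp z) fun hz => ⟨?_, hz.2⟩⟩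
    · have : z ∈ Im ∪ Ip := by rw [hI]; exact hz.1
      rcases Finset.mem_union.1 this with h1 | h1
      · exact Or.inr ⟨h1, hz.2⟩
      · exact Or.inl h1
    · rw [← hI]; exact Finset.mem_coe.2 (Finset.mem_union_left _ hz.1)
  obtain ⟨F, hF⟩ := exists_isTransient hK
  -- potentials of the charge `U`, absorbed on `W` and on `I`
  set kW : verts K → ℝ := fun u => if (u : ℂ) ∈ U ∧ (u : ℂ) ∉ W then 1 else 0 with hkW
  set kI : verts K → ℝ := fun u => if (u : ℂ) ∈ U ∧ (u : ℂ) ∉ (I : Set ℂ) then 1 else 0 with hkI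
  obtain ⟨γ, hγ0, hγ⟩ := hF.exists_dirichlet {u : verts K | (u : ℂ) ∈ W} kW
  obtain ⟨δ, hδ0, hδ⟩ := hF.exists_dirichlet {u : verts K | (u : ℂ) ∈ (I : Set ℂ)} kI
  have hkW0 : ∀ u : verts K, (u : ℂ) ∈ W → kW u = 0 := fun u hu => if_neg fun h => h.2 hu
  have hkI0 : ∀ u : verts K, (u : ℂ) ∈ (I : Set ℂ) → kI u = 0 := fun u hu => if_neg fun h => h.2 hu
  have hγnn : ∀ u, 0 ≤ γ u := hF.nonneg_of_superharmonic _ (fun i hi => (hγ0 i hi).ge)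
    fun i hi => by rw [hγ i hi, hkW]; dsimp only; split_ifs <;> simp
  have hδnn : ∀ u, 0 ≤ δ u := hF.nonneg_of_superharmonic _ (fun i hi => (hδ0 i hi).ge)
    fun i hi => by rw [hδ i hi, hkI]; dsimp only; split_ifs <;> simp
  have hQg : ∀ u, (netMatrix K *ᵥ (γ - δ)) u = (netMatrix K *ᵥ γ) u - (netMatrix K *ᵥ δ) u :=
    fun u => by rw [mulVec_sub, Pi.sub_apply]
  have hreachW : ∀ z ∈ reach K U I, z ∉ W := fun z hz hzW => hzW.2 hz
  have hchargeD : ∀ v : verts K, (v : ℂ) ∈ reach K U I →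
      (netMatrix K *ᵥ (γ - δ)) v = hmSum K U I v := by
    intro v hv
    have hvI : (v : ℂ) ∈ (I : Set ℂ) := (mem_reach.1 hv).1
    rw [hQg, hγ v (hreachW v hv), mulVec_potential hK hIl hδ0 hvI hδ hkI0,
      hmSum_eq h hIl (Or.inl hvI), hkW]
    dsimp only
    have : (v : ℂ) ∉ W := hreachW v hv
    simp only [this, not_false_eq_true, and_true]
    ring
  have hchargeO : ∀ v : verts K, (v : ℂ) ∉ reach K U I → (v : ℂ) ∉ W →
      (netMatrix K *ᵥ (γ - δ)) v = 0 := by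
    intro v hv hvW
    have hvI : (v : ℂ) ∉ (I : Set ℂ) := fun hvI => hvW ⟨hvI, hv⟩
    rw [hQg, hγ v hvW, hδ v hvI, hkW, hkI]
    dsimp only
    simp only [hvW, hvI, not_false_eq_true, and_true, sub_self]
  have hg0 : ∀ v : verts K, (v : ℂ) ∈ W → (γ - δ) v = 0 := fun v hv => by
    rw [Pi.sub_apply, hγ0 v hv, hδ0 v hv.1, sub_zero]
  have hgnn : ∀ v, 0 ≤ (γ - δ) v := hF.nonneg_of_superharmonic {u : verts K | (u : ℂ) ∈ W}
    (fun i hi => (hg0 i hi).ge) fun i hi => by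
      by_cases hr : (i : ℂ) ∈ reach K U I
      · rw [hchargeD i hr]; exact (mem_reach.1 hr).2.le
      · rw [hchargeO i hr hi]
  -- the potential at an explored point is controlled by the charge absorbed at its neighbour
  have hγle : ∀ v : verts K, (v : ℂ) ∈ reach K U I → ∀ w ∈ Ip, Nbr v w →
      γ v ≤ 4 * hmSum K U W w := by
    intro v hv w hw hvw
    have hwW := hIp w hw
    have hc := conductance_of_mem_reach h hv hvw
    have hsum := hmSum_eq h hWl (Or.inl hwW)
    rw [if_neg (hWU w hwW), add_zero] at hsum
    rcases mem_verts_or_mem_bdry (h.subset_I hwW.1) with hwv | hwb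
    · have h1 := mulVec_potential hK hWl hγ0 (w := ⟨w, hwv⟩) hwW hγ hkW0
      have h2 : (netMatrix K *ᵥ γ) ⟨w, hwv⟩ ≤ netMatrix K ⟨w, hwv⟩ v * γ v := by
        rw [mulVec, dotProduct, ← Finset.add_sum_erase _ _ (Finset.mem_univ v),
          add_le_iff_nonpos_right]
        refine Finset.sum_nonpos fun j _ => ?_
        rcases eq_or_ne (⟨w, hwv⟩ : verts K) j with rfl | hj
        · rw [hγ0 ⟨w, hwv⟩ hwW, mul_zero]
        · exact mul_nonpos_of_nonpos_of_nonneg (hF.offDiag _ _ hj) (hγnn j)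
      have h3 : netMatrix K ⟨w, hwv⟩ v = -(1 / 4) := by
        rw [netMatrix_offDiag, conductance_comm, hc]
        rintro rfl
        exact hwW.2 hv
      rw [h3, h1, ← hsum] at h2
      linarith
    · have h1 := sum_conductance_mul_potential hK hWl hγ0 hwb hγ hkW0
      have h2 : γ v * conductance (lattice ∪ bdry K) v w
          ≤ ∑ u : verts K, γ u * conductance (lattice ∪ bdry K) u w :=
        Finset.single_le_sum (f := fun u : verts K => γ u * conductance (lattice ∪ bdry K) u w)
          (fun u _ => mul_nonneg (hγnn u) (conductance_nonneg _ _ _)) (Finset.mem_univ v)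
      rw [h1, ← hsum, hc] at h2
      linarith
  have hQvv : ∀ v : verts K, (v : ℂ) ∈ reach K U I → netMatrix K v v = 1 := by
    intro v hv
    obtain ⟨l, hl⟩ := exists_isStar hK v.2
    rw [netMatrix, if_pos rfl, hl.totalConductance_eq]
    simp [hl.eq_one v.2.1.1 fun z => notMem_bdry_of_mem_reach h hv]
  have hgpos : ∀ v : verts K, (v : ℂ) ∈ reach K U I → 0 < (γ - δ) v := by
    intro v hv
    have h1 : (netMatrix K *ᵥ (γ - δ)) v ≤ (γ - δ) v := by
      rw [mulVec, dotProduct, ← Finset.add_sum_erase _ _ (Finset.mem_univ v), hQvv v hv, one_mul,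
        add_le_iff_nonpos_right]
      exact Finset.sum_nonpos fun j hj => mul_nonpos_of_nonpos_of_nonneg
        (hF.offDiag _ _ (Finset.ne_of_mem_erase hj).symm) (hgnn j)
    rw [hchargeD v hv] at h1
    exact (mem_reach.1 hv).2.trans_le h1
  have hgle : ∀ v : verts K, (v : ℂ) ∈ reach K U I →
      (γ - δ) v ≤ 4 * (xi K U I * hmTotal K U I) := by
    intro v hv
    obtain ⟨w, hw, hvw⟩ := hnbr v hv
    have h1 := hγle v hv w hw hvw
    have h2 : (γ - δ) v ≤ γ v := sub_le_self _ (hδnn v)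
    have h3 := hgpos v hv
    have := hmSum_le_xi_mul hH (hIp w hw).1 (by linarith)
    linarith
  have hPR : ∀ v : verts K, v ∈ (Finset.univ.filter fun v : verts K => (v : ℂ) ∈ Ip) ∪
      (Finset.univ.filter fun v : verts K => (v : ℂ) ∈ Im ∧ (v : ℂ) ∉ reach K U I) ↔ (v : ℂ) ∈ W :=
    fun v => by simp [hWsplit]
  refine ⟨γ - δ, hF.posDef, hF.offDiag, ?_, ?_, ?_, ?_, netMatrix_mulVec_one_nonneg hK, hlam, ?_,
    ?_, ?_, ?_, hgnn, ?_, ?_, ?_, ?_, ?_, ?_⟩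
  · refine Finset.disjoint_left.2 fun v hv hv' => ?_
    simp only [Finset.mem_filter, Finset.mem_univ, true_and] at hv hv'
    exact hreachW v hv (hIp v hv')
  · refine Finset.disjoint_left.2 fun v hv hv' => ?_
    simp only [Finset.mem_filter, Finset.mem_univ, true_and] at hv hv'
    exact hv'.2 hv
  · refine Finset.disjoint_left.2 fun v hv hv' => ?_
    simp only [Finset.mem_filter, Finset.mem_univ, true_and] at hv hv'
    exact Finset.disjoint_left.1 hdisj hv'.1 hv
  · intro v hv
    exact hQvv v (by simpa using hv)
  · have := Real.log_nonneg (by norm_num : (1 : ℝ) ≤ 64)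
    unfold barrierCharge
    positivity
  · obtain ⟨v, hv⟩ : (reach K U I).Nonempty := by
      rw [Finset.nonempty_iff_ne_empty]
      intro he
      rw [hmTotal_eq h, he, Finset.sum_empty] at hH
      exact hH.false
    have hvv := mem_verts_of_mem_reach h hv
    have := hgpos ⟨v, hvv⟩ hv
    have := hgle ⟨v, hvv⟩ hv
    linarith
  · intro v
    split_ifs with hv
    · exact (mem_reach.1 hv).2.le
    · exact le_rfl
  · intro v hv
    exact if_neg (by simpa using hv)
  · exact fun v hv => hg0 v ((hPR v).1 hv)
  · intro v hv
    have hv' : (v : ℂ) ∈ reach K U I := by simpa using hv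
    rw [hchargeD v hv', if_pos hv']
  · intro v hv hv'
    exact hchargeO v (by simpa using hv) fun h => hv' ((hPR v).2 h)
  · intro v hv
    exact hgle v (by simpa using hv)
  · intro v hv
    have hv' : (v : ℂ) ∈ reach K U I := by simpa using hv
    obtain ⟨w, hw, hvw⟩ := hnbr v hv'
    have hc := conductance_of_mem_reach h hv' hvw
    rcases mem_verts_or_mem_bdry (h.subset_I (hIp w hw).1) with hwv | hwb
    · refine Or.inl ⟨⟨w, hwv⟩, by simpa using hw, ?_⟩
      rw [netMatrix_offDiag, hc]
      rintro rfl
      exact (hIp _ hw).2 hv'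
    · refine Or.inr ?_
      obtain ⟨l, hl⟩ := exists_isStar hK v.2
      obtain ⟨d, rfl⟩ := hvw.exists_dir
      have hone := hl.eq_one v.2.1.1 (fun z => notMem_bdry_of_mem_reach h hv')
      rw [netMatrix_mulVec_one hl]
      refine le_trans ?_ (Finset.single_le_sum (fun e _ => div_nonneg
        (Set.indicator_nonneg (by simp) _) (by linarith [hl.pos e])) (Finset.mem_univ d))
      rw [hone, Complex.ofReal_one, one_mul, Set.indicator_of_mem hwb]
      norm_num
  · intro v hv
    have hv' : (v : ℂ) ∈ reach K U I := by simpa using hv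
    exact barrier_netMatrix hK (fun z => notMem_bdry_of_mem_reach h hv')
      (fun hvW => hreachW v hv' ((hPR v).1 hvW)) hlam

end Explored

/-! ### The law of the field -/

section Law
open Matrix

variable {K : Set ℂ} {Ω : Type*} [MeasurableSpace Ω] {P : Measure Ω} {f : ℂ → ℝ} {φ : ℂ → Ω → ℝ}

lemma green_of_mem_bdry {u : ℂ} (hu : u ∈ bdry K) (v : ℂ) : green K u v = 0 := by
  have : ∀ N n, killedProb N (bdry K) n u v = 0 := by
    rintro N (_ | n) <;> simp [killedProb, hu]
  simp [green, this]

lemma IsGFF.ae_eq_const (h : IsGFF P K f φ) [IsProbabilityMeasure P] {z : ℂ} (hz : z ∈ bdry K) :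
    ∀ᵐ ω ∂P, φ z ω = ∫ ω, φ z ω ∂P := by
  have hG := h.gaussian.hasGaussianLaw_eval ⟨z, hz.1⟩
  refine ae_eq_integral_of_variance_eq_zero hG.memLp_two ?_
  rw [← covariance_self hG.aemeasurable]
  exact (h.cov z hz.1 z hz.1).trans (green_of_mem_bdry hz z)

lemma IsGFF.hasGaussianLaw_verts (h : IsGFF P K f φ) [Fintype (verts K)] :
    HasGaussianLaw (fun ω (i : verts K) => φ i ω) P :=
  ((h.gaussian.comp_right fun i : verts K => ⟨i, i.2.1.2⟩).hasGaussianLaw Finset.univ).map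
    (ContinuousLinearMap.pi fun i : verts K =>
      ContinuousLinearMap.proj (R := ℝ) (φ := fun _ => ℝ) (⟨i, Finset.mem_univ i⟩ : {j // j ∈ _}))

/-- On interior lattice points the field has a Gaussian density, with precision matrix the network
matrix and drift at most `lam` times the killing rate. -/
lemma IsGFF.exists_map_eq (h : IsGFF P K f φ) (hK : IsCompact K) [Fintype (verts K)] {lam : ℝ}
    (hf : ∀ z ∈ bdry K, |f z| ≤ lam) : ∃ κ : verts K → ℝ, κ ≤ lam • netMatrix K *ᵥ 1 ∧
      P.map (fun ω (i : verts K) => φ i ω) = gaussMeasure (netMatrix K) κ := by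
  classical
  exact ⟨_, netMatrix_mulVec_mean_le hK hf, map_eq_gaussMeasure h.hasGaussianLaw_verts
    (isTransient_posDef hK) (fun i => h.mean i i.2.1.2) (netMatrix_mul_green hK)
    fun i j => h.cov i i.2.1.2 j j.2.1.2⟩

/-- A sign event of positive probability only concerns the interior lattice points, because the
field is deterministic at the boundary. -/
lemma IsGFF.signEvent_ae_eq (h : IsGFF P K f φ) [IsProbabilityMeasure P] {Im Ip : Finset ℂ}
    (hIm : (Im : Set ℂ) ⊆ K ∩ lattice) (hIp : (Ip : Set ℂ) ⊆ K ∩ lattice)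
    (hpos : P (signEvent φ Im Ip) ≠ 0) :
    signEvent φ Im Ip =ᵐ[P] (fun ω (i : verts K) => φ i ω) ⁻¹'
      {x | (∀ v : verts K, (v : ℂ) ∈ Im → x v < 0) ∧ ∀ v : verts K, (v : ℂ) ∈ Ip → 0 ≤ x v} := by
  have hconst : ∀ᵐ ω ∂P, ∀ z ∈ Im ∪ Ip, z ∈ bdry K → φ z ω = ∫ ω, φ z ω ∂P := by
    refine (Filter.eventually_all_finset _).2 fun z _ => ?_
    by_cases hz : z ∈ bdry K
    · filter_upwards [h.ae_eq_const hz] with ω hω _ using hω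
    · exact Filter.Eventually.of_forall fun ω hz' => absurd hz' hz
  -- a configuration at which both the event and the deterministic boundary values are realized
  obtain ⟨ω₀, ⟨hω₀m, hω₀p⟩, hω₀⟩ := ((frequently_ae_mem_iff.2 hpos).and_eventually hconst).exists
  filter_upwards [hconst] with ω hω
  refine propext ⟨fun hE => ⟨fun v hv => hE.1 v hv, fun v hv => hE.2 v hv⟩,
    fun hE => ⟨fun v hv => ?_, fun v hv => ?_⟩⟩
  · rcases mem_verts_or_mem_bdry (hIm hv) with hvv | hvb
    · exact hE.1 ⟨v, hvv⟩ hv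
    · rw [hω v (Finset.mem_union_left _ hv) hvb, ← hω₀ v (Finset.mem_union_left _ hv) hvb]
      exact hω₀m v hv
  · rcases mem_verts_or_mem_bdry (hIp hv) with hvv | hvb
    · exact hE.2 ⟨v, hvv⟩ hv
    · rw [hω v (Finset.mem_union_right _ hv) hvb, ← hω₀ v (Finset.mem_union_right _ hv) hvb]
      exact hω₀p v hv

end Law

end MetricGFF

/-! ### Conditioning the field on its signs -/

theorem proposition3p1 :
    ∃ r : ℝ → ℝ, Tendsto r (𝓝 0) (𝓝 0) ∧
      ∀ lam : ℝ, 0 ≤ lam → ∃ Δ : ℝ, 0 < Δ ∧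
        ∀ (K : Set ℂ) (U I Im Ip : Finset ℂ),
          MetricGFF.Admissible K U I →
          Im ∪ Ip = I → Disjoint Im Ip →
          MetricGFF.reach K U I ⊆ Im →
          (∀ v ∈ MetricGFF.reach K U I, ∃ w ∈ Ip, MetricGFF.Nbr v w) →
          ∀ f : ℂ → ℝ, (∀ v ∈ MetricGFF.bdry K, |f v| ≤ lam) →
          ∀ {Ω : Type*} [MeasurableSpace Ω] (P : Measure Ω) [IsProbabilityMeasure P]
            (φ : ℂ → Ω → ℝ),
            MetricGFF.IsGFF P K f φ →
            P (MetricGFF.signEvent φ Im Ip) ≠ 0 →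
            1 - r (MetricGFF.xi K U I) ≤
              (ProbabilityTheory.cond P (MetricGFF.signEvent φ Im Ip)).real
                {ω | MetricGFF.weightedField K U I φ ω ≤ -Δ * MetricGFF.hmTotal K U I} := by
  open MetricGFF in
  classical
  refine ⟨fun x => if x ≤ 0 then 0 else 2 * Real.exp (-(1 / (80 * x))), ?_, fun lam hlam =>
    ⟨repulsionConst lam (barrierCharge lam), repulsionConst_pos hlam, ?_⟩⟩
  · -- `exp (-y) ≤ 1 / y` for `y = 1 / (80 x)`
    refine squeeze_zero (g := fun x => 160 * |x|) (fun x => ?_) (fun x => ?_) ?_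
    · split_ifs <;> positivity
    · split_ifs with hx
      · positivity
      · push Not at hx
        rw [abs_of_pos hx, Real.exp_neg]
        have h1 : 1 / (80 * x) ≤ Real.exp (1 / (80 * x)) := by
          linarith [Real.add_one_le_exp (1 / (80 * x))]
        have h2 : (Real.exp (1 / (80 * x)))⁻¹ ≤ (1 / (80 * x))⁻¹ :=
          inv_anti₀ (by positivity) h1
        rw [one_div, inv_inv] at h2
        rw [one_div]
        linarith
    · have : Tendsto (fun x : ℝ => 160 * |x|) (𝓝 0) (𝓝 (160 * |0|)) :=
        (continuous_const.mul continuous_abs).tendsto 0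
      simpa using this
  intro K U I Im Ip hA hI hdisj hD hnbr f hf Ω _ P _ φ hφ hpos
  have hK := hA.domain.isCompact
  have := ProbabilityTheory.cond_isProbabilityMeasure hpos
  have : Fintype (verts K) := (finite_verts hK).fintype
  have hH0 : 0 ≤ hmTotal K U I := by
    rw [hmTotal_eq hA]
    exact Finset.sum_nonneg fun v hv => (mem_reach.1 hv).2.le
  rcases hH0.eq_or_lt with hH | hH
  · -- nothing is explored
    have hempty : reach K U I = ∅ := by
      rw [hmTotal_eq hA] at hH
      rw [Finset.eq_empty_iff_forall_notMem]
      intro v hv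
      have := (Finset.sum_eq_zero_iff_of_nonneg fun v hv => (mem_reach.1 hv).2.le).1 hH.symm v hv
      exact (mem_reach.1 hv).2.ne' this
    have huniv : {ω | weightedField K U I φ ω
        ≤ -repulsionConst lam (barrierCharge lam) * hmTotal K U I} = Set.univ := by
      rw [Set.eq_univ_iff_forall]
      intro ω
      simp [weightedField, hempty, ← hH]
    rw [huniv, probReal_univ, sub_le_self_iff]
    dsimp only
    split_ifs <;> positivity
  obtain ⟨g, hg⟩ := exists_repulsionData hA hI hdisj hD hnbr hH hlam
  obtain ⟨κ, hκ, hmap⟩ := hφ.exists_map_eq hK hf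
  have hQ := hg.posDef
  set Δ := repulsionConst lam (barrierCharge lam)
  set X : Ω → verts K → ℝ := fun ω i => φ i ω with hX
  have hXm : AEMeasurable X P := hφ.hasGaussianLaw_verts.aemeasurable
  have hsumH : ∑ v ∈ Finset.univ.filter (fun v : verts K => (v : ℂ) ∈ reach K U I),
      (if (v : ℂ) ∈ reach K U I then hmSum K U I v else 0) = hmTotal K U I := by
    rw [hmTotal_eq hA, sum_reach_eq hA]
    exact Finset.sum_congr rfl fun v hv => if_pos (Finset.mem_filter.1 hv).2
  have hsumY : ∀ ω, ∑ v ∈ Finset.univ.filter (fun v : verts K => (v : ℂ) ∈ reach K U I),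
      (if (v : ℂ) ∈ reach K U I then hmSum K U I v else 0) * X ω v
        = weightedField K U I φ ω := by
    intro ω
    rw [weightedField, sum_reach_eq hA fun v => hmSum K U I v * φ v ω]
    exact Finset.sum_congr rfl fun v hv => by rw [if_pos (Finset.mem_filter.1 hv).2]
  have hmass := hg.mass_le hκ
  rw [hsumH] at hmass
  set S : Set (verts K → ℝ) := {x | (∀ v ∈ Finset.univ.filter (fun v : verts K =>
      (v : ℂ) ∈ reach K U I), x v < 0) ∧ (∀ w ∈ Finset.univ.filter (fun v : verts K =>
      (v : ℂ) ∈ Ip), 0 ≤ x w) ∧ ∀ w ∈ Finset.univ.filter (fun v : verts K =>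
      (v : ℂ) ∈ Im ∧ (v : ℂ) ∉ reach K U I), x w < 0} with hS
  set T : Set (verts K → ℝ) := {x | -Δ * hmTotal K U I
    < ∑ v ∈ Finset.univ.filter (fun v : verts K => (v : ℂ) ∈ reach K U I),
      (if (v : ℂ) ∈ reach K U I then hmSum K U I v else 0) * x v} with hT
  have hSm : MeasurableSet S :=
    (measurableSet_lt_on _ _).inter ((measurableSet_nonneg_on _).inter (measurableSet_lt_on _ _))
  have hTm : MeasurableSet T := measurableSet_lt measurable_const (by fun_prop)
  have hE : signEvent φ Im Ip =ᵐ[P] X ⁻¹' S := by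
    have hsub : ∀ J : Finset ℂ, J ⊆ I → (J : Set ℂ) ⊆ K ∩ lattice := fun J hJ =>
      (Finset.coe_subset.2 hJ).trans hA.subset_I
    refine (hφ.signEvent_ae_eq (hsub Im (hI ▸ Finset.subset_union_left))
      (hsub Ip (hI ▸ Finset.subset_union_right)) hpos).trans (Eq.eventuallyEq ?_)
    congr 1
    ext x
    simp only [hS, Set.mem_ofPred_eq, Finset.mem_filter, Finset.mem_univ, true_and]
    constructor
    · rintro ⟨h1, h2⟩
      exact ⟨fun v hv => h1 v (hD hv), h2, fun v hv => h1 v hv.1⟩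
    · rintro ⟨h1, h2, h3⟩
      refine ⟨fun v hv => ?_, h2⟩
      by_cases hr : (v : ℂ) ∈ reach K U I
      exacts [h1 v hr, h3 v ⟨hv, hr⟩]
  have hEnull : NullMeasurableSet (signEvent φ Im Ip) P :=
    (hXm.nullMeasurableSet_preimage hSm).congr hE.symm
  have hPS : P (signEvent φ Im Ip) = gaussMeasure (netMatrix K) κ S := by
    rw [measure_congr hE, ← hmap, Measure.map_apply_of_aemeasurable hXm hSm]
  have hgoal : {ω | weightedField K U I φ ω ≤ -Δ * hmTotal K U I} = X ⁻¹' Tᶜ := by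
    ext ω
    simp only [hT, Set.mem_preimage, Set.mem_compl_iff, Set.mem_ofPred_eq, not_lt, hsumY]
  have hPT : P ({ω | weightedField K U I φ ω ≤ -Δ * hmTotal K U I} ∩ signEvent φ Im Ip)
      = gaussMeasure (netMatrix K) κ (S \ T) := by
    rw [hgoal, measure_congr ((ae_eq_refl _).inter hE), ← Set.preimage_inter, ← hmap,
      Measure.map_apply_of_aemeasurable hXm (hSm.diff hTm), Set.inter_comm, Set.sdiff_eq]
  have hM := mass_univ_pos (κ := κ) hQ
  have hSpos : 0 < mass (netMatrix K) κ S := by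
    rw [hPS, gaussMeasure_apply hQ] at hpos
    have := ENNReal.ofReal_pos.1 (pos_iff_ne_zero.2 hpos)
    exact (div_pos_iff_of_pos_right hM).1 this
  have hsplit := mass_inter_add_diff (κ := κ) hQ S hTm
  have hcond : (ProbabilityTheory.cond P (signEvent φ Im Ip)).real
      {ω | weightedField K U I φ ω ≤ -Δ * hmTotal K U I}
        = mass (netMatrix K) κ (S \ T) / mass (netMatrix K) κ S := by
    rw [Measure.real, ProbabilityTheory.cond, Measure.smul_apply,
      Measure.restrict_apply₀' hEnull, hPT, hPS, gaussMeasure_apply hQ, gaussMeasure_apply hQ,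
      smul_eq_mul, ENNReal.toReal_mul, ENNReal.toReal_inv,
      ENNReal.toReal_ofReal (div_nonneg (mass_nonneg _) hM.le),
      ENNReal.toReal_ofReal (div_nonneg (mass_nonneg _) hM.le)]
    field_simp
  have hxi : 0 < xi K U I := pos_of_mul_pos_left hg.beta_pos hH.le
  rw [hcond, le_div_iff₀ hSpos]
  simp only [if_neg (not_le.2 hxi)]
  have hexp : hmTotal K U I / (80 * (xi K U I * hmTotal K U I)) = 1 / (80 * xi K U I) := by
    field_simp
  rw [hexp] at hmass
  linarith
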